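/- Let $\gamma>2$ and let $\Pi$ be the improper marked Poisson line process of the plane: the Poisson point process on $\mathcal{L}^2\times(0,\infty)$ (lines $\ell$ of $\mathbb{R}^2$ marked by speed-limits $v$) with intensity measure $(\gamma-1)v^{-\gamma}\,\mathrm{d}v\,\mu_2(\mathrm{d}\ell)$, where $\mu_2(\mathrm{d}\ell)=\tfrac12\,\mathrm{d}r\,\mathrm{d}\theta$ is the isometry-invariant line measure ($\theta\in[0,\pi)$ is the angle that $\ell$ makes with the $x$-axis, $r\in\mathbb{R}$ its signed distance from the origin). For $v>0$ let $\mathcal{S}_v$ be the union of all lines of $\Pi$ with speed-limit at least $v$. A $\Pi$-path on $[0,T]$, $0<T<\infty$, is a locally Lipschitz map $\xi:[0,T]\to\mathbb{R}^2$ such that, for every $v>0$, the set of times $t$ with $|\xi'(t)|>v$ and $\xi(t)\notin\mathcal{S}_v$ is Lebesgue-null. It is a $\Pi$-geodesic if there is no $\Pi$-path from $\xi(0)$ to $\xi(T)$ on $[0,S]$ for any $S<T$. The path $\xi$ encounters a line $\ell$ of $\Pi$ properly at $\xi(t)\in\ell$ if there are $\varepsilon>0$ and a line $\widetilde\ell\neq\ell$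 of $\Pi$ such that the part of $\xi$ within the ball of radius $\varepsilon$ about $\xi(t)$ is not contained in $\ell$ but is contained in $\ell\cup\widetilde\ell$. Theorem. With probability $1$ the following holds simultaneously for every line $\ell$ of $\Pi$ and every $\Pi$-geodesic $\xi:[0,T]\to\mathbb{R}^2$. There are finitely many (possibly no) pairwise disjoint closed intervals $[a_i,b_i]\subseteq[0,T]$, $a_i\le b_i$, with $\{t\in[0,T]:\xi(t)\in\ell\}=\bigcup_i[a_i,b_i]$; the path $\xi$ maps $[a_i,b_i]$ onto the line segment between $\xi(a_i)$ and $\xi(b_i)$, and these segments, whose union is the intersection of $\xi$ with $\ell$, are pairwise disjoint. If $a_i<b_i$ and $a_i>0$, then $\xi$ encounters $\ell$ properly at $\xi(a_i)$, and $\xi(a_i)$ lies on a line of $\Pi$ other than $\ell$. If $a_i<b_i$ and $b_i<T$, then $\xi$ encounters $\ell$ properly at $\xi(b_i)$, and $\xi(b_i)$ lies on a line of $\Pi$ other than $\ell$. -/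

import Mathlib

open MeasureTheory ProbabilityTheory Set
open scoped ENNReal NNReal

noncomputable section

namespace PoissonRoads

/-! ### Poisson point processes as random sets -/

/-- The Poisson distribution with mean `m ∈ [0, ∞]`, as a measure on `ℕ∞`; for `m = ∞` it is
the unit mass at `∞`. -/
def poissonLaw (m : ℝ≥0∞) : Measure ℕ∞ :=
  if m = ∞ then Measure.dirac ⊤
  else (poissonMeasure m.toNNReal).map (fun n : ℕ => (n : ℕ∞))

/-- The random set `Φ` is a Poisson point process on `S` with intensity measure `m`: the numbers
of points in measurable sets `B` are random variables with the Poisson distribution of mean `m B`,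
and the numbers of points in finitely many pairwise disjoint measurable sets are independent. -/
structure IsPoissonProcess {S Ω : Type*} [MeasurableSpace S] [MeasurableSpace Ω]
    (m : Measure S) (P : Measure Ω) (Φ : Ω → Set S) : Prop where
  measurable_count : ∀ B : Set S, MeasurableSet B → Measurable (fun ω => (Φ ω ∩ B).encard)
  map_count : ∀ B : Set S, MeasurableSet B → P.map (fun ω => (Φ ω ∩ B).encard) = poissonLaw (m B)
  indep_count : ∀ (n : ℕ) (B : Fin n → Set S), (∀ i, MeasurableSet (B i)) →
    Pairwise (fun i j => Disjoint (B i) (B j)) →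
    iIndepFun (fun (i : Fin n) (ω : Ω) => (Φ ω ∩ B i).encard) P

/-! ### The space of lines of the plane and its invariant measure -/

/-- The Euclidean plane. -/
abbrev Plane : Type := EuclideanSpace ℝ (Fin 2)

/-- Line-space: the (undirected) lines of the plane. -/
def PlanarLine : Type := {ℓ : AffineSubspace ℝ Plane // Module.finrank ℝ ℓ.direction = 1}

instance : Membership Plane PlanarLine := ⟨fun ℓ x => x ∈ ℓ.1⟩

/-- The unit vector at angle `θ` to the first coordinate axis. -/
def unitVec (θ : ℝ) : Plane := !₂[Real.cos θ, Real.sin θ]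

/-- The unit vector perpendicular to `unitVec θ`. -/
def normalVec (θ : ℝ) : Plane := !₂[-Real.sin θ, Real.cos θ]

theorem unitVec_ne_zero (θ : ℝ) : unitVec θ ≠ 0 := by
  intro h
  have h0 : Real.cos θ = 0 := by simpa [unitVec] using congrArg (fun x : Plane => x 0) h
  have h1 : Real.sin θ = 0 := by simpa [unitVec] using congrArg (fun x : Plane => x 1) h
  have h2 := Real.sin_sq_add_cos_sq θ
  rw [h0, h1] at h2
  norm_num at h2

/-- The line that makes the angle `θ ∈ [0, π)` with the first coordinate axis and has signed
distance `r` from the origin. Every line is obtained from exactly one pair `(r, θ)`. -/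
def lineOfParams (p : ℝ × Ico (0 : ℝ) Real.pi) : PlanarLine :=
  ⟨AffineSubspace.mk' (p.1 • normalVec p.2) (Submodule.span ℝ {unitVec p.2}), by
    rw [AffineSubspace.direction_mk']
    exact finrank_span_singleton (unitVec_ne_zero _)⟩

/-- The σ-algebra of line-space, transported from the parameter space `ℝ × [0, π)`. -/
instance : MeasurableSpace PlanarLine := MeasurableSpace.map lineOfParams inferInstance

/-- The isometry-invariant line measure `½ dr dθ`, normalised so that the lines hitting a convex
body have measure half the perimeter of the body. -/
def lineMeasure : Measure PlanarLine :=
  Measure.map lineOfParams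
    ((1 / 2 : ℝ≥0∞) • (volume : Measure ℝ).prod (volume.comap (Subtype.val : Ico (0 : ℝ) Real.pi → ℝ)))

/-- The measure `(γ - 1) v ^ (-γ) dv` on the speeds `v > 0`. -/
def speedMeasure (γ : ℝ) : Measure ℝ :=
  (volume.restrict (Ioi 0)).withDensity (fun v => ENNReal.ofReal ((γ - 1) * v ^ (-γ)))

/-- The intensity measure `(γ - 1) v ^ (-γ) dv μ₂(dℓ)` on lines marked by speed-limits. -/
def markedLineIntensity (γ : ℝ) : Measure (PlanarLine × ℝ) :=
  lineMeasure.prod (speedMeasure γ)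

/-! ### Paths that obey the speed-limits -/

/-- The union of all the lines of `L` whose speed-limit is at least `v`. -/
def silhouette (L : Set (PlanarLine × ℝ)) (v : ℝ) : Set Plane :=
  {x | ∃ p ∈ L, v ≤ p.2 ∧ x ∈ p.1}

/-- `ξ`, restricted to `[0, T]`, is a path that for almost all time obeys the speed-limits of the
marked line pattern `L` (and is at rest for almost all the time spent off the lines of `L`). -/
structure IsPiPath (L : Set (PlanarLine × ℝ)) (T : ℝ) (ξ : ℝ → Plane) : Prop where
  pos : 0 < T
  locallyLipschitz : LocallyLipschitzOn (Icc 0 T) ξ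
  speed : ∀ v : ℝ, 0 < v → volume {t ∈ Ico 0 T | v < ‖deriv ξ t‖ ∧ ξ t ∉ silhouette L v} = 0

/-- `ξ`, restricted to `[0, T]`, is a minimum-time path between its end-points. -/
def IsPiGeodesic (L : Set (PlanarLine × ℝ)) (T : ℝ) (ξ : ℝ → Plane) : Prop :=
  IsPiPath L T ξ ∧
    ∀ S < T, ¬ ∃ η : ℝ → Plane, IsPiPath L S η ∧ η 0 = ξ 0 ∧ η S = ξ T

/-- The path `ξ` on `[0, T]` encounters the line `ℓ` properly at time `t`: it is on `ℓ` at time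
`t`, and within some ball about `ξ t` it is not contained in `ℓ` alone, but lies in the union
of `ℓ` and one further line of `L`. -/
def ProperEncounter (L : Set (PlanarLine × ℝ)) (T : ℝ) (ξ : ℝ → Plane) (ℓ : PlanarLine)
    (t : ℝ) : Prop :=
  t ∈ Icc 0 T ∧ ξ t ∈ ℓ ∧ ∃ ε > 0, ∃ q ∈ L, q.1 ≠ ℓ ∧
    (¬ ∀ u ∈ Icc 0 T, ξ u ∈ Metric.ball (ξ t) ε → ξ u ∈ ℓ) ∧
    (∀ u ∈ Icc 0 T, ξ u ∈ Metric.ball (ξ t) ε → ξ u ∈ ℓ ∨ ξ u ∈ q.1)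

/-- The point `x` lies on a line of `L` other than `ℓ`. -/
def OnAnotherLine (L : Set (PlanarLine × ℝ)) (ℓ : PlanarLine) (x : Plane) : Prop :=
  ∃ q ∈ L, q.1 ≠ ℓ ∧ x ∈ q.1

end PoissonRoads

end

/-! Almost surely the pattern of lines is `Generic`: locally finite above every positive speed, with
distinct lines and no triple crossings. For such a pattern most of the theorem is deterministic. A
Π-path is a Lipschitz path whose average speed is at most `v` on every time interval spent off the
lines of limit at least `v` (`Feasible`), and a Π-geodesic is such a path all of whose pieces take
the least time (`Geodesic`), hence is injective. Between two visits to a line it stays on the line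
unless it uses another line that is at least as fast, and right after a crossing it cannot change
from one of the two lines to the other. Hence just after or before any time it is either always or
never on a given line (`germ_right`, `germ_left`), and compactness yields finitely many intervals.
If the geodesic starts to follow a line at an interior time, then just before it either followed
another line through the same point, which gives the proper encounter, or its speed tended to `0`
(`SlowsDown`).

Slowing down is excluded by probability. Remove the line `p` from the pattern and consider the least
cost `V r` of reaching level `r` of the coordinate perpendicular to `p` (up to sign), as a function
of `r`. `V` is monotone. If a geodesic slows down before it follows `p`, its last perpendicular
displacement `1 / k` takes a time much longer than `1 / k`, and the left difference quotients of `V`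
at the position of `p` tend to infinity (`exists_isSteep`). But `V` depends only on the other lines
and on the angle and speed of `p`; by the Mecke formula the position of `p` is then distributed with
a density, and monotone functions are differentiable almost everywhere. So almost surely no line is
exceptional.

The cost is time plus a linear function of the end-point. Its slope along `p` refunds the time that
progress along `p` saves, since the geodesic goes on along `p`; its slope across `p` is chosen so
that overshooting `p` gains nothing, not even along a second line through the entry point. Only
countably many cost functions are used: a `Probe` consists of rational data, which is possible
because a geodesic follows some line in every time interval and so passes a point of a line with a
rational coordinate. For measurability, `value` is defined through discrete paths;
`Arrives.exists_admissible` and the compactness statement `exists_arrives_of_admissible` connect it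
to actual paths. -/

noncomputable section

namespace PoissonRoads

open Filter Topology

section

/-! ### Coordinates on line-space -/

/-- The coordinate of `x` perpendicular to the direction `θ`. -/
def nrm (θ : ℝ) (x : Plane) : ℝ := -Real.sin θ * x 0 + Real.cos θ * x 1

/-- The coordinate of `x` along the direction `θ`. -/
def tng (θ : ℝ) (x : Plane) : ℝ := Real.cos θ * x 0 + Real.sin θ * x 1

theorem continuous_nrm (θ : ℝ) : Continuous (nrm θ) := by unfold nrm; fun_prop

theorem continuous_tng (θ : ℝ) : Continuous (tng θ) := by unfold tng; fun_prop

theorem nrm_sub (θ : ℝ) (x y : Plane) : nrm θ (x - y) = nrm θ x - nrm θ y := by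
  simp [nrm]; ring

theorem tng_sub (θ : ℝ) (x y : Plane) : tng θ (x - y) = tng θ x - tng θ y := by
  simp [tng]; ring

theorem nrm_sq_add_tng_sq (θ : ℝ) (x : Plane) : nrm θ x ^ 2 + tng θ x ^ 2 = ‖x‖ ^ 2 := by
  rw [EuclideanSpace.norm_sq_eq]
  simp only [Fin.sum_univ_two, Real.norm_eq_abs, sq_abs, nrm, tng]
  linear_combination (x 0 ^ 2 + x 1 ^ 2) * Real.sin_sq_add_cos_sq θ

theorem abs_nrm_le (θ : ℝ) (x : Plane) : |nrm θ x| ≤ ‖x‖ :=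
  abs_le_of_sq_le_sq (by nlinarith [nrm_sq_add_tng_sq θ x, sq_nonneg (tng θ x)]) (norm_nonneg x)

theorem abs_tng_le (θ : ℝ) (x : Plane) : |tng θ x| ≤ ‖x‖ :=
  abs_le_of_sq_le_sq (by nlinarith [nrm_sq_add_tng_sq θ x, sq_nonneg (nrm θ x)]) (norm_nonneg x)

theorem abs_nrm_sub_le (θ : ℝ) (x y : Plane) : |nrm θ x - nrm θ y| ≤ dist x y := by
  rw [← nrm_sub, dist_eq_norm]; exact abs_nrm_le θ _

theorem abs_tng_sub_le (θ : ℝ) (x y : Plane) : |tng θ x - tng θ y| ≤ dist x y := by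
  rw [← tng_sub, dist_eq_norm]; exact abs_tng_le θ _

theorem abs_tng_sub_eq_dist {θ : ℝ} {x y : Plane} (h : nrm θ x = nrm θ y) :
    |tng θ x - tng θ y| = dist x y := by
  have h1 := nrm_sq_add_tng_sq θ (x - y)
  rw [nrm_sub, h, sub_self, tng_sub] at h1
  rw [dist_eq_norm, ← abs_of_nonneg (norm_nonneg (x - y))]
  exact (sq_eq_sq_iff_abs_eq_abs _ _).1 (by linarith)

theorem nrm_tng_ext {θ : ℝ} {x y : Plane} (h : nrm θ x = nrm θ y) (h' : tng θ x = tng θ y) :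
    x = y := by
  have := abs_tng_sub_eq_dist h
  rw [h', sub_self, abs_zero] at this
  exact dist_eq_zero.1 this.symm

theorem mem_lineOfParams {p : ℝ × Ico (0 : ℝ) Real.pi} {x : Plane} :
    x ∈ lineOfParams p ↔ nrm p.2 x = p.1 := by
  change x ∈ AffineSubspace.mk' (p.1 • normalVec p.2) (Submodule.span ℝ {unitVec p.2}) ↔ _
  rw [AffineSubspace.mem_mk', Submodule.mem_span_singleton]
  have hcs := Real.sin_sq_add_cos_sq (p.2 : ℝ)
  constructor
  · rintro ⟨c, hc⟩
    have h0 := congrArg (fun x : Plane => x 0) hc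
    have h1 := congrArg (fun x : Plane => x 1) hc
    simp [unitVec, normalVec] at h0 h1
    simp only [nrm]
    linear_combination (-Real.cos p.2) * h1 + Real.sin p.2 * h0 + p.1 * hcs
  · intro h
    refine ⟨tng p.2 x, ?_⟩
    simp only [nrm] at h
    ext i
    fin_cases i
    · simp [unitVec, normalVec, tng]
      linear_combination (Real.sin p.2) * h + x 0 * hcs
    · simp [unitVec, normalVec, tng]
      linear_combination (-Real.cos p.2) * h + x 1 * hcs

theorem lineOfParams_injective : Function.Injective lineOfParams := by
  rintro ⟨r, θ⟩ ⟨r', θ'⟩ h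
  have key : ∀ x : Plane, nrm θ x = r ↔ nrm θ' x = r' := fun x => by
    have h1 := @mem_lineOfParams (r, θ) x
    have h2 := @mem_lineOfParams (r', θ') x
    rw [h] at h1
    exact h1.symm.trans h2
  have hcs := Real.sin_sq_add_cos_sq (θ : ℝ)
  -- The foot of the perpendicular and the point one unit further along the line both lie on the
  -- second line. Subtracting gives `sin (θ - θ') = 0`, and the angles differ by less than `π`.
  have h1 := (key (r • normalVec θ)).1 (by
    simp [nrm, normalVec]; linear_combination r * hcs)
  have h2 := (key (r • normalVec θ + unitVec θ)).1 (by
    simp [nrm, normalVec, unitVec]; linear_combination r * hcs)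
  have h3 : Real.sin (θ - θ') = 0 := by
    rw [Real.sin_sub]
    simp [nrm, normalVec, unitVec] at h1 h2
    linear_combination h2 - h1
  have h4 : (θ : ℝ) = θ' := by
    have := (Real.sin_eq_zero_iff_of_lt_of_lt (x := (θ : ℝ) - θ')
      (by linarith [θ.2.1, θ'.2.2]) (by linarith [θ.2.2, θ'.2.1])).1 h3
    linarith
  have h5 : θ = θ' := Subtype.ext h4
  subst h5
  have h6 : r = r' := by
    simp [nrm, normalVec] at h1
    linear_combination h1 - r * hcs
  rw [h6]

theorem exists_smul_unitVec (d : Plane) :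
    ∃ θ : Ico (0 : ℝ) Real.pi, ∃ c : ℝ, d = c • unitVec θ := by
  obtain ⟨θ, c, hθ, h0, h1⟩ : ∃ θ c : ℝ, θ ∈ Ico (-Real.pi) (Real.pi + 1) ∧
      d 0 = c * Real.cos θ ∧ d 1 = c * Real.sin θ := by
    refine ⟨Complex.arg ⟨d 0, d 1⟩, ‖(⟨d 0, d 1⟩ : ℂ)‖, ⟨(Complex.neg_pi_lt_arg _).le, ?_⟩, ?_, ?_⟩
    · linarith [Complex.arg_le_pi ⟨d 0, d 1⟩]
    · exact (Complex.norm_mul_cos_arg ⟨d 0, d 1⟩).symm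
    · exact (Complex.norm_mul_sin_arg ⟨d 0, d 1⟩).symm
  have hd : ∀ (θ' c' : ℝ), d 0 = c' * Real.cos θ' → d 1 = c' * Real.sin θ' →
      d = c' • unitVec θ' := by
    intro θ' c' h0 h1
    ext i
    fin_cases i
    · simpa [unitVec] using h0
    · simpa [unitVec] using h1
  have hpi := Real.pi_gt_three
  -- The argument lies in `(-π, π]`; angles outside `[0, π)` are moved by `π`, at the price of the
  -- sign of `c`.
  rcases lt_or_ge θ 0 with h | h
  · refine ⟨⟨θ + Real.pi, by linarith [hθ.1], by linarith⟩, -c, hd _ _ ?_ ?_⟩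
    · rw [Real.cos_add_pi, h0]; ring
    · rw [Real.sin_add_pi, h1]; ring
  rcases lt_or_ge θ Real.pi with h' | h'
  · exact ⟨⟨θ, h, h'⟩, c, hd _ _ h0 h1⟩
  · refine ⟨⟨θ - Real.pi, by linarith, by linarith [hθ.2]⟩, -c, hd _ _ ?_ ?_⟩
    · rw [Real.cos_sub_pi, h0]; ring
    · rw [Real.sin_sub_pi, h1]; ring

theorem lineOfParams_surjective : Function.Surjective lineOfParams := by
  rintro ⟨ℓ, hℓ⟩
  obtain ⟨⟨d, hd⟩, hd0, hspan⟩ := finrank_eq_one_iff'.1 hℓ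
  obtain ⟨θ, c, hc⟩ := exists_smul_unitVec d
  have hne : (ℓ : Set Plane).Nonempty := by
    rw [AffineSubspace.nonempty_iff_ne_bot]
    rintro rfl
    rw [AffineSubspace.direction_bot, finrank_bot] at hℓ
    exact zero_ne_one hℓ
  obtain ⟨x, hx⟩ := hne
  have hc0 : c ≠ 0 := by
    rintro rfl
    exact hd0 (Subtype.ext (by simpa using hc))
  have hdir : ℓ.direction = Submodule.span ℝ {unitVec θ} := by
    apply le_antisymm
    · intro w hw
      obtain ⟨a, ha⟩ := hspan ⟨w, hw⟩
      rw [Submodule.mem_span_singleton]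
      refine ⟨a * c, ?_⟩
      have := congrArg Subtype.val ha
      change a • d = w at this
      rw [← this, hc, smul_smul]
    · rw [Submodule.span_singleton_le_iff_mem]
      have : unitVec θ = c⁻¹ • d := by rw [hc, smul_smul, inv_mul_cancel₀ hc0, one_smul]
      rw [this]
      exact Submodule.smul_mem _ _ hd
  refine ⟨(nrm θ x, θ), Subtype.ext ?_⟩
  have hx' : x ∈ lineOfParams (nrm θ x, θ) := mem_lineOfParams.2 rfl
  refine AffineSubspace.ext_of_direction_eq ?_ ⟨x, hx', hx⟩
  rw [hdir]
  exact AffineSubspace.direction_mk' _ _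

/-- The parametrization of line-space as an isomorphism of measurable spaces. -/
def lineEquiv : ℝ × Ico (0 : ℝ) Real.pi ≃ᵐ PlanarLine where
  toEquiv := Equiv.ofBijective lineOfParams ⟨lineOfParams_injective, lineOfParams_surjective⟩
  measurable_toFun := fun s hs => hs
  measurable_invFun := by
    intro s hs
    change MeasurableSet (lineOfParams ⁻¹' _)
    convert hs using 1
    ext x
    simp only [mem_preimage]
    rw [show lineOfParams x = Equiv.ofBijective lineOfParams
      ⟨lineOfParams_injective, lineOfParams_surjective⟩ x from rfl, Equiv.symm_apply_apply]

/-- The signed distance of a line from the origin. -/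
def rad (ℓ : PlanarLine) : ℝ := (lineEquiv.symm ℓ).1

/-- The angle that a line makes with the first coordinate axis. -/
def ang (ℓ : PlanarLine) : ℝ := (lineEquiv.symm ℓ).2

theorem measurable_rad : Measurable rad := measurable_fst.comp lineEquiv.symm.measurable

theorem measurable_ang : Measurable ang :=
  measurable_subtype_coe.comp (measurable_snd.comp lineEquiv.symm.measurable)

theorem ang_mem (ℓ : PlanarLine) : ang ℓ ∈ Ico 0 Real.pi := (lineEquiv.symm ℓ).2.2

theorem mem_line_iff {ℓ : PlanarLine} {x : Plane} : x ∈ ℓ ↔ nrm (ang ℓ) x = rad ℓ := by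
  have h : lineOfParams (lineEquiv.symm ℓ) = ℓ := lineEquiv.apply_symm_apply ℓ
  conv_lhs => rw [← h]
  exact mem_lineOfParams

theorem line_ext {ℓ ℓ' : PlanarLine} (hr : rad ℓ = rad ℓ') (ha : ang ℓ = ang ℓ') : ℓ = ℓ' :=
  lineEquiv.symm.injective (Prod.ext hr (Subtype.ext ha))

theorem isClosed_line (ℓ : PlanarLine) : IsClosed {x | x ∈ ℓ} := by
  simp only [mem_line_iff]
  exact isClosed_eq (continuous_nrm _) continuous_const

/-- The distance of the point `x` from the line `ℓ`. -/
def lineDist (ℓ : PlanarLine) (x : Plane) : ℝ := |nrm (ang ℓ) x - rad ℓ|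

theorem lineDist_le_dist {ℓ : PlanarLine} {x y : Plane} (hy : y ∈ ℓ) : lineDist ℓ x ≤ dist x y := by
  rw [lineDist, ← mem_line_iff.1 hy]; exact abs_nrm_sub_le _ _ _

theorem exists_mem_line_dist_eq (ℓ : PlanarLine) (x : Plane) :
    ∃ y ∈ ℓ, dist x y = lineDist ℓ x := by
  have hcs := Real.sin_sq_add_cos_sq (ang ℓ)
  refine ⟨x - (nrm (ang ℓ) x - rad ℓ) • normalVec (ang ℓ), mem_line_iff.2 ?_, ?_⟩
  · rw [nrm_sub]
    have : nrm (ang ℓ) ((nrm (ang ℓ) x - rad ℓ) • normalVec (ang ℓ)) = nrm (ang ℓ) x - rad ℓ := by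
      generalize nrm (ang ℓ) x - rad ℓ = c
      simp [nrm, normalVec]
      linear_combination c * hcs
    rw [this]; ring
  · have hn : ‖normalVec (ang ℓ)‖ = 1 := by
      rw [EuclideanSpace.norm_eq]
      simp [normalVec, Fin.sum_univ_two, hcs]
    rw [dist_eq_norm, sub_sub_cancel, norm_smul, hn, mul_one]
    rfl

theorem measurable_lineDist (x : Plane) : Measurable (fun ℓ => lineDist ℓ x) := by
  have h1 := measurable_rad
  have h2 := measurable_ang
  unfold lineDist nrm
  fun_prop

/-- A point of a line is at least `κ` times as far from another line as from the crossing of the two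
lines, for a constant `κ > 0`. -/
theorem exists_angle_const {ℓ ℓ' : PlanarLine} (hne : ℓ ≠ ℓ') {x : Plane} (hx : x ∈ ℓ)
    (hx' : x ∈ ℓ') : ∃ κ > 0, ∀ y ∈ ℓ, ∀ z ∈ ℓ', κ * dist x z ≤ dist y z := by
  set θ := ang ℓ
  set θ' := ang ℓ'
  have hs : Real.sin (θ' - θ) ≠ 0 := by
    intro h0
    have h1 := (Real.sin_eq_zero_iff_of_lt_of_lt (x := θ' - θ)
      (by linarith [(ang_mem ℓ').1, (ang_mem ℓ).2]) (by linarith [(ang_mem ℓ').2, (ang_mem ℓ).1])).1 h0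
    have h2 : ang ℓ = ang ℓ' := by linarith
    refine hne (line_ext ?_ h2)
    rw [← mem_line_iff.1 hx, ← mem_line_iff.1 hx', h2]
  refine ⟨|Real.sin (θ' - θ)|, abs_pos.2 hs, fun y hy z hz => ?_⟩
  have h1 : nrm θ z - nrm θ y = Real.sin (θ' - θ) * (tng θ' z - tng θ' x) := by
    have e1 : nrm θ y = nrm θ x := (mem_line_iff.1 hy).trans (mem_line_iff.1 hx).symm
    have e2 : nrm θ' z = nrm θ' x := (mem_line_iff.1 hz).trans (mem_line_iff.1 hx').symm
    rw [e1, Real.sin_sub]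
    have hcs := Real.sin_sq_add_cos_sq θ'
    simp only [nrm, tng] at e2 ⊢
    linear_combination (Real.sin θ' * Real.sin θ + Real.cos θ' * Real.cos θ) * e2 +
      (Real.sin θ * (z 0 - x 0) - Real.cos θ * (z 1 - x 1)) * hcs
  rw [dist_comm x z, ← abs_tng_sub_eq_dist ((mem_line_iff.1 hz).trans (mem_line_iff.1 hx').symm),
    ← abs_mul, ← h1, dist_comm]
  exact abs_nrm_sub_le θ z y

theorem eq_of_mem_lines {ℓ ℓ' : PlanarLine} (hne : ℓ ≠ ℓ') {x y : Plane} (hx : x ∈ ℓ)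
    (hx' : x ∈ ℓ') (hy : y ∈ ℓ) (hy' : y ∈ ℓ') : x = y := by
  obtain ⟨κ, hκ, h⟩ := exists_angle_const hne hx hx'
  have := h y hy y hy'
  rw [dist_self] at this
  exact dist_le_zero.1 (nonpos_of_mul_nonpos_right this hκ)

end

section

/-! ### Feasible paths -/

/-- Only finitely many lines of given minimal speed-limit meet a given bounded region. -/
def LocallyFiniteSpeeds (L : Set (PlanarLine × ℝ)) : Prop :=
  ∀ R v : ℝ, 0 < v → {p ∈ L | v ≤ p.2 ∧ |rad p.1| ≤ R}.Finite

/-- On every time interval spent off the lines of speed-limit at least `v`, the path `ξ` has average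
speed at most `v`. -/
def ObeysLimits (L : Set (PlanarLine × ℝ)) (a b : ℝ) (ξ : ℝ → Plane) : Prop :=
  ∀ v : ℝ, 0 < v → ∀ s t : ℝ, a ≤ s → s ≤ t → t ≤ b → (∀ u ∈ Icc s t, ξ u ∉ silhouette L v) →
    dist (ξ s) (ξ t) ≤ v * (t - s)

/-- `ξ` is a Lipschitz path on `[a, b]` that obeys the speed-limits of `L`. -/
structure Feasible (L : Set (PlanarLine × ℝ)) (a b : ℝ) (ξ : ℝ → Plane) : Prop where
  le : a ≤ b
  lipschitz : ∃ K : ℝ≥0, LipschitzOnWith K ξ (Icc a b)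
  obeys : ObeysLimits L a b ξ

/-- One can travel from `x` to `y` in time `t`. -/
def Reach (L : Set (PlanarLine × ℝ)) (x y : Plane) (t : ℝ) : Prop :=
  ∃ ξ : ℝ → Plane, Feasible L 0 t ξ ∧ ξ 0 = x ∧ ξ t = y

variable {L E : Set (PlanarLine × ℝ)} {a b c : ℝ} {ξ η : ℝ → Plane}

theorem silhouette_mono (h : E ⊆ L) (v : ℝ) : silhouette E v ⊆ silhouette L v :=
  fun _ ⟨p, hp, hv, hx⟩ => ⟨p, h hp, hv, hx⟩

theorem LocallyFiniteSpeeds.mono (hL : LocallyFiniteSpeeds L) (h : E ⊆ L) :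
    LocallyFiniteSpeeds E :=
  fun R v hv => (hL R v hv).subset fun _ hp => ⟨h hp.1, hp.2⟩

theorem abs_rad_le_norm {ℓ : PlanarLine} {x : Plane} (hx : x ∈ ℓ) : |rad ℓ| ≤ ‖x‖ := by
  rw [← mem_line_iff.1 hx]; exact abs_nrm_le _ _

/-- Only finitely many lines of limit at least `v` come near `x`, and those that miss `x` are
closed, so they miss a neighbourhood. In particular silhouettes are closed. -/
theorem LocallyFiniteSpeeds.eventually_mem (hL : LocallyFiniteSpeeds L) {v : ℝ} (hv : 0 < v)
    (x : Plane) : ∀ᶠ y in 𝓝 x, ∀ q ∈ L, v ≤ q.2 → y ∈ q.1 → x ∈ q.1 := by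
  have h1 : ∀ᶠ y in 𝓝 x, ∀ q ∈ {p ∈ L | v ≤ p.2 ∧ |rad p.1| ≤ ‖x‖ + 1}, y ∈ q.1 → x ∈ q.1 := by
    rw [eventually_all_finite (hL (‖x‖ + 1) v hv)]
    intro q _
    by_cases hq : x ∈ q.1
    · exact Eventually.of_forall fun _ _ => hq
    · filter_upwards [(isClosed_line q.1).isOpen_compl.mem_nhds hq] with y hy hy'
      exact absurd hy' hy
  filter_upwards [h1, Metric.ball_mem_nhds x one_pos] with y hy hyx q hq hvq hyq
  refine hy q ⟨hq, hvq, (abs_rad_le_norm hyq).trans ?_⟩ hyq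
  have := norm_sub_norm_le y x
  rw [← dist_eq_norm] at this
  linarith [Metric.mem_ball.1 hyx]

theorem Feasible.continuousOn (h : Feasible L a b ξ) : ContinuousOn ξ (Icc a b) := by
  obtain ⟨K, hK⟩ := h.lipschitz
  exact hK.continuousOn

theorem ObeysLimits.mono (h : ObeysLimits L a b ξ) {a' b' : ℝ} (ha : a ≤ a') (hb : b' ≤ b) :
    ObeysLimits L a' b' ξ :=
  fun v hv s t hs hst ht => h v hv s t (ha.trans hs) hst (ht.trans hb)

theorem ObeysLimits.mono_lines (h : ObeysLimits E a b ξ) (hEL : E ⊆ L) : ObeysLimits L a b ξ :=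
  fun v hv s t hs hst ht hu => h v hv s t hs hst ht fun u hu' hu'' =>
    hu u hu' (silhouette_mono hEL v hu'')

theorem Feasible.mono (h : Feasible L a b ξ) {a' b' : ℝ} (ha : a ≤ a') (hab : a' ≤ b')
    (hb : b' ≤ b) : Feasible L a' b' ξ := by
  obtain ⟨K, hK⟩ := h.lipschitz
  exact ⟨hab, ⟨K, hK.mono (Icc_subset_Icc ha hb)⟩, h.obeys.mono ha hb⟩

theorem Feasible.mono_lines (h : Feasible E a b ξ) (hEL : E ⊆ L) : Feasible L a b ξ :=
  ⟨h.le, h.lipschitz, h.obeys.mono_lines hEL⟩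

theorem Feasible.congr (h : Feasible L a b ξ) (he : EqOn ξ η (Icc a b)) : Feasible L a b η := by
  obtain ⟨K, hK⟩ := h.lipschitz
  refine ⟨h.le, ⟨K, fun x hx y hy => ?_⟩, fun v hv s t hs hst ht hu => ?_⟩
  · rw [← he hx, ← he hy]; exact hK hx hy
  · rw [← he ⟨hs, hst.trans ht⟩, ← he ⟨hs.trans hst, ht⟩]
    refine h.obeys v hv s t hs hst ht fun u hu' => ?_
    rw [he ⟨hs.trans hu'.1, hu'.2.trans ht⟩]
    exact hu u hu'

theorem Feasible.comp_add_const (h : Feasible L a b ξ) (c : ℝ) :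
    Feasible L (a - c) (b - c) (fun t => ξ (t + c)) := by
  obtain ⟨K, hK⟩ := h.lipschitz
  refine ⟨by linarith [h.le], ⟨K, LipschitzOnWith.of_dist_le_mul fun x hx y hy => ?_⟩,
    fun v hv s t hs hst ht hu => ?_⟩
  · have := hK.dist_le_mul (x + c) ⟨by linarith [hx.1], by linarith [hx.2]⟩ (y + c)
      ⟨by linarith [hy.1], by linarith [hy.2]⟩
    simpa using this
  · have := h.obeys v hv (s + c) (t + c) (by linarith) (by linarith) (by linarith) fun u hu' => by
      have := hu (u - c) ⟨by linarith [hu'.1], by linarith [hu'.2]⟩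
      simpa using this
    simpa using this

theorem Feasible.reverse (h : Feasible L a b ξ) (c : ℝ) :
    Feasible L (c - b) (c - a) (fun t => ξ (c - t)) := by
  obtain ⟨K, hK⟩ := h.lipschitz
  refine ⟨by linarith [h.le], ⟨K, LipschitzOnWith.of_dist_le_mul fun x hx y hy => ?_⟩,
    fun v hv s t hs hst ht hu => ?_⟩
  · have := hK.dist_le_mul (c - x) ⟨by linarith [hx.2], by linarith [hx.1]⟩ (c - y)
      ⟨by linarith [hy.2], by linarith [hy.1]⟩
    rwa [dist_sub_left] at this
  · have := h.obeys v hv (c - t) (c - s) (by linarith) (by linarith) (by linarith) fun u hu' => by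
      have := hu (c - u) ⟨by linarith [hu'.2], by linarith [hu'.1]⟩
      simpa using this
    rw [dist_comm]
    calc _ ≤ _ := this
      _ = _ := by ring

theorem Feasible.append (h : Feasible L a b ξ) (h' : Feasible L b c ξ) : Feasible L a c ξ := by
  obtain ⟨K, hK⟩ := h.lipschitz
  obtain ⟨K', hK'⟩ := h'.lipschitz
  have hb := h.le
  have hc := h'.le
  refine ⟨hb.trans hc, ⟨max K K', LipschitzOnWith.of_dist_le_mul ?_⟩, ?_⟩
  · have key : ∀ x ∈ Icc a c, ∀ y ∈ Icc a c, x ≤ y →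
        dist (ξ x) (ξ y) ≤ (max K K' : ℝ≥0) * dist x y := by
      intro x hx y hy hxy
      rw [dist_comm x y, Real.dist_eq, abs_of_nonneg (sub_nonneg.2 hxy)]
      have hm1 : (K : ℝ) ≤ (max K K' : ℝ≥0) := by exact_mod_cast le_max_left K K'
      have hm2 : (K' : ℝ) ≤ (max K K' : ℝ≥0) := by exact_mod_cast le_max_right K K'
      have d1 : ∀ u ∈ Icc a b, ∀ w ∈ Icc a b, u ≤ w →
          dist (ξ u) (ξ w) ≤ (max K K' : ℝ≥0) * (w - u) := fun u hu w hw huw => by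
        have := hK.dist_le_mul u hu w hw
        rw [dist_comm u w, Real.dist_eq, abs_of_nonneg (sub_nonneg.2 huw)] at this
        exact this.trans (mul_le_mul_of_nonneg_right hm1 (sub_nonneg.2 huw))
      have d2 : ∀ u ∈ Icc b c, ∀ w ∈ Icc b c, u ≤ w →
          dist (ξ u) (ξ w) ≤ (max K K' : ℝ≥0) * (w - u) := fun u hu w hw huw => by
        have := hK'.dist_le_mul u hu w hw
        rw [dist_comm u w, Real.dist_eq, abs_of_nonneg (sub_nonneg.2 huw)] at this
        exact this.trans (mul_le_mul_of_nonneg_right hm2 (sub_nonneg.2 huw))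
      rcases le_total y b with h1 | h1
      · exact d1 x ⟨hx.1, hxy.trans h1⟩ y ⟨hy.1, h1⟩ hxy
      rcases le_total b x with h2 | h2
      · exact d2 x ⟨h2, hx.2⟩ y ⟨h1, hy.2⟩ hxy
      have e1 := d1 x ⟨hx.1, h2⟩ b ⟨hb, le_rfl⟩ h2
      have e2 := d2 b ⟨le_rfl, hc⟩ y ⟨h1, hy.2⟩ h1
      linarith [dist_triangle (ξ x) (ξ b) (ξ y)]
    intro x hx y hy
    rcases le_total x y with hxy | hxy
    · exact key x hx y hy hxy
    · rw [dist_comm, dist_comm x]; exact key y hy x hx hxy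
  · intro v hv s t hs hst ht hu
    rcases le_total t b with h1 | h1
    · exact h.obeys v hv s t hs hst h1 hu
    rcases le_total b s with h2 | h2
    · exact h'.obeys v hv s t h2 hst ht hu
    have e1 := h.obeys v hv s b hs h2 le_rfl fun u hu' => hu u ⟨hu'.1, hu'.2.trans h1⟩
    have e2 := h'.obeys v hv b t le_rfl h1 ht fun u hu' => hu u ⟨h2.trans hu'.1, hu'.2⟩
    linarith [dist_triangle (ξ s) (ξ b) (ξ t)]

theorem Feasible.concat (h : Feasible L a b ξ) (h' : Feasible L b c η) (hb : ξ b = η b) :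
    Feasible L a c (fun t => if t ≤ b then ξ t else η t) := by
  refine (h.congr fun t ht => ?_).append (h'.congr fun t ht => ?_)
  · simp [ht.2]
  · rcases ht.1.eq_or_lt with rfl | h1
    · simp [hb]
    · simp [h1.not_ge]

/-- The speed-limits bound the speed also when only the interior of a time interval is known to be
spent off the fast lines. -/
theorem Feasible.dist_le_of_Ioo (h : Feasible L a b ξ) {v : ℝ} (hv : 0 < v) {s t : ℝ} (hs : a ≤ s)
    (hst : s ≤ t) (ht : t ≤ b) (hu : ∀ u ∈ Ioo s t, ξ u ∉ silhouette L v) :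
    dist (ξ s) (ξ t) ≤ v * (t - s) := by
  rcases hst.eq_or_lt with rfl | hst
  · simp
  have hc := h.continuousOn
  have hcs : ContinuousOn ξ (Icc s t) := hc.mono (Icc_subset_Icc hs ht)
  have key : ∀ᶠ ε in 𝓝[>] (0 : ℝ), dist (ξ (s + ε)) (ξ (t - ε)) ≤ v * (t - s) := by
    have h1 : ∀ᶠ ε in 𝓝[>] (0 : ℝ), ε < (t - s) / 2 :=
      (eventually_lt_nhds (by linarith)).filter_mono nhdsWithin_le_nhds
    filter_upwards [h1, self_mem_nhdsWithin] with ε h1 h2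
    rw [mem_Ioi] at h2
    have := h.obeys v hv (s + ε) (t - ε) (by linarith) (by linarith) (by linarith) fun u hu' =>
      hu u ⟨by linarith [hu'.1], by linarith [hu'.2]⟩
    nlinarith
  have t1 : Tendsto (fun ε => ξ (s + ε)) (𝓝[>] (0 : ℝ)) (𝓝 (ξ s)) := by
    refine (hcs s ⟨le_rfl, hst.le⟩).tendsto.comp (tendsto_nhdsWithin_iff.2 ⟨?_, ?_⟩)
    · have : Tendsto (fun ε : ℝ => s + ε) (𝓝 0) (𝓝 (s + 0)) := by
        exact (continuous_const.add continuous_id).tendsto 0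
      rw [add_zero] at this
      exact this.mono_left nhdsWithin_le_nhds
    · filter_upwards [Ioo_mem_nhdsGT (sub_pos.2 hst)] with ε hε
      exact ⟨by linarith [hε.1], by linarith [hε.2]⟩
  have t2 : Tendsto (fun ε => ξ (t - ε)) (𝓝[>] (0 : ℝ)) (𝓝 (ξ t)) := by
    refine (hcs t ⟨hst.le, le_rfl⟩).tendsto.comp (tendsto_nhdsWithin_iff.2 ⟨?_, ?_⟩)
    · have : Tendsto (fun ε : ℝ => t - ε) (𝓝 0) (𝓝 (t - 0)) := by
        exact (continuous_const.sub continuous_id).tendsto 0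
      rw [sub_zero] at this
      exact this.mono_left nhdsWithin_le_nhds
    · filter_upwards [Ioo_mem_nhdsGT (sub_pos.2 hst)] with ε hε
      exact ⟨by linarith [hε.2], by linarith [hε.1]⟩
  exact le_of_tendsto (t1.dist t2) key

/-- A path off the fast lines stays off them for a short time, so the bound on average speeds bounds
the derivative. Time `0` is left out because the two-sided derivative there also sees the values of
`ξ` before `0`. -/
theorem isPiPath_of_feasible (hL : LocallyFiniteSpeeds L) {T : ℝ} (hT : 0 < T)
    (h : Feasible L 0 T ξ) : IsPiPath L T ξ := by
  obtain ⟨K, hK⟩ := h.lipschitz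
  refine ⟨hT, fun x _ => ⟨K, Icc 0 T, self_mem_nhdsWithin, hK⟩, fun v hv => ?_⟩
  refine measure_mono_null (t := {0}) ?_ (by simp)
  rintro t ⟨ht, hd, hS⟩
  by_contra h0
  have ht0 : t ∈ Ioo 0 T := ⟨lt_of_le_of_ne ht.1 (Ne.symm h0), ht.2⟩
  have hcont : ContinuousAt ξ t := h.continuousOn.continuousAt (Icc_mem_nhds ht0.1 ht0.2)
  have h1 : ∀ᶠ u in 𝓝 t, u ∈ Ioo 0 T ∧ ξ u ∉ silhouette L v := by
    filter_upwards [Ioo_mem_nhds ht0.1 ht0.2, hcont.eventually (hL.eventually_mem hv (ξ t))]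
      with u hu hu'
    exact ⟨hu, fun ⟨q, hq, hvq, hx⟩ => hS ⟨q, hq, hvq, hu' q hq hvq hx⟩⟩
  obtain ⟨ε, hε, hball⟩ := Metric.eventually_nhds_iff_ball.1 h1
  refine hd.not_ge (norm_deriv_le_of_lip' hv.le ?_)
  filter_upwards [Metric.ball_mem_nhds t hε] with u hu
  have hsub : ∀ w, w ∈ uIcc t u → w ∈ Metric.ball t ε := fun w hw => by
    rw [Metric.mem_ball, Real.dist_eq] at hu ⊢
    have := abs_sub_left_of_mem_uIcc hw
    linarith
  rw [← dist_eq_norm, Real.norm_eq_abs]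
  rcases le_total t u with htu | htu
  · rw [dist_comm, abs_of_nonneg (sub_nonneg.2 htu)]
    refine h.obeys v hv t u ht.1 htu (hball u hu).1.2.le fun w hw => ?_
    exact (hball w (hsub w (by rwa [uIcc_of_le htu]))).2
  · rw [abs_of_nonpos (sub_nonpos.2 htu), neg_sub]
    refine h.obeys v hv u t (hball u hu).1.1.le htu ht.2.le fun w hw => ?_
    exact (hball w (hsub w (by rwa [uIcc_of_ge htu]))).2

/-- Take the inner product of the path with its total displacement `D`. This is an absolutely
continuous function with derivative at most `‖D‖ * v`, and its increment is `‖D‖ ^ 2`. -/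
theorem dist_le_of_ae_norm_deriv_le {K : ℝ≥0} {s t v : ℝ} (hst : s < t)
    (hK : LipschitzOnWith K ξ (Icc s t))
    (hd : ∀ᵐ u, u ∈ Ioo s t → ‖deriv ξ u‖ ≤ v) : dist (ξ s) (ξ t) ≤ v * (t - s) := by
  set D := ξ t - ξ s with hD
  let ip : Plane →L[ℝ] ℝ := innerSL ℝ D
  have hlip : LipschitzOnWith (‖ip‖₊ * K) (ip ∘ ξ) (uIcc s t) := by
    rw [uIcc_of_le hst.le]
    exact ip.lipschitz.comp_lipschitzOnWith hK
  have hac := hlip.absolutelyContinuousOnInterval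
  have hint := hac.integral_deriv_eq_sub
  have hdiff := hK.ae_differentiableWithinAt_of_mem (μ := volume)
  have hle : ∫ u in s..t, deriv (ip ∘ ξ) u ≤ ∫ _ in s..t, ‖D‖ * v := by
    refine intervalIntegral.integral_mono_ae_restrict hst.le hac.intervalIntegrable_deriv
      intervalIntegrable_const ?_
    have hb : ∀ᵐ u : ℝ, u ≠ s ∧ u ≠ t := by
      filter_upwards [compl_mem_ae_iff.2 (measure_singleton s),
        compl_mem_ae_iff.2 (measure_singleton t)] with u h1 h2
      exact ⟨h1, h2⟩
    refine (ae_restrict_iff' measurableSet_Icc).2 ?_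
    filter_upwards [hd, hdiff, hb] with u h1 h2 h3 hu
    have hu' : u ∈ Ioo s t := ⟨lt_of_le_of_ne hu.1 h3.1.symm, lt_of_le_of_ne hu.2 h3.2⟩
    have hda : DifferentiableAt ℝ ξ u := (h2 hu).differentiableAt (Icc_mem_nhds hu'.1 hu'.2)
    have : deriv (ip ∘ ξ) u = ip (deriv ξ u) :=
      (ip.hasFDerivAt.comp_hasDerivAt u hda.hasDerivAt).deriv
    rw [this]
    calc ip (deriv ξ u) ≤ ‖D‖ * ‖deriv ξ u‖ := real_inner_le_norm D (deriv ξ u)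
      _ ≤ ‖D‖ * v := mul_le_mul_of_nonneg_left (h1 hu') (norm_nonneg _)
  rw [hint, intervalIntegral.integral_const, smul_eq_mul] at hle
  have h1 : (ip ∘ ξ) t - (ip ∘ ξ) s = ‖D‖ ^ 2 := by
    change ip (ξ t) - ip (ξ s) = _
    rw [← map_sub]
    exact real_inner_self_eq_norm_sq D
  rw [h1] at hle
  rw [dist_comm, dist_eq_norm, ← hD]
  rcases (norm_nonneg D).eq_or_lt with h0 | h0
  · rw [← h0]
    have hv : 0 ≤ v := by
      by_contra hneg
      have hpos : volume (Ioo s t) ≠ 0 := by simp [hst]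
      refine hpos (measure_mono_null (fun u hu => ?_) (ae_iff.1 hd))
      simp only [mem_ofPred_eq, Classical.not_imp, not_le]
      exact ⟨hu, (not_le.1 hneg).trans_le (norm_nonneg _)⟩
    exact mul_nonneg hv (sub_nonneg.2 hst.le)
  · nlinarith

theorem IsPiPath.feasible {T : ℝ} (h : IsPiPath L T ξ) : Feasible L 0 T ξ := by
  obtain ⟨K, hK⟩ := h.locallyLipschitz.exists_lipschitzOnWith_of_compact isCompact_Icc
  refine ⟨h.pos.le, ⟨K, hK⟩, fun v hv s t hs hst ht hu => ?_⟩
  rcases hst.eq_or_lt with rfl | hst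
  · simp
  refine dist_le_of_ae_norm_deriv_le hst (hK.mono (Icc_subset_Icc hs ht)) ?_
  have := h.speed v hv
  rw [← compl_mem_ae_iff] at this
  filter_upwards [this] with u hu' huI
  by_contra hlt
  exact hu' ⟨⟨hs.trans huI.1.le, huI.2.trans_le ht⟩, not_le.1 hlt, hu u ⟨huI.1.le, huI.2.le⟩⟩

/-! ### Travel between points -/

variable {x y z : Plane} {s t : ℝ}

theorem Reach.nonneg (h : Reach L x y t) : 0 ≤ t := by
  obtain ⟨ξ, hξ, -⟩ := h
  exact hξ.le

theorem Reach.trans (h : Reach L x y s) (h' : Reach L y z t) : Reach L x z (s + t) := by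
  obtain ⟨ξ, hξ, hξ0, hξs⟩ := h
  obtain ⟨η, hη, hη0, hηt⟩ := h'
  have h1 := hη.comp_add_const (-s)
  rw [zero_sub, neg_neg, sub_neg_eq_add, add_comm t s] at h1
  refine ⟨_, hξ.concat h1 ?_, ?_, ?_⟩
  · simp [hξs, hη0]
  · simp [hξ.le, hξ0]
  · by_cases ht : s + t ≤ s
    · have ht0 : t = 0 := le_antisymm (by linarith) hη.le
      subst ht0
      simp [hξs, ← hηt, hη0]
    · simp [ht, hηt]

theorem Reach.mono_lines (h : Reach E x y t) (hEL : E ⊆ L) : Reach L x y t := by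
  obtain ⟨ξ, hξ, h0⟩ := h
  exact ⟨ξ, hξ.mono_lines hEL, h0⟩

theorem reach_refl (L : Set (PlanarLine × ℝ)) (x : Plane) (ht : 0 ≤ t) : Reach L x x t := by
  refine ⟨fun _ => x, ⟨ht, ⟨0, LipschitzOnWith.of_dist_le_mul fun _ _ _ _ => by simp⟩,
    fun v hv s t _ hst _ _ => ?_⟩, rfl, rfl⟩
  rw [dist_self]
  exact mul_nonneg hv.le (sub_nonneg.2 hst)

theorem Feasible.reach (h : Feasible L a b ξ) : Reach L (ξ a) (ξ b) (b - a) := by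
  have h1 := h.comp_add_const a
  rw [sub_self] at h1
  exact ⟨_, h1, by simp, by simp⟩

theorem reach_along_line {p : PlanarLine × ℝ} (hp : p ∈ L) (hv : 0 < p.2) (hx : x ∈ p.1)
    (hy : y ∈ p.1) : Reach L x y (dist x y / p.2) := by
  rcases eq_or_ne x y with rfl | hxy
  · rw [dist_self, zero_div]; exact reach_refl L x le_rfl
  have hd : 0 < dist x y := dist_pos.2 hxy
  set ξ : ℝ → Plane := fun t => AffineMap.lineMap x y (t * p.2 / dist x y) with hξ
  have hdist : ∀ s t, dist (ξ s) (ξ t) = p.2 * |s - t| := fun s t => by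
    simp only [hξ]
    rw [dist_lineMap_lineMap, Real.dist_eq, ← sub_div, ← sub_mul, abs_div, abs_mul, abs_of_pos hv,
      abs_of_pos hd]
    field_simp
  have hmem : ∀ t, ξ t ∈ p.1 := fun t => AffineMap.lineMap_mem _ hx hy
  refine ⟨ξ, ⟨by positivity, ⟨⟨p.2, hv.le⟩, LipschitzOnWith.of_dist_le_mul fun s _ t _ => ?_⟩,
    fun v hv' s t _ hst _ hu => ?_⟩, ?_, ?_⟩
  · rw [hdist, Real.dist_eq]; rfl
  · rw [hdist, abs_sub_comm, abs_of_nonneg (sub_nonneg.2 hst)]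
    refine mul_le_mul_of_nonneg_right (le_of_not_ge fun hle => ?_) (sub_nonneg.2 hst)
    exact hu s ⟨le_rfl, hst⟩ ⟨p, hp, hle, hmem s⟩
  · simp [hξ]
  · simp only [hξ]
    rw [div_mul_cancel₀ _ hv.ne', div_self hd.ne', AffineMap.lineMap_apply_one]

/-! ### Geodesics -/

/-- `ξ` is a feasible path on `[0, T]` all of whose pieces take the least possible time. -/
structure Geodesic (L : Set (PlanarLine × ℝ)) (T : ℝ) (ξ : ℝ → Plane) : Prop where
  feasible : Feasible L 0 T ξ
  minimal : ∀ s t r : ℝ, 0 ≤ s → s ≤ t → t ≤ T → Reach L (ξ s) (ξ t) r → t - s ≤ r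

theorem IsPiGeodesic.geodesic (hL : LocallyFiniteSpeeds L) {T : ℝ} (h : IsPiGeodesic L T ξ) :
    Geodesic L T ξ := by
  have hf := h.1.feasible
  refine ⟨hf, fun s t r hs hst ht hr => ?_⟩
  by_contra hlt
  have h1 := (hf.mono le_rfl hs (hst.trans ht)).reach
  have h2 := (hf.mono (hs.trans hst) ht le_rfl).reach
  have h3 := (h1.trans hr).trans h2
  have h4 := h3.nonneg
  -- The shortcut is prolonged by waiting at the end for half of the time saved: a Π-path needs a
  -- positive duration, and the total is still less than `T`.
  obtain ⟨η, hη, hη0, hη1⟩ := h3.trans (reach_refl L (ξ T)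
    (t := (T - (s - 0 + r + (T - t))) / 2) (by linarith))
  exact h.2 _ (by linarith) ⟨η, isPiPath_of_feasible hL (by linarith [h.1.pos]) hη, hη0, hη1⟩

variable {T : ℝ}

theorem Geodesic.continuousOn (h : Geodesic L T ξ) : ContinuousOn ξ (Icc 0 T) :=
  h.feasible.continuousOn

theorem Geodesic.reverse (h : Geodesic L T ξ) : Geodesic L T (fun t => ξ (T - t)) := by
  refine ⟨by simpa using h.feasible.reverse T, fun s t r hs hst ht ⟨η, hη, hη0, hηr⟩ => ?_⟩
  have h1 := hη.reverse r
  rw [sub_self, sub_zero] at h1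
  have := h.minimal (T - t) (T - s) r (by linarith) (by linarith) (by linarith)
    ⟨_, h1, by simp [hηr], by simp [hη0]⟩
  linarith

theorem Geodesic.injOn (h : Geodesic L T ξ) : InjOn ξ (Icc 0 T) := by
  have key : ∀ s ∈ Icc 0 T, ∀ t ∈ Icc 0 T, s ≤ t → ξ s = ξ t → s = t := fun s hs t ht hst he => by
    have := h.minimal s t 0 hs.1 hst ht.2 (by rw [he]; exact reach_refl L _ le_rfl)
    linarith
  intro s hs t ht he
  rcases le_total s t with hst | hst
  · exact key s hs t ht hst he
  · exact (key t ht s hs hst he.symm).symm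

theorem Geodesic.mul_sub_le_dist (h : Geodesic L T ξ) {p : PlanarLine × ℝ} (hp : p ∈ L)
    (hv : 0 < p.2) (hs : 0 ≤ s) (hst : s ≤ t) (ht : t ≤ T) (hsp : ξ s ∈ p.1) (htp : ξ t ∈ p.1) :
    p.2 * (t - s) ≤ dist (ξ s) (ξ t) := by
  have := h.minimal s t _ hs hst ht (reach_along_line hp hv hsp htp)
  rw [le_div_iff₀ hv] at this
  linarith

end

section

/-! ### Local behaviour of geodesics at a line -/

/-- A locally finite pattern of distinct lines with positive speed-limits, no three of which have a
common point. -/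
structure Generic (L : Set (PlanarLine × ℝ)) : Prop where
  pos : ∀ p ∈ L, 0 < p.2
  locallyFinite : LocallyFiniteSpeeds L
  line_ne : ∀ p ∈ L, ∀ q ∈ L, p ≠ q → p.1 ≠ q.1
  no_triple : ∀ p ∈ L, ∀ q ∈ L, ∀ r ∈ L, p ≠ q → p ≠ r → q ≠ r → ∀ x, x ∈ p.1 → x ∈ q.1 → x ∉ r.1

theorem exists_last_mem {X : Type*} [TopologicalSpace X] {f : ℝ → X} {a b : ℝ} {C : Set X}
    (hf : ContinuousOn f (Icc a b)) (hC : IsClosed C) (hab : a ≤ b) (ha : f a ∈ C) :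
    ∃ s ∈ Icc a b, f s ∈ C ∧ ∀ u ∈ Ioc s b, f u ∉ C := by
  have hcl : IsClosed (Icc a b ∩ f ⁻¹' C) := hf.preimage_isClosed_of_isClosed isClosed_Icc hC
  have hcomp : IsCompact (Icc a b ∩ f ⁻¹' C) := isCompact_Icc.of_isClosed_subset hcl inter_subset_left
  obtain ⟨s, ⟨hs, hsC⟩, hmax⟩ := hcomp.exists_isGreatest ⟨a, ⟨le_rfl, hab⟩, ha⟩
  exact ⟨s, hs, hsC, fun u hu huC => hu.1.not_ge (hmax ⟨⟨hs.1.trans hu.1.le, hu.2⟩, huC⟩)⟩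

theorem exists_first_mem {X : Type*} [TopologicalSpace X] {f : ℝ → X} {a b : ℝ} {C : Set X}
    (hf : ContinuousOn f (Icc a b)) (hC : IsClosed C) (hab : a ≤ b) (hb : f b ∈ C) :
    ∃ s ∈ Icc a b, f s ∈ C ∧ ∀ u ∈ Ico a s, f u ∉ C := by
  have hcl : IsClosed (Icc a b ∩ f ⁻¹' C) := hf.preimage_isClosed_of_isClosed isClosed_Icc hC
  have hcomp : IsCompact (Icc a b ∩ f ⁻¹' C) := isCompact_Icc.of_isClosed_subset hcl inter_subset_left
  obtain ⟨s, ⟨hs, hsC⟩, hmin⟩ := hcomp.exists_isLeast ⟨b, ⟨hab, le_rfl⟩, hb⟩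
  exact ⟨s, hs, hsC, fun u hu huC => hu.2.not_ge (hmin ⟨⟨hu.1, hu.2.le.trans hs.2⟩, huC⟩)⟩

variable {L : Set (PlanarLine × ℝ)} {T : ℝ} {ξ : ℝ → Plane}

/-- A geodesic does not leave a line between two visits if the speeds off the line do not exceed the
speed-limit of the line. -/
theorem Geodesic.mem_line_of_between (h : Geodesic L T ξ) {p : PlanarLine × ℝ} (hp : p ∈ L)
    (hv : 0 < p.2) {t₀ t₁ : ℝ} (h₀ : 0 ≤ t₀) (h₁ : t₁ ≤ T) (hm₀ : ξ t₀ ∈ p.1) (hm₁ : ξ t₁ ∈ p.1)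
    (hslow : ∀ u ∈ Ioo t₀ t₁, ξ u ∉ p.1 → ξ u ∉ silhouette L p.2) :
    ∀ u ∈ Icc t₀ t₁, ξ u ∈ p.1 := by
  intro u hu
  by_contra hn
  obtain ⟨s, hs, hsm, hs'⟩ := exists_last_mem (C := {x | x ∈ p.1})
    (h.continuousOn.mono (Icc_subset_Icc h₀ (hu.2.trans h₁))) (isClosed_line p.1) hu.1 hm₀
  obtain ⟨r, hr, hrm, hr'⟩ := exists_first_mem (C := {x | x ∈ p.1})
    (h.continuousOn.mono (Icc_subset_Icc (h₀.trans hu.1) h₁)) (isClosed_line p.1) hu.2 hm₁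
  have hoff : ∀ w ∈ Ioo s r, ξ w ∉ silhouette L p.2 := fun w hw => by
    refine hslow w ⟨hs.1.trans_lt hw.1, hw.2.trans_le hr.2⟩ ?_
    rcases le_total w u with hwu | hwu
    · exact hs' w ⟨hw.1, hwu⟩
    · exact hr' w ⟨hwu, hw.2⟩
  -- Between the last visit `s` and the next visit `r` the speed is at most `p.2`, while riding the
  -- line shows that `ξ s` and `ξ r` are at least `p.2 * (r - s)` apart. So the triangle inequality
  -- through `ξ u` is an equality, and `ξ u` is on the segment.
  have d1 := h.feasible.dist_le_of_Ioo hv (h₀.trans hs.1) hs.2 (hu.2.trans h₁) fun w hw =>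
    hoff w ⟨hw.1, hw.2.trans_le hr.1⟩
  have d2 := h.feasible.dist_le_of_Ioo hv (h₀.trans hu.1) hr.1 (hr.2.trans h₁) fun w hw =>
    hoff w ⟨hs.2.trans_lt hw.1, hw.2⟩
  have d3 := h.mul_sub_le_dist hp hv (h₀.trans hs.1) (hs.2.trans hr.1) (hr.2.trans h₁) hsm hrm
  have hw : Wbtw ℝ (ξ s) (ξ u) (ξ r) := dist_add_dist_eq_iff.1
    (le_antisymm (by linarith) (dist_triangle _ _ _))
  obtain ⟨c, -, hc⟩ := hw
  exact hn (hc ▸ AffineMap.lineMap_mem c hsm hrm)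

/-- After a geodesic has passed through the crossing of two lines, it does not change from one to the
other while all other lines in its neighbourhood are slow. -/
theorem Geodesic.not_cross (h : Geodesic L T ξ) {p q : PlanarLine × ℝ} (hq : q ∈ L)
    (hqv : 0 < q.2) {t₀ s t κ δ : ℝ} (h₀ : 0 ≤ t₀)
    (hκ : ∀ y ∈ p.1, ∀ z ∈ q.1, κ * dist (ξ t₀) z ≤ dist y z) (hκ0 : 0 < κ) (hδ : 0 < δ)
    (hδκ : δ < κ * q.2) (hts : t₀ < s) (hst : s ≤ t) (htT : t ≤ T) (hq₀ : ξ t₀ ∈ q.1)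
    (hslow : ∀ u ∈ Ioc t₀ t, ξ u ∈ silhouette L δ → ξ u ∈ p.1 ∨ ξ u ∈ q.1)
    (hs : ξ s ∈ p.1) (ht : ξ t ∈ q.1) : False := by
  have hc : ContinuousOn ξ (Icc s t) := h.continuousOn.mono (Icc_subset_Icc (h₀.trans hts.le) htT)
  obtain ⟨s', hs', hsm, hlast⟩ := exists_last_mem (C := {x | x ∈ p.1}) hc (isClosed_line p.1) hst hs
  obtain ⟨t', ht', htm, hfirst⟩ := exists_first_mem (C := {x | x ∈ q.1})
    (hc.mono (Icc_subset_Icc hs'.1 le_rfl)) (isClosed_line q.1) hs'.2 ht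
  -- Between the last point on `p` and the first point on `q` the speed is at most `δ`. The gap to
  -- be bridged is at least `κ` times the distance from the crossing, hence at least `κ * q.2 * (t'
  -- - t₀)`, which is too much.
  have d1 := h.feasible.dist_le_of_Ioo hδ (h₀.trans (hts.le.trans hs'.1)) ht'.1
    (ht'.2.trans htT) fun w hw hw' => by
      rcases hslow w ⟨hts.trans_le (hs'.1.trans hw.1.le), hw.2.le.trans ht'.2⟩ hw' with h1 | h1
      · exact hlast w ⟨hw.1, hw.2.le.trans ht'.2⟩ h1
      · exact hfirst w ⟨hw.1.le, hw.2⟩ h1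
  have htt : t₀ < t' := hts.trans_le (hs'.1.trans ht'.1)
  have d2 := h.mul_sub_le_dist hq hqv h₀ htt.le (ht'.2.trans htT) hq₀ htm
  have d3 := hκ _ hsm _ htm
  have e1 : κ * (q.2 * (t' - t₀)) ≤ κ * dist (ξ t₀) (ξ t') := mul_le_mul_of_nonneg_left d2 hκ0.le
  have e2 : δ * (t' - s') ≤ δ * (t' - t₀) :=
    mul_le_mul_of_nonneg_left (by linarith [hs'.1]) hδ.le
  have e3 : δ * (t' - t₀) < κ * q.2 * (t' - t₀) := mul_lt_mul_of_pos_right hδκ (sub_pos.2 htt)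
  linarith

theorem Geodesic.tendsto_right (h : Geodesic L T ξ) {t₀ : ℝ} (ht₀ : t₀ ∈ Ico 0 T) :
    Tendsto ξ (𝓝[>] t₀) (𝓝 (ξ t₀)) :=
  (h.continuousOn t₀ ⟨ht₀.1, ht₀.2.le⟩).tendsto.mono_left <| nhdsWithin_le_iff.2 <|
    mem_of_superset (Ioo_mem_nhdsGT ht₀.2) fun _ hu => ⟨ht₀.1.trans hu.1.le, hu.2.le⟩

theorem LocallyFiniteSpeeds.eventually_right (hL : LocallyFiniteSpeeds L) (h : Geodesic L T ξ)
    {t₀ : ℝ} (ht₀ : t₀ ∈ Ico 0 T) {v : ℝ} (hv : 0 < v) :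
    ∃ b ∈ Ioc t₀ T, ∀ u ∈ Ioo t₀ b, ∀ q ∈ L, v ≤ q.2 → ξ u ∈ q.1 → ξ t₀ ∈ q.1 := by
  have h1 := (h.tendsto_right ht₀).eventually (hL.eventually_mem hv (ξ t₀))
  obtain ⟨b, hb, hb'⟩ := (mem_nhdsGT_iff_exists_mem_Ioc_Ioo_subset ht₀.2).1 h1
  exact ⟨b, hb, hb'⟩

/-- Just after any given time, a geodesic is either always or never on a given line. -/
theorem Geodesic.germ_right (hL : Generic L) (h : Geodesic L T ξ) {p : PlanarLine × ℝ} (hp : p ∈ L)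
    {t₀ : ℝ} (ht₀ : t₀ ∈ Ico 0 T) :
    (∀ᶠ t in 𝓝[>] t₀, ξ t ∈ p.1) ∨ (∀ᶠ t in 𝓝[>] t₀, ξ t ∉ p.1) := by
  by_cases hx : ξ t₀ ∈ p.1
  swap
  · exact Or.inr ((h.tendsto_right ht₀).eventually ((isClosed_line p.1).isOpen_compl.mem_nhds hx))
  have hpv := hL.pos p hp
  -- it suffices that visits to the line exclude fast lines off it
  have main : ∀ b ∈ Ioc t₀ T, (∀ s ∈ Ioo t₀ b, ξ s ∈ p.1 →
      ∀ u ∈ Ioo t₀ s, ξ u ∉ p.1 → ξ u ∉ silhouette L p.2) →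
      (∀ᶠ t in 𝓝[>] t₀, ξ t ∈ p.1) ∨ (∀ᶠ t in 𝓝[>] t₀, ξ t ∉ p.1) := by
    intro b hb hslow
    by_cases hex : ∃ s ∈ Ioo t₀ b, ξ s ∈ p.1
    · obtain ⟨s, hs, hsm⟩ := hex
      left
      filter_upwards [Ioo_mem_nhdsGT hs.1] with u hu
      exact h.mem_line_of_between hp hpv ht₀.1 (hs.2.le.trans hb.2) hx hsm (hslow s hs hsm) u
        ⟨hu.1.le, hu.2.le⟩
    · right
      filter_upwards [Ioo_mem_nhdsGT hb.1] with u hu hum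
      exact hex ⟨u, hu, hum⟩
  by_cases hq : ∃ q ∈ L, q ≠ p ∧ ξ t₀ ∈ q.1
  · obtain ⟨q, hq, hqp, hxq⟩ := hq
    have hqv := hL.pos q hq
    obtain ⟨κ, hκ0, hκ⟩ := exists_angle_const (hL.line_ne p hp q hq hqp.symm) hx hxq
    obtain ⟨κ', hκ'0, hκ'⟩ := exists_angle_const (hL.line_ne q hq p hp hqp) hxq hx
    obtain ⟨δ, hδ, hδm⟩ : ∃ δ, 0 < δ ∧ δ < min p.2 (min (κ * q.2) (κ' * p.2)) :=
      exists_between (by positivity)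
    obtain ⟨h1, h2, h3⟩ : δ < p.2 ∧ δ < κ * q.2 ∧ δ < κ' * p.2 := by simpa using hδm
    obtain ⟨b, hb, hbL⟩ := hL.locallyFinite.eventually_right h ht₀ hδ
    have hpq : ∀ u ∈ Ioo t₀ b, ∀ r ∈ L, δ ≤ r.2 → ξ u ∈ r.1 → r = p ∨ r = q := by
      intro u hu r hr hδr hur
      by_contra! hne
      exact hL.no_triple p hp q hq r hr hqp.symm hne.1.symm hne.2.symm _ hx hxq
        (hbL u hu r hr hδr hur)
    have hsil : ∀ u ∈ Ioo t₀ b, ξ u ∈ silhouette L δ → ξ u ∈ p.1 ∨ ξ u ∈ q.1 := by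
      rintro u hu ⟨r, hr, hδr, hur⟩
      rcases hpq u hu r hr hδr hur with rfl | rfl
      · exact Or.inl hur
      · exact Or.inr hur
    -- Off `p`, only `q` can be as fast as `p` near the crossing; a visit to `q` followed by a
    -- return to `p` is excluded by `not_cross` with the two lines interchanged.
    refine main b hb fun s hs hsm u hu hup ⟨r, hr, hvr, hur⟩ => ?_
    have hub : u ∈ Ioo t₀ b := ⟨hu.1, hu.2.trans hs.2⟩
    rcases hpq u hub r hr (h1.le.trans hvr) hur with rfl | rfl
    · exact hup hur
    · exact h.not_cross hp hpv ht₀.1 hκ' hκ'0 hδ h3 hu.1 hu.2.le (hs.2.le.trans hb.2) hx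
        (fun w hw hw' => (hsil w ⟨hw.1, hw.2.trans_lt hs.2⟩ hw').symm) hur hsm
  · push Not at hq
    obtain ⟨b, hb, hbL⟩ := hL.locallyFinite.eventually_right h ht₀ hpv
    refine main b hb fun s hs hsm u hu hup ⟨r, hr, hvr, hur⟩ => ?_
    by_cases hrp : r = p
    · exact hup (hrp ▸ hur)
    · exact hq r hr hrp (hbL u ⟨hu.1, hu.2.trans hs.2⟩ r hr hvr hur)

theorem map_const_sub_nhdsGT (T t : ℝ) : map (fun u => T - u) (𝓝[>] (T - t)) = 𝓝[<] t := by
  simp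

theorem Geodesic.germ_left (hL : Generic L) (h : Geodesic L T ξ) {p : PlanarLine × ℝ} (hp : p ∈ L)
    {t₀ : ℝ} (ht₀ : t₀ ∈ Ioc 0 T) :
    (∀ᶠ t in 𝓝[<] t₀, ξ t ∈ p.1) ∨ (∀ᶠ t in 𝓝[<] t₀, ξ t ∉ p.1) := by
  have := h.reverse.germ_right hL hp (t₀ := T - t₀) ⟨by linarith [ht₀.2], by linarith [ht₀.1]⟩
  rw [← map_const_sub_nhdsGT T t₀]
  exact this

end

section

/-! ### The intersection of a geodesic with a line -/

/-- A compact set of reals which on either side of any of its points is locally everything or nothing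
is a finite union of disjoint closed intervals. -/
theorem exists_eq_iUnion_Icc {A : Set ℝ} (hA : IsCompact A)
    (hr : ∀ t ∈ A, (∀ᶠ u in 𝓝[>] t, u ∈ A) ∨ ∀ᶠ u in 𝓝[>] t, u ∉ A)
    (hl : ∀ t ∈ A, (∀ᶠ u in 𝓝[<] t, u ∈ A) ∨ ∀ᶠ u in 𝓝[<] t, u ∉ A) :
    ∃ (n : ℕ) (a b : Fin n → ℝ), (∀ i, a i ≤ b i) ∧ A = ⋃ i, Icc (a i) (b i) ∧
      Pairwise (fun i j => Disjoint (Icc (a i) (b i)) (Icc (a j) (b j))) ∧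
      (∀ i, ∀ᶠ u in 𝓝[<] (a i), u ∉ A) ∧ ∀ i, ∀ᶠ u in 𝓝[>] (b i), u ∉ A := by
  classical
  have hsub : ∀ {x y : ℝ}, Icc x y ⊆ A → ∀ {z}, z ∈ Icc x y → Icc x y ⊆ connectedComponentIn A z :=
    fun h _ hz => isPreconnected_Icc.subset_connectedComponentIn hz h
  -- Near each of its points, `A` lies in a single connected component. By compactness there are
  -- finitely many components, and each is a compact interval.
  have hN : ∀ t ∈ A, {u | u ∈ A → u ∈ connectedComponentIn A t} ∈ 𝓝 t := by
    intro t ht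
    rw [← nhdsLT_sup_nhdsGE, ← Ioi_union_left, nhdsWithin_union, nhdsWithin_singleton]
    refine mem_sup.2 ⟨?_, mem_sup.2 ⟨?_, ?_⟩⟩
    · rcases hl t ht with h | h
      · obtain ⟨s, hs, hsA⟩ := mem_nhdsLT_iff_exists_Ioo_subset.1 h
        filter_upwards [Ioo_mem_nhdsLT hs] with u hu _
        refine hsub (x := u) (y := t) (fun w hw => ?_) ⟨hu.2.le, le_rfl⟩ ⟨le_rfl, hu.2.le⟩
        rcases hw.2.eq_or_lt with rfl | hw'
        · exact ht
        · exact hsA ⟨hu.1.trans_le hw.1, hw'⟩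
      · filter_upwards [h] with u hu huA using absurd huA hu
    · rcases hr t ht with h | h
      · obtain ⟨s, hs, hsA⟩ := mem_nhdsGT_iff_exists_Ioo_subset.1 h
        filter_upwards [Ioo_mem_nhdsGT hs] with u hu _
        refine hsub (x := t) (y := u) (fun w hw => ?_) ⟨le_rfl, hu.1.le⟩ ⟨hu.1.le, le_rfl⟩
        rcases hw.1.eq_or_lt with rfl | hw'
        · exact ht
        · exact hsA ⟨hw', hw.2.trans_lt hu.2⟩
      · filter_upwards [h] with u hu huA using absurd huA hu
    · exact mem_pure.2 fun _ => mem_connectedComponentIn ht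
  obtain ⟨F, hFA, hF⟩ := hA.elim_nhds_subcover _ hN
  let 𝒞 : Finset (Set ℝ) := F.image (connectedComponentIn A)
  have h𝒞 : ∀ u ∈ A, connectedComponentIn A u ∈ 𝒞 := by
    intro u hu
    obtain ⟨t, ht, htu⟩ := mem_iUnion₂.1 (hF hu)
    rw [← connectedComponentIn_eq (htu hu)]
    exact Finset.mem_image_of_mem _ ht
  have h𝒞' : ∀ C ∈ 𝒞, ∃ t ∈ A, C = connectedComponentIn A t := by
    intro C hC
    obtain ⟨t, ht, rfl⟩ := Finset.mem_image.1 hC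
    exact ⟨t, hFA t ht, rfl⟩
  have hIcc : ∀ C ∈ 𝒞, C.Nonempty ∧ C = Icc (sInf C) (sSup C) := by
    intro C hC
    obtain ⟨t, ht, rfl⟩ := h𝒞' C hC
    have hconn : IsConnected (connectedComponentIn A t) := isConnected_connectedComponentIn_iff.2 ht
    refine ⟨hconn.nonempty, eq_Icc_of_connected_compact hconn ?_⟩
    refine hA.of_isClosed_subset ?_ (connectedComponentIn_subset A t)
    refine isClosed_of_closure_subset ?_
    exact hconn.isPreconnected.closure.subset_connectedComponentIn
      (subset_closure (mem_connectedComponentIn ht))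
      (closure_minimal (connectedComponentIn_subset A t) hA.isClosed)
  let e : Fin 𝒞.card ≃ 𝒞 := 𝒞.equivFin.symm
  have he : ∀ i, Icc (sInf (e i : Set ℝ)) (sSup (e i : Set ℝ)) = e i := fun i =>
    (hIcc _ (e i).2).2.symm
  have hle : ∀ i, sInf (e i : Set ℝ) ≤ sSup (e i : Set ℝ) := fun i => by
    have := (hIcc _ (e i).2).1
    rw [← he i] at this
    exact nonempty_Icc.1 this
  have heA : ∀ i, (e i : Set ℝ) ⊆ A := fun i => by
    obtain ⟨t, ht, h⟩ := h𝒞' _ (e i).2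
    rw [h]; exact connectedComponentIn_subset A t
  have hmax : ∀ i, ∀ {x y z : ℝ}, Icc x y ⊆ A → z ∈ Icc x y → z ∈ (e i : Set ℝ) →
      Icc x y ⊆ e i := by
    intro i x y z hxy hz hzi
    obtain ⟨t, ht, h⟩ := h𝒞' _ (e i).2
    rw [h] at hzi ⊢
    rw [connectedComponentIn_eq hzi]
    exact hsub hxy hz
  refine ⟨𝒞.card, fun i => sInf (e i : Set ℝ), fun i => sSup (e i : Set ℝ), hle, ?_, ?_, ?_, ?_⟩
  · simp only [he]
    refine Subset.antisymm (fun u hu => ?_) (iUnion_subset heA)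
    refine mem_iUnion.2 ⟨e.symm ⟨_, h𝒞 u hu⟩, ?_⟩
    rw [Equiv.apply_symm_apply]
    exact mem_connectedComponentIn hu
  · intro i j hij
    simp only [he]
    rw [Set.disjoint_left]
    intro u hui huj
    apply hij
    obtain ⟨t, ht, h⟩ := h𝒞' _ (e i).2
    obtain ⟨t', ht', h'⟩ := h𝒞' _ (e j).2
    refine e.injective (Subtype.ext ?_)
    rw [h] at hui ⊢
    rw [h'] at huj ⊢
    rw [connectedComponentIn_eq hui, connectedComponentIn_eq huj]
  · intro i
    have hai : sInf (e i : Set ℝ) ∈ (e i : Set ℝ) := by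
      have := left_mem_Icc.2 (hle i); rwa [he i] at this
    -- If `A` contained points just to the left, the component could be enlarged.
    refine (hl _ (heA i hai)).resolve_left fun h => ?_
    obtain ⟨s, hs, hsA⟩ := mem_nhdsLT_iff_exists_Ioo_subset.1 h
    obtain ⟨u, hu⟩ := exists_between (mem_Iio.1 hs)
    have := hmax i (x := u) (y := sInf (e i : Set ℝ)) (fun w hw => ?_) ⟨hu.2.le, le_rfl⟩ hai
      ⟨le_rfl, hu.2.le⟩
    · rw [← he i] at this
      exact this.1.not_gt hu.2
    · rcases hw.2.eq_or_lt with rfl | hw'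
      · exact heA i hai
      · exact hsA ⟨hu.1.trans_le hw.1, hw'⟩
  · intro i
    have hbi : sSup (e i : Set ℝ) ∈ (e i : Set ℝ) := by
      have := right_mem_Icc.2 (hle i); rwa [he i] at this
    refine (hr _ (heA i hbi)).resolve_left fun h => ?_
    obtain ⟨s, hs, hsA⟩ := mem_nhdsGT_iff_exists_Ioo_subset.1 h
    obtain ⟨u, hu⟩ := exists_between (mem_Ioi.1 hs)
    have := hmax i (x := sSup (e i : Set ℝ)) (y := u) (fun w hw => ?_) ⟨le_rfl, hu.1.le⟩ hbi
      ⟨hu.1.le, le_rfl⟩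
    · rw [← he i] at this
      exact this.2.not_gt hu.1
    · rcases hw.1.eq_or_lt with hw' | hw'
      · exact hw' ▸ heA i hbi
      · exact hsA ⟨hw', hw.2.trans_lt hu.2⟩

/-- On the line, points are determined by their tangential coordinate, which along the path is
continuous and injective in time, hence strictly monotone. -/
theorem image_Icc_eq_segment {ℓ : PlanarLine} {ξ : ℝ → Plane} {a b : ℝ} (hab : a ≤ b)
    (hc : ContinuousOn ξ (Icc a b)) (hi : InjOn ξ (Icc a b)) (hm : ∀ u ∈ Icc a b, ξ u ∈ ℓ) :
    ξ '' Icc a b = segment ℝ (ξ a) (ξ b) := by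
  set θ := ang ℓ
  have hnrm : ∀ {x y : Plane}, x ∈ ℓ → y ∈ ℓ → nrm θ x = nrm θ y := fun hx hy =>
    (mem_line_iff.1 hx).trans (mem_line_iff.1 hy).symm
  have hgc : ContinuousOn (fun u => tng θ (ξ u)) (Icc a b) := (continuous_tng θ).comp_continuousOn hc
  have hgi : InjOn (fun u => tng θ (ξ u)) (Icc a b) := fun u hu w hw huw =>
    hi hu hw (nrm_tng_ext (hnrm (hm u hu) (hm w hw)) huw)
  have ha : ξ a ∈ ℓ := hm a ⟨le_rfl, hab⟩
  have hb : ξ b ∈ ℓ := hm b ⟨hab, le_rfl⟩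
  have htl : ∀ c : ℝ, tng θ (AffineMap.lineMap (ξ a) (ξ b) c) =
      AffineMap.lineMap (tng θ (ξ a)) (tng θ (ξ b)) c := fun c => by
    simp [AffineMap.lineMap_apply, tng]; ring
  have himg : (fun u => tng θ (ξ u)) '' Icc a b = uIcc (tng θ (ξ a)) (tng θ (ξ b)) := by
    refine Subset.antisymm ?_ ?_
    · rintro _ ⟨u, hu, rfl⟩
      rcases hgc.strictMonoOn_of_injOn_Icc' hab hgi with h | h
      · exact Icc_subset_uIcc ⟨h.monotoneOn ⟨le_rfl, hab⟩ hu hu.1, h.monotoneOn hu ⟨hab, le_rfl⟩ hu.2⟩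
      · exact Icc_subset_uIcc' ⟨h.antitoneOn hu ⟨hab, le_rfl⟩ hu.2,
          h.antitoneOn ⟨le_rfl, hab⟩ hu hu.1⟩
    · have := intermediate_value_uIcc (f := fun u => tng θ (ξ u)) (a := a) (b := b)
        (by rwa [uIcc_of_le hab])
      rwa [uIcc_of_le hab] at this
  rw [← segment_eq_uIcc, segment_eq_image_lineMap] at himg
  rw [segment_eq_image_lineMap]
  ext z
  constructor
  · rintro ⟨u, hu, rfl⟩
    obtain ⟨c, hc01, hcu⟩ := himg.subset ⟨u, hu, rfl⟩
    refine ⟨c, hc01, nrm_tng_ext (hnrm (AffineMap.lineMap_mem c ha hb) (hm u hu)) ?_⟩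
    rw [htl]; exact hcu
  · rintro ⟨c, hc01, rfl⟩
    obtain ⟨u, hu, huc⟩ := himg.superset ⟨c, hc01, rfl⟩
    refine ⟨u, hu, nrm_tng_ext (hnrm (hm u hu) (AffineMap.lineMap_mem c ha hb)) ?_⟩
    rw [htl]; exact huc

variable {L : Set (PlanarLine × ℝ)} {T : ℝ} {ξ : ℝ → Plane} {p : PlanarLine × ℝ} {t₀ : ℝ}

theorem Geodesic.tendsto_left (h : Geodesic L T ξ) (ht₀ : t₀ ∈ Ioc 0 T) :
    Tendsto ξ (𝓝[<] t₀) (𝓝 (ξ t₀)) :=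
  (h.continuousOn t₀ ⟨ht₀.1.le, ht₀.2⟩).tendsto.mono_left <| nhdsWithin_le_iff.2 <|
    mem_of_superset (Ioo_mem_nhdsLT ht₀.1) fun _ hu => ⟨hu.1.le, hu.2.le.trans ht₀.2⟩

/-- Injectivity turns nearness in time into nearness in space: the path over the times outside an
open neighbourhood `N` of `t₀` is a compact set that misses `ξ t₀`, so a small ball sees only times
in `N`. -/
theorem Geodesic.properEncounter (h : Geodesic L T ξ) {q : PlanarLine × ℝ} (hq : q ∈ L)
    (hqp : q.1 ≠ p.1) (ht₀ : t₀ ∈ Icc 0 T) (hx : ξ t₀ ∈ p.1)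
    (hoff : ∃ᶠ u in 𝓝[Icc 0 T] t₀, ξ u ∉ p.1)
    (hon : ∀ᶠ u in 𝓝 t₀, u ∈ Icc 0 T → ξ u ∈ p.1 ∨ ξ u ∈ q.1) :
    ProperEncounter L T ξ p.1 t₀ := by
  obtain ⟨N, hN, hNo, hNt⟩ := eventually_nhds_iff.1 hon
  have hK : IsCompact (Icc 0 T \ N) := isCompact_Icc.diff hNo
  have hKim : IsClosed (ξ '' (Icc 0 T \ N)) :=
    (hK.image_of_continuousOn (h.continuousOn.mono sdiff_subset)).isClosed
  have hxK : ξ t₀ ∉ ξ '' (Icc 0 T \ N) := by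
    rintro ⟨u, hu, hux⟩
    exact hu.2 (h.injOn hu.1 ht₀ hux ▸ hNt)
  obtain ⟨ε, hε, hball⟩ := Metric.mem_nhds_iff.1 (hKim.isOpen_compl.mem_nhds hxK)
  refine ⟨ht₀, hx, ε, hε, q, hq, hqp, fun hall => ?_, fun u hu hub => hN u ?_ hu⟩
  · have hb : ∀ᶠ u in 𝓝[Icc 0 T] t₀, ξ u ∈ Metric.ball (ξ t₀) ε :=
      (h.continuousOn t₀ ht₀).eventually (Metric.ball_mem_nhds _ hε)
    obtain ⟨u, hu, hu', hu''⟩ := (hoff.and_eventually (hb.and self_mem_nhdsWithin)).exists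
    exact hu (hall u hu'' hu')
  · by_contra huN
    exact hball hub ⟨u, ⟨hu, huN⟩, rfl⟩

/-- The path `ξ` comes to a stop at time `t`: just before `t` it is off all the lines of a given
minimal speed-limit. -/
def SlowsDown (L : Set (PlanarLine × ℝ)) (ξ : ℝ → Plane) (t : ℝ) : Prop :=
  ∀ v : ℝ, 0 < v → ∀ᶠ u in 𝓝[<] t, ξ u ∉ silhouette L v

/-- A geodesic that reaches a line without slowing down does so along another line. -/
theorem Geodesic.exists_entry_line (hL : Generic L) (h : Geodesic L T ξ) (ht₀ : t₀ ∈ Ioc 0 T)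
    (hoff : ∀ᶠ u in 𝓝[<] t₀, ξ u ∉ p.1) (hslow : ¬ SlowsDown L ξ t₀) :
    ∃ q ∈ L, q.1 ≠ p.1 ∧ ξ t₀ ∈ q.1 ∧ ∀ᶠ u in 𝓝[<] t₀, ξ u ∈ q.1 := by
  -- If no other line through `ξ t₀` is followed just before `t₀`, then by `germ_left` each of them
  -- is avoided there. For every `v` only finitely many lines matter, so the path avoids all lines
  -- of limit at least `v`.
  by_contra! hno
  refine hslow fun v hv => ?_
  have h1 : ∀ᶠ u in 𝓝[<] t₀, ∀ r ∈ {r ∈ L | v ≤ r.2 ∧ |rad r.1| ≤ ‖ξ t₀‖}, ξ t₀ ∈ r.1 →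
      ξ u ∉ r.1 := by
    rw [eventually_all_finite (hL.locallyFinite ‖ξ t₀‖ v hv)]
    rintro r ⟨hr, -, -⟩
    by_cases hxr : ξ t₀ ∈ r.1
    · by_cases hrp : r.1 = p.1
      · rw [hrp]; filter_upwards [hoff] with u hu _ using hu
      · have := hno r hr hrp hxr
        rcases h.germ_left hL hr ht₀ with h' | h'
        · exact absurd h' (by simpa using this)
        · filter_upwards [h'] with u hu _ using hu
    · exact Eventually.of_forall fun _ h => absurd h hxr
  filter_upwards [h1, (h.tendsto_left ht₀).eventually (hL.locallyFinite.eventually_mem hv (ξ t₀))]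
    with u hu1 hu2
  rintro ⟨r, hr, hvr, hur⟩
  have hxr := hu2 r hr hvr hur
  exact hu1 r ⟨hr, hvr, abs_rad_le_norm hxr⟩ hxr hur

/-- The structure of the intersection of a geodesic with a line, provided that no geodesic slows down
just before it starts to follow the line. -/
theorem Geodesic.intersection_structure (hL : Generic L) (h : Geodesic L T ξ) (hp : p ∈ L)
    (hslow : ∀ η : ℝ → Plane, Geodesic L T η → ∀ t ∈ Ioo 0 T, η t ∈ p.1 →
      (∀ᶠ u in 𝓝[>] t, η u ∈ p.1) → ¬ SlowsDown L η t) :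
    ∃ (n : ℕ) (a b : Fin n → ℝ),
      (∀ i, a i ≤ b i) ∧
      {t ∈ Icc 0 T | ξ t ∈ p.1} = ⋃ i, Icc (a i) (b i) ∧
      Pairwise (fun i j => Disjoint (Icc (a i) (b i)) (Icc (a j) (b j))) ∧
      (∀ i, ξ '' Icc (a i) (b i) = segment ℝ (ξ (a i)) (ξ (b i))) ∧
      Pairwise (fun i j =>
        Disjoint (segment ℝ (ξ (a i)) (ξ (b i))) (segment ℝ (ξ (a j)) (ξ (b j)))) ∧
      ∀ i, a i < b i →
        (0 < a i → ProperEncounter L T ξ p.1 (a i) ∧ OnAnotherLine L p.1 (ξ (a i))) ∧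
        (b i < T → ProperEncounter L T ξ p.1 (b i) ∧ OnAnotherLine L p.1 (ξ (b i))) := by
  set A : Set ℝ := {t ∈ Icc 0 T | ξ t ∈ p.1} with hAdef
  have hAcl : IsClosed A := h.continuousOn.preimage_isClosed_of_isClosed isClosed_Icc
    (isClosed_line p.1)
  have hAc : IsCompact A := isCompact_Icc.of_isClosed_subset hAcl fun _ ht => ht.1
  have hr : ∀ t ∈ A, (∀ᶠ u in 𝓝[>] t, u ∈ A) ∨ ∀ᶠ u in 𝓝[>] t, u ∉ A := by
    intro t ht
    rcases ht.1.2.eq_or_lt with rfl | htT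
    · right
      filter_upwards [self_mem_nhdsWithin] with u hu huA
      exact (not_le.2 hu) huA.1.2
    · rcases h.germ_right hL hp ⟨ht.1.1, htT⟩ with h' | h'
      · left
        filter_upwards [h', Ioo_mem_nhdsGT htT] with u hu hu'
        exact ⟨⟨ht.1.1.trans hu'.1.le, hu'.2.le⟩, hu⟩
      · right
        filter_upwards [h'] with u hu huA using hu huA.2
  have hl : ∀ t ∈ A, (∀ᶠ u in 𝓝[<] t, u ∈ A) ∨ ∀ᶠ u in 𝓝[<] t, u ∉ A := by
    intro t ht
    rcases ht.1.1.eq_or_lt with rfl | ht0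
    · right
      filter_upwards [self_mem_nhdsWithin] with u hu huA
      exact (not_le.2 hu) huA.1.1
    · rcases h.germ_left hL hp ⟨ht0, ht.1.2⟩ with h' | h'
      · left
        filter_upwards [h', Ioo_mem_nhdsLT ht0] with u hu hu'
        exact ⟨⟨hu'.1.le, hu'.2.le.trans ht.1.2⟩, hu⟩
      · right
        filter_upwards [h'] with u hu huA using hu huA.2
  obtain ⟨n, a, b, hab, hA, hdisj, hleft, hright⟩ := exists_eq_iUnion_Icc hAc hr hl
  have hsubA : ∀ i, Icc (a i) (b i) ⊆ A := fun i => hA ▸ subset_iUnion (fun i => Icc (a i) (b i)) i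
  have hsubT : ∀ i, Icc (a i) (b i) ⊆ Icc 0 T := fun i u hu => (hsubA i hu).1
  have hseg : ∀ i, ξ '' Icc (a i) (b i) = segment ℝ (ξ (a i)) (ξ (b i)) := fun i =>
    image_Icc_eq_segment (hab i) (h.continuousOn.mono (hsubT i)) (h.injOn.mono (hsubT i))
      fun u hu => (hsubA i hu).2
  refine ⟨n, a, b, hab, hA, hdisj, hseg, fun i j hij => ?_, fun i hi => ⟨fun h0 => ?_, fun hT => ?_⟩⟩
  · change Disjoint (segment ℝ (ξ (a i)) (ξ (b i))) (segment ℝ (ξ (a j)) (ξ (b j)))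
    rw [← hseg i, ← hseg j, Set.disjoint_left]
    rintro _ ⟨u, hu, rfl⟩ ⟨w, hw, hwu⟩
    have := h.injOn (hsubT j hw) (hsubT i hu) hwu
    exact Set.disjoint_left.1 (hdisj hij) hu (this ▸ hw)
  · have haA := hsubA i ⟨le_rfl, hi.le⟩
    have hbA := hsubA i ⟨hi.le, le_rfl⟩
    have hoff : ∀ᶠ u in 𝓝[<] (a i), ξ u ∉ p.1 := by
      filter_upwards [hleft i, Ioo_mem_nhdsLT h0] with u hu hu' hum
      exact hu ⟨⟨hu'.1.le, hu'.2.le.trans haA.1.2⟩, hum⟩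
    have hon : ∀ᶠ u in 𝓝[>] (a i), ξ u ∈ p.1 := by
      filter_upwards [Ioo_mem_nhdsGT hi] with u hu
      exact (hsubA i ⟨hu.1.le, hu.2.le⟩).2
    obtain ⟨q, hq, hqp, hxq, hev⟩ := h.exists_entry_line hL ⟨h0, haA.1.2⟩ hoff
      (hslow ξ h (a i) ⟨h0, hi.trans_le hbA.1.2⟩ haA.2 hon)
    refine ⟨h.properEncounter hq hqp haA.1 haA.2 ?_ ?_, q, hq, hqp, hxq⟩
    · have : 𝓝[<] (a i) ≤ 𝓝[Icc 0 T] (a i) := nhdsWithin_le_iff.2 <|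
        mem_of_superset (Ioo_mem_nhdsLT h0) fun u hu => ⟨hu.1.le, hu.2.le.trans haA.1.2⟩
      exact hoff.frequently.filter_mono this
    · rw [← nhdsLT_sup_nhdsGE, ← Ioi_union_left, nhdsWithin_union, nhdsWithin_singleton]
      refine eventually_sup.2 ⟨?_, eventually_sup.2 ⟨?_, fun _ => Or.inl haA.2⟩⟩
      · filter_upwards [hev] with u hu _ using Or.inr hu
      · filter_upwards [hon] with u hu _ using Or.inl hu
  · have haA := hsubA i ⟨le_rfl, hi.le⟩
    have hbA := hsubA i ⟨hi.le, le_rfl⟩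
    have hoff : ∀ᶠ u in 𝓝[>] (b i), ξ u ∉ p.1 := by
      filter_upwards [hright i, Ioo_mem_nhdsGT hT] with u hu hu' hum
      exact hu ⟨⟨hbA.1.1.trans hu'.1.le, hu'.2.le⟩, hum⟩
    have hon : ∀ᶠ u in 𝓝[<] (b i), ξ u ∈ p.1 := by
      filter_upwards [Ioo_mem_nhdsLT hi] with u hu
      exact (hsubA i ⟨hu.1.le, hu.2.le⟩).2
    have hmapl : map (fun u => T - u) (𝓝[<] (T - b i)) = 𝓝[>] (b i) := by simp
    have hmapr : map (fun u => T - u) (𝓝[>] (T - b i)) = 𝓝[<] (b i) := map_const_sub_nhdsGT T (b i)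
    have hbx : ξ (T - (T - b i)) = ξ (b i) := by simp
    have hb0 : 0 < b i := haA.1.1.trans_lt hi
    rw [← hmapl] at hoff
    rw [← hmapr] at hon
    -- Leaving the line is entering it for the reversed geodesic; for this reason `hslow` is assumed
    -- for all geodesics of duration `T`.
    obtain ⟨q, hq, hqp, hxq, hev⟩ := h.reverse.exists_entry_line hL (t₀ := T - b i) (p := p)
      ⟨by linarith, by linarith⟩ hoff
      (hslow _ h.reverse (T - b i) ⟨by linarith, by linarith⟩ (by rw [hbx]; exact hbA.2) hon)
    rw [hbx] at hxq
    change ∀ᶠ u in map (fun u => T - u) (𝓝[<] (T - b i)), ξ u ∈ q.1 at hev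
    change ∀ᶠ u in map (fun u => T - u) (𝓝[<] (T - b i)), ξ u ∉ p.1 at hoff
    change ∀ᶠ u in map (fun u => T - u) (𝓝[>] (T - b i)), ξ u ∈ p.1 at hon
    rw [hmapl] at hev hoff
    rw [hmapr] at hon
    refine ⟨h.properEncounter hq hqp hbA.1 hbA.2 ?_ ?_, q, hq, hqp, hxq⟩
    · have : 𝓝[>] (b i) ≤ 𝓝[Icc 0 T] (b i) := nhdsWithin_le_iff.2 <|
        mem_of_superset (Ioo_mem_nhdsGT hT) fun u hu => ⟨hb0.le.trans hu.1.le, hu.2.le⟩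
      exact hoff.frequently.filter_mono this
    · rw [← nhdsLT_sup_nhdsGE, ← Ioi_union_left, nhdsWithin_union, nhdsWithin_singleton]
      refine eventually_sup.2 ⟨?_, eventually_sup.2 ⟨?_, fun _ => Or.inl hbA.2⟩⟩
      · filter_upwards [hon] with u hu _ using Or.inl hu
      · filter_upwards [hev] with u hu _ using Or.inr hu

end

section

/-! ### Discrete approximation of feasible paths -/

/-- Continuous induction: the bound from `s` up to time `u` is a closed condition on `u`, and it can
always be pushed a little to the right. -/
theorem dist_le_of_eventually_right {ξ : ℝ → Plane} {s t v : ℝ} (hst : s ≤ t)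
    (hc : ContinuousOn ξ (Icc s t))
    (hloc : ∀ u ∈ Ico s t, ∀ᶠ w in 𝓝[>] u, dist (ξ u) (ξ w) ≤ v * (w - u)) :
    dist (ξ s) (ξ t) ≤ v * (t - s) := by
  have hcl : IsClosed ({u | dist (ξ s) (ξ u) ≤ v * (u - s)} ∩ Icc s t) := by
    have : ContinuousOn (fun u => dist (ξ s) (ξ u) - v * (u - s)) (Icc s t) := by fun_prop
    have := this.preimage_isClosed_of_isClosed isClosed_Icc (isClosed_Iic (a := (0 : ℝ)))
    convert this using 1
    ext u
    simp [and_comm]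
  refine hcl.Icc_subset_of_forall_exists_gt (by simp) (fun u hu w hw => ?_) ⟨hst, le_rfl⟩
  obtain ⟨z, hz, hzw⟩ := ((hloc u hu.2).and (Ioc_mem_nhdsGT hw)).exists
  refine ⟨z, ?_, hzw⟩
  have h1 : dist (ξ s) (ξ u) ≤ v * (u - s) := hu.1
  change dist (ξ s) (ξ z) ≤ v * (z - s)
  linarith [dist_triangle (ξ s) (ξ u) (ξ z)]

variable {E : Set (PlanarLine × ℝ)}

/-- A finite sequence of points `x 0, …, x m`, traversed at time steps of length `1 / (N + 1)`, that
obeys the speed-limits of `E` up to an error `ε`, stays in the ball of radius `R` about `c`, and starts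
on a line of `C` at a point with coordinate `ρ`. -/
structure Admissible (C : Set (PlanarLine × ℝ)) (i : Fin 2) (ρ : ℝ) (c : Plane) (R ε : ℝ)
    (E : Set (PlanarLine × ℝ)) (N m : ℕ) (x : ℕ → Plane) : Prop where
  start_coord : |x 0 i - ρ| < ε
  start_line : (E ∩ {q | q ∈ C ∧ lineDist q.1 (x 0) < ε}).Nonempty
  mem_ball : ∀ k ≤ m, dist (x k) c < R + ε
  step : ∀ k < m, dist (x k) (x (k + 1)) * (N + 1) ≤ ε ∨
    (E ∩ {q | dist (x k) (x (k + 1)) * (N + 1) < q.2 + ε ∧ lineDist q.1 (x k) < ε}).Nonempty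

/-- There is a feasible path of duration `t` to `w`, inside the ball of radius `R` about `c`, from a
point with coordinate `ρ` on a line of `C`. -/
def Arrives (C : Set (PlanarLine × ℝ)) (i : Fin 2) (ρ : ℝ) (c : Plane) (R : ℝ)
    (E : Set (PlanarLine × ℝ)) (w : Plane) (t : ℝ) : Prop :=
  ∃ η : ℝ → Plane, Feasible E 0 t η ∧ η 0 i = ρ ∧ (∃ q ∈ E, q ∈ C ∧ η 0 ∈ q.1) ∧ η t = w ∧
    ∀ u ∈ Icc 0 t, dist (η u) c ≤ R

variable {C : Set (PlanarLine × ℝ)} {i : Fin 2} {ρ : ℝ} {c : Plane} {R : ℝ} {w : Plane} {t : ℝ}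

theorem abs_apply_sub_le_dist (x y : Plane) (i : Fin 2) : |x i - y i| ≤ dist x y := by
  rw [dist_eq_norm, ← Real.norm_eq_abs]
  exact PiLp.norm_apply_le (x - y) i

theorem Arrives.exists_admissible (h : Arrives C i ρ c R E w t) {ε ε' : ℝ} (hε : 0 < ε)
    (hε' : 0 < ε') (n : ℕ) : ∃ (N m : ℕ) (a : ℕ → ℕ), n ≤ N ∧
      Admissible C i ρ c R ε E N m (fun k => TopologicalSpace.denseSeq Plane (a k)) ∧
      (m : ℝ) / (N + 1) ≤ t ∧ dist (TopologicalSpace.denseSeq Plane (a m)) w < ε' := by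
  obtain ⟨η, hη, hη0, ⟨q₀, hq₀, hq₀C, hq₀x⟩, hηt, hball⟩ := h
  obtain ⟨K, hK⟩ := hη.lipschitz
  have ht := hη.le
  -- In one time step `1 / (N + 1)` the path moves by less than `ε / 4` and less than `ε' / 2`.
  obtain ⟨N₀, hN₀⟩ := exists_nat_gt ((K + 1) / min (ε / 4) (ε' / 2))
  set N := max n N₀ with hN
  have hNpos : (0 : ℝ) < N + 1 := by positivity
  set h : ℝ := 1 / (N + 1) with hh
  have hhpos : 0 < h := by positivity
  have hKh : (K : ℝ) * h < min (ε / 4) (ε' / 2) := by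
    rw [div_lt_iff₀ (by positivity)] at hN₀
    have h1 : (N₀ : ℝ) ≤ N := by exact_mod_cast le_max_right n N₀
    rw [hh, mul_one_div, div_lt_iff₀ hNpos]
    have h2 : 0 < min (ε / 4) (ε' / 2) := by positivity
    nlinarith
  have hKh1 : (K : ℝ) * h < ε / 4 := hKh.trans_le (min_le_left _ _)
  have hKh2 : (K : ℝ) * h < ε' / 2 := hKh.trans_le (min_le_right _ _)
  set m := ⌊t * (N + 1)⌋₊ with hm
  have hmt : (m : ℝ) / (N + 1) ≤ t := by
    rw [div_le_iff₀ hNpos]; exact Nat.floor_le (by positivity)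
  have hmt' : t - m * h ≤ h := by
    have := (Nat.lt_floor_add_one (t * (N + 1))).le
    rw [← hm] at this
    rw [hh, mul_one_div, sub_le_iff_le_add, ← add_div, le_div_iff₀ hNpos]
    linarith
  have htime : ∀ k ≤ m, (k : ℝ) * h ∈ Icc 0 t := fun k hk => by
    refine ⟨by positivity, le_trans ?_ hmt⟩
    rw [hh, mul_one_div]
    gcongr
  -- Replacing the points by members of the dense sequence changes the length of a step by at most
  -- `2 * β`, so `β ≤ ε * h / 8` keeps the error of its speed below `ε / 2`.
  set β := min (min (ε / 4) (ε' / 2)) (ε * h / 8) with hβ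
  have hβpos : 0 < β := by positivity
  have hβ1 : β ≤ ε / 4 := (min_le_left _ _).trans (min_le_left _ _)
  have hβ2 : β ≤ ε' / 2 := (min_le_left _ _).trans (min_le_right _ _)
  have hβ3 : β ≤ ε * h / 8 := min_le_right _ _
  have hdense : ∀ k : ℕ, ∃ a : ℕ, dist (TopologicalSpace.denseSeq Plane a) (η (k * h)) < β := by
    intro k
    obtain ⟨a, hy⟩ := (TopologicalSpace.denseRange_denseSeq Plane).exists_dist_lt
      (η (k * h)) hβpos
    exact ⟨a, by rwa [dist_comm]⟩
  choose a ha using hdense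
  have ha0 : dist (TopologicalSpace.denseSeq Plane (a 0)) (η 0) < β := by simpa using ha 0
  refine ⟨N, m, a, le_max_left _ _, ⟨?_, ⟨q₀, hq₀, hq₀C, ?_⟩, fun k hk => ?_, fun k hk => ?_⟩,
    hmt, ?_⟩
  · rw [← hη0]
    exact (abs_apply_sub_le_dist _ _ i).trans_lt (by linarith)
  · exact (lineDist_le_dist hq₀x).trans_lt (by linarith)
  · have := hball _ (htime k hk)
    linarith [dist_triangle (TopologicalSpace.denseSeq Plane (a k)) (η (k * h)) c, ha k]
  · rw [or_iff_not_imp_left]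
    intro hlarge
    rw [not_le] at hlarge
    set D := dist (TopologicalSpace.denseSeq Plane (a k)) (TopologicalSpace.denseSeq Plane (a (k + 1)))
    have hD : D = D * (N + 1) * h := by rw [hh]; field_simp
    have hk1 := htime k hk.le
    have hk2 := htime (k + 1) hk
    have hdiff : ((k + 1 : ℕ) : ℝ) * h - k * h = h := by push_cast; ring
    have hDη : D ≤ dist (η (k * h)) (η ((k + 1 : ℕ) * h)) + 2 * β := by
      have := dist_triangle4 (TopologicalSpace.denseSeq Plane (a k)) (η (k * h))
        (η ((k + 1 : ℕ) * h)) (TopologicalSpace.denseSeq Plane (a (k + 1)))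
      have h1 := ha k
      have h2 := ha (k + 1)
      rw [dist_comm] at h2
      linarith
    by_contra hne
    -- If no line of limit above `D * (N + 1) - ε` is near, the path meets no line of limit at least
    -- `D * (N + 1) - ε / 2` in this step. It then advances by at most `D - ε * h / 2`, which the
    -- error `2 * β` cannot make up for.
    have hob := hη.obeys (D * (N + 1) - ε / 2) (by linarith) (k * h) ((k + 1 : ℕ) * h) hk1.1
      (by linarith) hk2.2 fun u hu => by
        rintro ⟨q, hq, hqv, hqx⟩
        refine hne ⟨q, hq, by linarith, ?_⟩
        have h1 : dist (η (k * h)) (η u) ≤ K * h := by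
          refine (hK.dist_le_mul _ hk1 u ⟨hk1.1.trans hu.1, hu.2.trans hk2.2⟩).trans ?_
          refine mul_le_mul_of_nonneg_left ?_ K.2
          rw [dist_comm, Real.dist_eq, abs_of_nonneg (sub_nonneg.2 hu.1)]
          linarith [hu.2]
        have h2 := lineDist_le_dist (x := TopologicalSpace.denseSeq Plane (a k)) hqx
        linarith [dist_triangle (TopologicalSpace.denseSeq Plane (a k)) (η (k * h)) (η u), ha k]
    rw [hdiff, sub_mul, ← hD] at hob
    nlinarith
  · have hm1 := htime m le_rfl
    have h1 : dist (η (m * h)) (η t) ≤ K * h := by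
      refine (hK.dist_le_mul _ hm1 t ⟨ht, le_rfl⟩).trans (mul_le_mul_of_nonneg_left ?_ K.2)
      rw [dist_comm, Real.dist_eq, abs_of_nonneg (sub_nonneg.2 hm1.2)]
      exact hmt'
    rw [← hηt]
    linarith [dist_triangle (TopologicalSpace.denseSeq Plane (a m)) (η (m * h)) (η t), ha m]

theorem dist_le_of_steps {x : ℕ → Plane} {k l : ℕ} {d : ℝ} (hkl : k ≤ l)
    (h : ∀ j, k ≤ j → j < l → dist (x j) (x (j + 1)) ≤ d) : dist (x k) (x l) ≤ d * ((l : ℝ) - k) := by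
  have := dist_le_Ico_sum_of_dist_le (f := x) (d := fun _ => d) hkl fun hj hj' => h _ hj hj'
  simpa [Nat.cast_sub hkl, mul_comm] using this

/-- The index reached at time `s` by a sequence of `m` steps of length `1 / (N + 1)`. -/
def timeIndex (N m : ℕ) (s : ℝ) : ℕ := min m ⌊s * (N + 1)⌋₊

theorem timeIndex_mono (N m : ℕ) {s t : ℝ} (hst : s ≤ t) : timeIndex N m s ≤ timeIndex N m t :=
  min_le_min le_rfl (Nat.floor_mono (mul_le_mul_of_nonneg_right hst (by positivity)))

theorem timeIndex_sub_le (N m : ℕ) {s t : ℝ} (hs : 0 ≤ s) (hst : s ≤ t) :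
    (timeIndex N m t : ℝ) - timeIndex N m s ≤ (t - s) * (N + 1) + 1 := by
  have h1 : (⌊t * (N + 1)⌋₊ : ℝ) ≤ t * (N + 1) := Nat.floor_le (mul_nonneg (hs.trans hst) (by positivity))
  have h2 := Nat.lt_floor_add_one (s * (N + 1) : ℝ)
  have h3 : (0 : ℝ) ≤ (t - s) * (N + 1) := mul_nonneg (sub_nonneg.2 hst) (by positivity)
  unfold timeIndex
  push_cast
  rcases le_total (m : ℝ) ⌊s * (N + 1)⌋₊ with h | h
  · rw [min_eq_left h]
    linarith [min_le_left (m : ℝ) ⌊t * (N + 1)⌋₊]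
  · rw [min_eq_right h]
    linarith [min_le_right (m : ℝ) ⌊t * (N + 1)⌋₊]

/-- Approximately feasible sequences of points have a feasible path as a limit. -/
theorem exists_arrives_of_admissible (hE : LocallyFiniteSpeeds E) {M : PlanarLine × ℝ}
    (hM : ∀ q ∈ E, q ∈ C → q = M) {N m : ℕ → ℕ} {x : ℕ → ℕ → Plane} {B : ℝ}
    (hN : ∀ n, n ≤ N n)
    (hx : ∀ n : ℕ, Admissible C i ρ c R (1 / ((n : ℝ) + 1)) E (N n) (m n) (x n))
    (hB : ∀ n, (m n : ℝ) / (N n + 1) ≤ B) :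
    ∃ (w : Plane) (t : ℝ) (𝒰 : Ultrafilter ℕ), (𝒰 : Filter ℕ) ≤ atTop ∧ Arrives C i ρ c R E w t ∧
      Tendsto (fun n => (m n : ℝ) / (N n + 1)) 𝒰 (𝓝 t) ∧ Tendsto (fun n => x n (m n)) 𝒰 (𝓝 w) := by
  -- a bound for the speeds
  obtain ⟨W, hW0, hW⟩ : ∃ W : ℝ, 0 < W ∧ ∀ n, ∀ k < m n,
      dist (x n k) (x n (k + 1)) ≤ W * (1 / ((N n : ℝ) + 1)) := by
    -- The points of the discrete paths are within `R + 1` of `c`, and the lines used are within `1`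
    -- of them, so these lines are at distance at most `‖c‖ + R + 2` from the origin. Finitely many
    -- of them have limit at least `1`.
    obtain ⟨V, hV⟩ := ((hE (‖c‖ + R + 2) 1 one_pos).image Prod.snd).bddAbove
    refine ⟨max V 1 + 1, by positivity, fun n k hk => ?_⟩
    have hpos : (0 : ℝ) < (N n : ℝ) + 1 := by positivity
    have hε1 : 1 / ((n : ℝ) + 1) ≤ 1 := by
      rw [div_le_one (by positivity)]; linarith [n.cast_nonneg (α := ℝ)]
    rw [mul_one_div, le_div_iff₀ hpos]
    rcases (hx n).step k hk with h1 | ⟨q, hq, hqv, hqx⟩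
    · linarith [le_max_right V 1]
    · have : q.2 ≤ max V 1 := by
        by_cases h1 : 1 ≤ q.2
        · refine le_max_of_le_left (hV ⟨q, ⟨hq, h1, ?_⟩, rfl⟩)
          obtain ⟨y, hy, hyd⟩ := exists_mem_line_dist_eq q.1 (x n k)
          have h2 := abs_rad_le_norm hy
          have h3 := (hx n).mem_ball k hk.le
          have h4 : ‖y‖ ≤ ‖c‖ + dist y c := by
            rw [dist_eq_norm]
            calc ‖y‖ = ‖c + (y - c)‖ := by abel_nf
              _ ≤ _ := norm_add_le _ _
          have h5 := dist_triangle y (x n k) c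
          rw [dist_comm y (x n k)] at h5
          linarith
        · exact le_max_of_le_right (not_le.1 h1).le
      linarith
  set h : ℕ → ℝ := fun n => 1 / ((N n : ℝ) + 1) with hh
  have hhpos : ∀ n, 0 < h n := fun n => by simp only [hh]; positivity
  have hε : Tendsto (fun n : ℕ => 1 / ((n : ℝ) + 1)) atTop (𝓝 0) := tendsto_one_div_add_atTop_nhds_zero_nat
  have hh0 : Tendsto h atTop (𝓝 0) := by
    refine squeeze_zero (fun n => (hhpos n).le) (fun n => ?_) hε
    simp only [hh]
    have : (n : ℝ) ≤ N n := by exact_mod_cast hN n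
    gcongr
  -- the interpolated paths
  set y : ℕ → ℝ → Plane := fun n s => x n (timeIndex (N n) (m n) s) with hy
  have hidx : ∀ n s, timeIndex (N n) (m n) s ≤ m n := fun n s => min_le_left _ _
  have hchain : ∀ n (v s u : ℝ), 0 ≤ v → 0 ≤ s → s ≤ u →
      (∀ j, timeIndex (N n) (m n) s ≤ j → j < timeIndex (N n) (m n) u →
        dist (x n j) (x n (j + 1)) ≤ v * h n) → dist (y n s) (y n u) ≤ v * ((u - s) + h n) := by
    intro n v s u hv hs hsu hj
    refine (dist_le_of_steps (timeIndex_mono _ _ hsu) hj).trans ?_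
    have h1 := timeIndex_sub_le (N n) (m n) hs hsu
    have h2 : h n * (N n + 1) = 1 := by simp only [hh]; field_simp
    calc v * h n * _ ≤ v * h n * ((u - s) * (N n + 1) + 1) :=
          mul_le_mul_of_nonneg_left h1 (mul_nonneg hv (hhpos n).le)
      _ = v * ((u - s) * (h n * (N n + 1)) + h n) := by ring
      _ = _ := by rw [h2, mul_one]
  have hylip : ∀ n (s u : ℝ), 0 ≤ s → s ≤ u → dist (y n s) (y n u) ≤ W * ((u - s) + h n) :=
    fun n s u hs hsu => hchain n W s u hW0.le hs hsu fun j _ hj => hW n j (hj.trans_le (hidx n u))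
  -- Along an ultrafilter the bounded sequences `y n s` converge for all real `s` at once.
  set 𝒰 := hyperfilter ℕ with h𝒰
  have h𝒰top : (𝒰 : Filter ℕ) ≤ atTop := Nat.hyperfilter_le_atTop
  have hε𝒰 := hε.mono_left h𝒰top
  have hh𝒰 := hh0.mono_left h𝒰top
  have hyball : ∀ n s, dist (y n s) c < R + 1 / ((n : ℝ) + 1) := fun n s =>
    (hx n).mem_ball _ (hidx n s)
  have hlim : ∀ z : ℕ → Plane, (∀ n, dist (z n) c < R + 1 / ((n : ℝ) + 1)) →
      ∃ p : Plane, Tendsto z 𝒰 (𝓝 p) := by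
    intro z hz
    have hcomp : IsCompact (Metric.closedBall c (R + 1)) := isCompact_closedBall c (R + 1)
    have : ↑(𝒰.map z) ≤ 𝓟 (Metric.closedBall c (R + 1)) := by
      rw [le_principal_iff]
      refine mem_map.2 (Eventually.of_forall fun n => ?_)
      have hε1 : 1 / ((n : ℝ) + 1) ≤ 1 := by
        rw [div_le_one (by positivity)]; linarith [n.cast_nonneg (α := ℝ)]
      exact Metric.mem_closedBall.2 ((hz n).le.trans (by linarith))
    obtain ⟨p, -, hp⟩ := hcomp.ultrafilter_le_nhds _ this
    exact ⟨p, hp⟩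
  choose η hη using fun s => hlim (fun n => y n s) fun n => hyball n s
  obtain ⟨w, hw⟩ := hlim (fun n => x n (m n)) fun n => (hx n).mem_ball _ le_rfl
  obtain ⟨t, ht0, htlim⟩ : ∃ t ∈ Icc 0 B, Tendsto (fun n => (m n : ℝ) / (N n + 1)) 𝒰 (𝓝 t) := by
    have : ↑(𝒰.map fun n => (m n : ℝ) / (N n + 1)) ≤ 𝓟 (Icc 0 B) := by
      rw [le_principal_iff]
      exact mem_map.2 (Eventually.of_forall fun n => ⟨by positivity, hB n⟩)
    exact isCompact_Icc.ultrafilter_le_nhds _ this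
  have hηlip : ∀ s u, 0 ≤ s → s ≤ u → dist (η s) (η u) ≤ W * (u - s) := by
    intro s u hs hsu
    have h1 : Tendsto (fun n => W * ((u - s) + h n)) 𝒰 (𝓝 (W * ((u - s) + 0))) :=
      (tendsto_const_nhds.add hh𝒰).const_mul W
    rw [add_zero] at h1
    exact le_of_tendsto_of_tendsto' ((hη s).dist (hη u)) h1 fun n => hylip n s u hs hsu
  have hηL : LipschitzOnWith ⟨W, hW0.le⟩ η (Icc 0 t) := by
    refine LipschitzOnWith.of_dist_le_mul fun s hs u hu => ?_
    change _ ≤ W * _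
    rcases le_total s u with hsu | hsu
    · rw [dist_comm s u, Real.dist_eq, abs_of_nonneg (sub_nonneg.2 hsu)]
      exact hηlip s u hs.1 hsu
    · rw [Real.dist_eq, abs_of_nonneg (sub_nonneg.2 hsu), dist_comm]
      exact hηlip u s hu.1 hsu
  have hηt : η t = w := by
    refine tendsto_nhds_unique (hη t) ?_
    refine hw.congr_dist (squeeze_zero (fun _ => dist_nonneg) (fun n => ?_)
      (g := fun n => W * (|(m n : ℝ) / (N n + 1) - t| + h n)) ?_)
    · have hdist := dist_le_of_steps (x := x n) (hidx n t) fun j _ hj => hW n j hj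
      rw [dist_comm]
      refine hdist.trans ?_
      rw [mul_assoc]
      refine mul_le_mul_of_nonneg_left ?_ hW0.le
      have hpos : (0 : ℝ) < (N n : ℝ) + 1 := by positivity
      change 1 / ((N n : ℝ) + 1) * _ ≤ |(m n : ℝ) / (N n + 1) - t| + 1 / ((N n : ℝ) + 1)
      have h2 := Nat.lt_floor_add_one (t * (N n + 1) : ℝ)
      have h3 : (m n : ℝ) - timeIndex (N n) (m n) t ≤ |(m n : ℝ) - t * (N n + 1)| + 1 := by
        unfold timeIndex
        push_cast
        rcases le_total (m n : ℝ) ⌊t * (N n + 1)⌋₊ with h | h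
        · rw [min_eq_left h, sub_self]; positivity
        · rw [min_eq_right h]
          linarith [le_abs_self ((m n : ℝ) - t * (N n + 1))]
      have h4 : |(m n : ℝ) / (N n + 1) - t| = |(m n : ℝ) - t * (N n + 1)| / (N n + 1) := by
        rw [← abs_of_pos hpos, ← abs_div, abs_of_pos hpos]
        congr 1
        field_simp
      rw [h4, ← add_div, one_div, inv_mul_eq_div]
      gcongr
    · have : Tendsto (fun n => W * (|(m n : ℝ) / (N n + 1) - t| + h n)) 𝒰
          (𝓝 (W * (|t - t| + 0))) := (((htlim.sub_const t).abs).add hh𝒰).const_mul W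
      simpa using this
  have hind0 : ∀ n, timeIndex (N n) (m n) 0 = 0 := fun n => by simp [timeIndex]
  have hx0 : Tendsto (fun n => x n 0) 𝒰 (𝓝 (η 0)) := by
    have := hη 0
    simpa only [hy, hind0] using this
  refine ⟨w, t, 𝒰, h𝒰top, ⟨η, ⟨ht0.1, ⟨_, hηL⟩, fun v hv s s' hs hss ht hoff => ?_⟩, ?_, ?_, hηt,
    fun u hu => ?_⟩, htlim, hw⟩
  · refine dist_le_of_eventually_right hss (hηL.continuousOn.mono (Icc_subset_Icc hs ht)) fun u hu => ?_
    -- No line of limit at least `v` passes within `d` of `η u`. The margins of `d / 8` keep the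
    -- discrete paths within `d / 2` of `η u` up to time `w'`, so their steps use only slower lines
    -- and have speed at most `v + 1 / (n + 1)`.
    have hu0 : 0 ≤ u := hs.trans hu.1
    obtain ⟨d, hd, hdE⟩ := Metric.eventually_nhds_iff_ball.1 (hE.eventually_mem hv (η u))
    have hfar : ∀ z, dist z (η u) < d / 2 → ∀ q ∈ E, v ≤ q.2 → d / 2 ≤ lineDist q.1 z := by
      intro z hz q hq hvq
      by_contra! hlt
      obtain ⟨z', hz', hzd⟩ := exists_mem_line_dist_eq q.1 z
      have : z' ∈ Metric.ball (η u) d := by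
        rw [Metric.mem_ball]
        linarith [dist_triangle z' z (η u), dist_comm z z']
      exact hoff u ⟨hu.1, hu.2.le⟩ ⟨q, hq, hvq, hdE z' this q hq hvq hz'⟩
    filter_upwards [Ioo_mem_nhdsGT (show u < u + d / (8 * W) by linarith [show 0 < d / (8 * W) by positivity])]
      with w' hw'
    have hwu : W * (w' - u) ≤ d / 8 := by
      have : w' - u ≤ d / (8 * W) := by linarith [hw'.2]
      calc W * (w' - u) ≤ W * (d / (8 * W)) := mul_le_mul_of_nonneg_left this hW0.le
        _ = d / 8 := by field_simp
    have ev1 : ∀ᶠ n in (𝒰 : Filter ℕ), dist (y n u) (η u) < d / 8 :=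
      (hη u).eventually (Metric.ball_mem_nhds _ (by positivity))
    have ev2 : ∀ᶠ n in (𝒰 : Filter ℕ), h n < d / (8 * W) :=
      hh𝒰.eventually (gt_mem_nhds (by positivity))
    have ev3 : ∀ᶠ n : ℕ in (𝒰 : Filter ℕ), 1 / ((n : ℝ) + 1) < d / 2 :=
      hε𝒰.eventually (gt_mem_nhds (by positivity))
    have hlim2 : Tendsto (fun n : ℕ => (v + 1 / ((n : ℝ) + 1)) * ((w' - u) + h n)) 𝒰
        (𝓝 ((v + 0) * ((w' - u) + 0))) :=
      (tendsto_const_nhds.add hε𝒰).mul (tendsto_const_nhds.add hh𝒰)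
    rw [add_zero, add_zero] at hlim2
    refine le_of_tendsto_of_tendsto ((hη u).dist (hη w')) hlim2 ?_
    filter_upwards [ev1, ev2, ev3] with n e1 e2 e3
    refine hchain n _ u w' (by positivity) hu0 hw'.1.le fun j hj1 hj2 => ?_
    have hjm : j < m n := hj2.trans_le (hidx n w')
    have hWh : W * h n ≤ d / 8 := by
      calc W * h n ≤ W * (d / (8 * W)) := mul_le_mul_of_nonneg_left e2.le hW0.le
        _ = d / 8 := by field_simp
    have hnear : dist (x n j) (η u) < d / 2 := by
      have h1 := dist_le_of_steps (x := x n) hj1 fun k _ hk => hW n k (hk.trans hjm)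
      have h2 := timeIndex_sub_le (N n) (m n) hu0 hw'.1.le
      have h3 : (j : ℝ) ≤ timeIndex (N n) (m n) w' := by exact_mod_cast hj2.le
      have h4 : h n * (N n + 1) = 1 := by simp only [hh]; field_simp
      have h5 : W * h n * ((j : ℝ) - timeIndex (N n) (m n) u) ≤ W * (w' - u) + W * h n := by
        calc W * h n * ((j : ℝ) - timeIndex (N n) (m n) u)
            ≤ W * h n * ((w' - u) * (N n + 1) + 1) :=
              mul_le_mul_of_nonneg_left (by linarith) (mul_nonneg hW0.le (hhpos n).le)
          _ = W * ((w' - u) * (h n * (N n + 1))) + W * h n := by ring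
          _ = _ := by rw [h4, mul_one]
      have h6 : dist (y n u) (x n j) ≤ d / 4 := by
        change dist (x n (timeIndex (N n) (m n) u)) (x n j) ≤ d / 4
        linarith
      linarith [dist_triangle (x n j) (y n u) (η u), dist_comm (x n j) (y n u)]
    change _ ≤ _ * (1 / ((N n : ℝ) + 1))
    rw [mul_one_div, le_div_iff₀ (by positivity)]
    rcases (hx n).step j hjm with h1 | ⟨q, hq, hqv, hqx⟩
    · linarith
    · have : q.2 < v := by
        by_contra! hle
        exact absurd (hfar _ hnear q hq hle) (by linarith)
      linarith
  · have h1 : Tendsto (fun n => |x n 0 i - ρ|) 𝒰 (𝓝 |η 0 i - ρ|) := by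
      have hcont : Continuous fun z : Plane => |z i - ρ| := by fun_prop
      exact (hcont.tendsto (η 0)).comp hx0
    have h2 := le_of_tendsto_of_tendsto' h1 hε𝒰 fun n => (hx n).start_coord.le
    have h3 := abs_nonpos_iff.1 h2
    linarith
  · have hME : M ∈ E ∧ M ∈ C := by
      obtain ⟨q, hq, hqC, -⟩ := (hx 0).start_line
      rw [← hM q hq hqC]
      exact ⟨hq, hqC⟩
    refine ⟨M, hME.1, hME.2, mem_line_iff.2 ?_⟩
    have h1 : Tendsto (fun n => lineDist M.1 (x n 0)) 𝒰 (𝓝 (lineDist M.1 (η 0))) := by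
      have hcont : Continuous (lineDist M.1) := ((continuous_nrm _).sub continuous_const).abs
      exact (hcont.tendsto (η 0)).comp hx0
    have h2 := le_of_tendsto_of_tendsto' h1 hε𝒰 fun n => by
      obtain ⟨q, hq, hqC, hqx⟩ := (hx n).start_line
      rw [← hM q hq hqC]
      exact hqx.le
    have h3 := abs_nonpos_iff.1 h2
    linarith
  · have h1 : Tendsto (fun n : ℕ => R + 1 / ((n : ℝ) + 1)) 𝒰 (𝓝 (R + 0)) :=
      tendsto_const_nhds.add hε𝒰
    rw [add_zero] at h1
    exact le_of_tendsto_of_tendsto' ((hη u).dist tendsto_const_nhds) h1 fun n => (hyball n u).le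

end

section

/-! ### A monotone travel-cost functional -/

/-- An open box in the space of marked lines, with given bounds for the signed distance from the
origin, the angle and the speed-limit. -/
def boxSet (b : (ℚ × ℚ) × (ℚ × ℚ) × (ℚ × ℚ)) : Set (PlanarLine × ℝ) :=
  {q | rad q.1 ∈ Ioo (b.1.1 : ℝ) b.1.2 ∧ ang q.1 ∈ Ioo (b.2.1.1 : ℝ) b.2.1.2 ∧
    q.2 ∈ Ioo (b.2.2.1 : ℝ) b.2.2.2}

/-- Rational data for the comparison of travel costs near a line: paths start on a line in a box, at a
point with a given coordinate, and stay in a ball. -/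
structure Probe where
  /-- the box that contains the starting line -/
  box : (ℚ × ℚ) × (ℚ × ℚ) × (ℚ × ℚ)
  /-- the index of the given coordinate of the starting point -/
  coord : Fin 2
  /-- the given coordinate of the starting point -/
  start : ℚ
  /-- the index of the centre of the ball -/
  center : ℕ
  /-- the radius of the ball -/
  radius : ℚ
  /-- the side of the line from which it is approached -/
  side : ℤˣ
  /-- the sense in which the line is followed -/
  slope : ℚ
  /-- the cost of the displacement perpendicular to the line -/
  tilt : ℚ
  /-- the bound at which costs are truncated -/
  cap : ℕ

/-- Countability permits a single null set for all probes. -/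
instance : Countable Probe := by
  let f : Probe → ((ℚ × ℚ) × (ℚ × ℚ) × (ℚ × ℚ)) × Fin 2 × ℚ × ℕ × ℚ × ℤˣ × ℚ × ℚ × ℕ :=
    fun Q => (Q.box, Q.coord, Q.start, Q.center, Q.radius, Q.side, Q.slope, Q.tilt, Q.cap)
  refine Function.Injective.countable (f := f) fun Q Q' h => ?_
  cases Q
  cases Q'
  simp only [f, Prod.mk.injEq] at h
  simp [h]

/-- The linear part of the travel cost. -/
def linearCost (s l θ v : ℝ) (w : Plane) : ℝ := l * nrm θ w - s * tng θ w / v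

theorem abs_linearCost_sub_le (s l θ : ℝ) {v : ℝ} (hv : 0 < v) (x y : Plane) :
    |linearCost s l θ v x - linearCost s l θ v y| ≤ (|l| + |s| / v) * dist x y := by
  have h1 := abs_nrm_sub_le θ x y
  have h2 := abs_tng_sub_le θ x y
  have e : linearCost s l θ v x - linearCost s l θ v y =
      l * (nrm θ x - nrm θ y) - s * (tng θ x - tng θ y) / v := by
    unfold linearCost; ring
  rw [e]
  refine (abs_sub _ _).trans ?_
  rw [abs_mul, abs_div, abs_mul, abs_of_pos hv, add_mul, div_mul_eq_mul_div]
  gcongr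

theorem abs_linearCost_le (s l θ : ℝ) {v : ℝ} (hv : 0 < v) (x : Plane) :
    |linearCost s l θ v x| ≤ (|l| + |s| / v) * ‖x‖ := by
  have := abs_linearCost_sub_le s l θ hv x 0
  simpa [linearCost, nrm, tng] using this

theorem continuous_linearCost (s l θ v : ℝ) : Continuous (linearCost s l θ v) := by
  have h1 := continuous_nrm θ
  have h2 := continuous_tng θ
  unfold linearCost
  fun_prop

namespace Probe

variable (Q : Probe)

/-- The centre of the ball. -/
def ctr : Plane := TopologicalSpace.denseSeq Plane Q.center

/-- The side as a real number. -/
def sgn : ℝ := ((Q.side : ℤ) : ℝ)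

/-- The linear part of the travel cost. -/
def lin (θ v : ℝ) (w : Plane) : ℝ := linearCost Q.slope Q.tilt θ v w

/-- The points of a discrete path given by indices into the dense sequence. -/
def pts (l : List ℕ) (k : ℕ) : Plane := TopologicalSpace.denseSeq Plane (l.getD k 0)

/-- The discrete path `j` is admissible for the `n`-th approximation and ends beyond the level `r`. -/
def Valid (n : ℕ) (j : ℕ × ℕ × List ℕ) (r θ : ℝ) (E : Set (PlanarLine × ℝ)) : Prop :=
  n ≤ j.1 ∧ Admissible (boxSet Q.box) Q.coord Q.start Q.ctr Q.radius (1 / ((n : ℝ) + 1)) E j.1 j.2.1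
    (pts j.2.2) ∧ r - 1 / ((n : ℝ) + 1) < Q.sgn * nrm θ (pts j.2.2 j.2.1)

open Classical in
/-- The truncated cost of the discrete path `j`. -/
def cost (n : ℕ) (j : ℕ × ℕ × List ℕ) (r θ v : ℝ) (E : Set (PlanarLine × ℝ)) : ℝ :=
  if Q.Valid n j r θ E then
    max (-(Q.cap : ℝ)) (min Q.cap ((j.2.1 : ℝ) / (j.1 + 1) + Q.lin θ v (pts j.2.2 j.2.1)))
  else Q.cap

/-- The least cost of reaching the level `r`. -/
def value (r θ v : ℝ) (E : Set (PlanarLine × ℝ)) : ℝ := ⨆ n, ⨅ j, Q.cost n j r θ v E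

variable {Q} {n : ℕ} {j : ℕ × ℕ × List ℕ} {r r' θ v : ℝ} {E : Set (PlanarLine × ℝ)}

theorem cost_mem : Q.cost n j r θ v E ∈ Icc (-(Q.cap : ℝ)) Q.cap := by
  have h0 : (0 : ℝ) ≤ Q.cap := Nat.cast_nonneg _
  unfold cost
  split_ifs
  · exact ⟨le_max_left _ _, max_le (by linarith) (min_le_left _ _)⟩
  · exact ⟨by linarith, le_rfl⟩

theorem bddBelow_cost : BddBelow (range fun j => Q.cost n j r θ v E) :=
  ⟨-(Q.cap : ℝ), by rintro _ ⟨j, rfl⟩; exact cost_mem.1⟩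

theorem bddAbove_iInf_cost : BddAbove (range fun n => ⨅ j, Q.cost n j r θ v E) :=
  ⟨Q.cap, by
    rintro _ ⟨n, rfl⟩
    exact (ciInf_le bddBelow_cost (0, 0, [])).trans cost_mem.2⟩

theorem cost_mono (h : r ≤ r') : Q.cost n j r θ v E ≤ Q.cost n j r' θ v E := by
  by_cases h1 : Q.Valid n j r' θ E
  · have h2 : Q.Valid n j r θ E := ⟨h1.1, h1.2.1, (sub_le_sub_right h _).trans_lt h1.2.2⟩
    simp [cost, h1, h2]
  · rw [show Q.cost n j r' θ v E = Q.cap by simp [cost, h1]]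
    exact cost_mem.2

/-- A farther level is reached by fewer paths. This monotonicity is the only regularity of the cost
that the argument uses. -/
theorem value_mono (θ v : ℝ) (E : Set (PlanarLine × ℝ)) : Monotone fun r => Q.value r θ v E :=
  fun _ _ h => ciSup_mono bddAbove_iInf_cost fun _ => ciInf_mono bddBelow_cost fun _ => cost_mono h

theorem abs_sgn_eq_one : |Q.sgn| = 1 := by
  unfold sgn
  rcases Int.units_eq_one_or Q.side with h | h <;> simp [h]

/-- Sampling an actual path gives a valid discrete path for every `n`, with cost at most `B + δ`.
Together with `le_value` this identifies `value`, up to truncation, with the least cost of an actual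
arrival. -/
theorem value_le {w : Plane} {t B : ℝ} (hv : 0 < v)
    (h : Arrives (boxSet Q.box) Q.coord Q.start Q.ctr Q.radius E w t) (hr : r ≤ Q.sgn * nrm θ w)
    (hB : t + Q.lin θ v w ≤ B) (hcap : -(Q.cap : ℝ) ≤ B) : Q.value r θ v E ≤ B := by
  refine ciSup_le fun n => le_of_forall_pos_le_add fun δ hδ => ?_
  set κ : ℝ := |(Q.tilt : ℝ)| + |(Q.slope : ℝ)| / v + 1 with hκ
  have hκ0 : 0 < κ := by positivity
  obtain ⟨N, m, a, hnN, hadm, hmt, hend⟩ := h.exists_admissible (ε := 1 / ((n : ℝ) + 1))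
    (ε' := min (1 / ((n : ℝ) + 1)) (δ / κ)) (by positivity) (by positivity) n
  -- The list has the `m + 1` entries for the indices `0` to `m`, so the default of `getD` does not
  -- occur at them.
  have hpts : ∀ k ≤ m, pts ((List.range (m + 1)).map a) k = TopologicalSpace.denseSeq Plane (a k) := by
    intro k hk
    have : k < ((List.range (m + 1)).map a).length := by simpa using Nat.lt_succ_of_le hk
    rw [pts, List.getD_eq_getElem _ _ this]
    simp
  have hadm' : Admissible (boxSet Q.box) Q.coord Q.start Q.ctr Q.radius (1 / ((n : ℝ) + 1)) E N m
      (pts ((List.range (m + 1)).map a)) := by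
    refine ⟨?_, ?_, fun k hk => ?_, fun k hk => ?_⟩
    · rw [hpts 0 (Nat.zero_le _)]; exact hadm.start_coord
    · rw [hpts 0 (Nat.zero_le _)]; exact hadm.start_line
    · rw [hpts k hk]; exact hadm.mem_ball k hk
    · rw [hpts k hk.le, hpts (k + 1) hk]; exact hadm.step k hk
  refine (ciInf_le bddBelow_cost (N, m, (List.range (m + 1)).map a)).trans ?_
  have hvalid : Q.Valid n (N, m, (List.range (m + 1)).map a) r θ E := by
    refine ⟨hnN, hadm', ?_⟩
    rw [hpts m le_rfl]
    have h1 : |Q.sgn * nrm θ w - Q.sgn * nrm θ (TopologicalSpace.denseSeq Plane (a m))| <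
        1 / ((n : ℝ) + 1) := by
      rw [← mul_sub, abs_mul, abs_sgn_eq_one, one_mul]
      refine (abs_nrm_sub_le _ _ _).trans_lt ?_
      rw [dist_comm]
      exact hend.trans_le (min_le_left _ _)
    linarith [le_abs_self (Q.sgn * nrm θ w - Q.sgn * nrm θ (TopologicalSpace.denseSeq Plane (a m)))]
  rw [cost, if_pos hvalid]
  refine max_le (by linarith) ((min_le_right _ _).trans ?_)
  simp only [hpts m le_rfl]
  have h2 := abs_linearCost_sub_le (Q.slope : ℝ) (Q.tilt : ℝ) θ hv
    (TopologicalSpace.denseSeq Plane (a m)) w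
  have h3 : (|(Q.tilt : ℝ)| + |(Q.slope : ℝ)| / v) * dist (TopologicalSpace.denseSeq Plane (a m)) w ≤
      δ := by
    calc _ ≤ κ * (δ / κ) := by
          refine mul_le_mul (by simp [hκ]) (hend.le.trans (min_le_right _ _)) dist_nonneg hκ0.le
      _ = δ := by field_simp
  have h4 := (le_abs_self _).trans (h2.trans h3)
  unfold lin at hB ⊢
  linarith

/-- Were the value below `B`, there would be, for each `n`, a discrete path of cost less than some
`B' < B`. As `B ≤ Q.cap`, these are valid, since invalid ones cost `Q.cap`; their limit is an
arrival of cost at most `B'`. -/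
theorem le_value {M : PlanarLine × ℝ} {B : ℝ} (hE : LocallyFiniteSpeeds E)
    (hM : ∀ q ∈ E, q ∈ boxSet Q.box → q = M) (hv : 0 < v) (hcap : B ≤ Q.cap)
    (h : ∀ w t, Arrives (boxSet Q.box) Q.coord Q.start Q.ctr Q.radius E w t →
      r ≤ Q.sgn * nrm θ w → B ≤ t + Q.lin θ v w) : B ≤ Q.value r θ v E := by
  by_contra! hlt
  obtain ⟨B', hB', hB'B⟩ := exists_between hlt
  have hj : ∀ n, ∃ j, Q.cost n j r θ v E < B' := fun n =>
    exists_lt_of_ciInf_lt ((le_ciSup bddAbove_iInf_cost n).trans_lt hB')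
  choose j hj using hj
  have hvalid : ∀ n, Q.Valid n (j n) r θ E := fun n => by
    by_contra hno
    have := hj n
    rw [cost, if_neg hno] at this
    linarith
  have hcost : ∀ n, ((j n).2.1 : ℝ) / ((j n).1 + 1) +
      Q.lin θ v (pts (j n).2.2 (j n).2.1) < B' := fun n => by
    have := hj n
    rw [cost, if_pos (hvalid n)] at this
    rcases min_lt_iff.1 ((le_max_right _ _).trans_lt this) with h1 | h1
    · linarith
    · exact h1
  obtain ⟨w, t, 𝒰, h𝒰, harr, htlim, hwlim⟩ := exists_arrives_of_admissible (hE := hE) hM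
    (N := fun n => (j n).1) (m := fun n => (j n).2.1) (x := fun n => pts (j n).2.2)
    -- The linear part is bounded on the ball, so a bound for the cost is one for the time.
    (B := B' + (|(Q.tilt : ℝ)| + |(Q.slope : ℝ)| / v) * (‖Q.ctr‖ + (Q.radius + 1)))
    (fun n => (hvalid n).1) (fun n => (hvalid n).2.1) fun n => by
      have h1 := hcost n
      have h2 := abs_linearCost_le (Q.slope : ℝ) (Q.tilt : ℝ) θ hv (pts (j n).2.2 (j n).2.1)
      have h3 : ‖pts (j n).2.2 (j n).2.1‖ ≤ ‖Q.ctr‖ + (Q.radius + 1) := by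
        have h4 := (hvalid n).2.1.mem_ball _ le_rfl
        have h5 := norm_sub_norm_le (pts (j n).2.2 (j n).2.1) Q.ctr
        rw [dist_eq_norm] at h4
        have hε1 : 1 / ((n : ℝ) + 1) ≤ 1 := by
          rw [div_le_one (by positivity)]; linarith [n.cast_nonneg (α := ℝ)]
        linarith
      have h4 := mul_le_mul_of_nonneg_left h3
        (show 0 ≤ |(Q.tilt : ℝ)| + |(Q.slope : ℝ)| / v by positivity)
      have h5 := neg_abs_le (linearCost (Q.slope : ℝ) (Q.tilt : ℝ) θ v (pts (j n).2.2 (j n).2.1))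
      unfold lin at h1
      linarith
  have hε : Tendsto (fun n : ℕ => 1 / ((n : ℝ) + 1)) 𝒰 (𝓝 0) :=
    tendsto_one_div_add_atTop_nhds_zero_nat.mono_left h𝒰
  have h1 : r ≤ Q.sgn * nrm θ w := by
    have e1 : Tendsto (fun n : ℕ => r - 1 / ((n : ℝ) + 1)) 𝒰 (𝓝 (r - 0)) := tendsto_const_nhds.sub hε
    rw [sub_zero] at e1
    exact le_of_tendsto_of_tendsto' e1 ((((continuous_nrm θ).tendsto w).comp hwlim).const_mul Q.sgn)
      fun n => (hvalid n).2.2.le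
  have h2 : t + Q.lin θ v w ≤ B' :=
    le_of_tendsto' (htlim.add (((continuous_linearCost _ _ θ v).tendsto w).comp hwlim))
      fun n => (hcost n).le
  linarith [h w t harr h1]

end Probe

/-- The difference quotients of `f` to the left of `x` tend to infinity along `1 / (k + 1)`. -/
def IsSteep (f : ℝ → ℝ) (x : ℝ) : Prop :=
  ∀ A : ℕ, ∃ N : ℕ, ∀ k ≥ N, (A : ℝ) / (k + 1) ≤ f x - f (x - 1 / ((k : ℝ) + 1))

theorem not_isSteep_of_differentiableAt {f : ℝ → ℝ} {x : ℝ} (hf : DifferentiableAt ℝ f x) :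
    ¬ IsSteep f x := by
  intro hs
  have h1 := hf.hasDerivAt.tendsto_slope
  have h2 : Tendsto (fun k : ℕ => x - 1 / ((k : ℝ) + 1)) atTop (𝓝[≠] x) := by
    refine tendsto_nhdsWithin_iff.2 ⟨?_, Eventually.of_forall fun k => ?_⟩
    · simpa using (tendsto_one_div_add_atTop_nhds_zero_nat (𝕜 := ℝ)).const_sub x
    · have : (0 : ℝ) < 1 / ((k : ℝ) + 1) := by positivity
      simp only [mem_compl_iff, mem_singleton_iff]
      linarith
  have h3 := h1.comp h2
  obtain ⟨A, hA⟩ := exists_nat_gt (deriv f x)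
  have h4 := h3.eventually (gt_mem_nhds hA)
  obtain ⟨N, hN⟩ := hs A
  obtain ⟨k, hk, hkN⟩ := (h4.and (eventually_ge_atTop N)).exists
  have h5 := hN k hkN
  have hpos : (0 : ℝ) < (k : ℝ) + 1 := by positivity
  simp only [Function.comp, slope_def_field] at hk
  have e : (f (x - 1 / ((k : ℝ) + 1)) - f x) / (x - 1 / ((k : ℝ) + 1) - x) =
      (f x - f (x - 1 / ((k : ℝ) + 1))) * (k + 1) := by
    field_simp
    ring
  rw [e] at hk
  rw [div_le_iff₀ hpos] at h5
  linarith

theorem ae_not_isSteep {f : ℝ → ℝ} (hf : Monotone f) : ∀ᵐ x, ¬ IsSteep f x := by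
  filter_upwards [hf.ae_differentiableAt] with x hx using not_isSteep_of_differentiableAt hx

end

section

/-! ### A geodesic that slows down before it follows a line -/

variable {L E : Set (PlanarLine × ℝ)} {T : ℝ} {ξ : ℝ → Plane} {p : PlanarLine × ℝ} {t₀ : ℝ}

/-- A path on a line of limit `v` is off the lines of limit at least `v'` only for `v' > v`, so
speed bounds are proved for such `v'` and then passed to `v`. -/
theorem abs_le_of_forall_lt_mul {a b v : ℝ} (h : ∀ v' > v, a ≤ v' * b) : a ≤ v * b := by
  have h1 : Tendsto (fun v' => v' * b) (𝓝[>] v) (𝓝 (v * b)) :=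
    ((continuous_id.mul continuous_const).tendsto v).mono_left nhdsWithin_le_nhds
  exact ge_of_tendsto h1 (by filter_upwards [self_mem_nhdsWithin] with v' hv' using h v' hv')

/-- Any linear cost along one line can be made small along a line that crosses it by adding a rational
multiple of the perpendicular coordinate. -/
theorem exists_tilt {ℓ ℓ' : PlanarLine} (hne : ℓ ≠ ℓ') {x : Plane} (hx : x ∈ ℓ) (hx' : x ∈ ℓ')
    (s v : ℝ) {ε : ℝ} (hε : 0 < ε) : ∃ l : ℚ, ∀ y ∈ ℓ', ∀ z ∈ ℓ',
      |linearCost s l (ang ℓ) v y - linearCost s l (ang ℓ) v z| ≤ ε * dist y z := by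
  obtain ⟨κ, hκ, hκ'⟩ := exists_angle_const hne hx hx'
  set θ := ang ℓ
  set θ' := ang ℓ'
  have hnrm : ∀ y ∈ ℓ', ∀ z ∈ ℓ', nrm θ y - nrm θ z = Real.sin (θ' - θ) * (tng θ' y - tng θ' z) ∧
      tng θ y - tng θ z = Real.cos (θ' - θ) * (tng θ' y - tng θ' z) := by
    intro y hy z hz
    have e : nrm θ' y = nrm θ' z := (mem_line_iff.1 hy).trans (mem_line_iff.1 hz).symm
    have hcs := Real.sin_sq_add_cos_sq θ'
    rw [Real.sin_sub, Real.cos_sub]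
    simp only [nrm, tng] at e ⊢
    constructor
    · linear_combination (Real.sin θ' * Real.sin θ + Real.cos θ' * Real.cos θ) * e +
        (Real.sin θ * (y 0 - z 0) - Real.cos θ * (y 1 - z 1)) * hcs
    · linear_combination (Real.cos θ' * Real.sin θ - Real.sin θ' * Real.cos θ) * e -
        (Real.cos θ * (y 0 - z 0) + Real.sin θ * (y 1 - z 1)) * hcs
  have hS : Real.sin (θ' - θ) ≠ 0 := by
    intro h0
    -- a point of `ℓ'` other than `x` is at positive distance from `ℓ`
    have hu : x + unitVec θ' ∈ ℓ' := by
      rw [mem_line_iff] at hx' ⊢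
      rw [← hx']
      change nrm θ' _ = nrm θ' _
      simp [nrm, unitVec]
      ring
    obtain ⟨y, hy, hyd⟩ := exists_mem_line_dist_eq ℓ (x + unitVec θ')
    have h1 := (hnrm _ hu _ hx').1
    rw [h0, zero_mul, (show nrm θ x = rad ℓ from mem_line_iff.1 hx)] at h1
    have h2 : lineDist ℓ (x + unitVec θ') = 0 := by
      unfold lineDist; rw [show nrm (ang ℓ) (x + unitVec θ') - rad ℓ = 0 from h1, abs_zero]
    have h3 := hκ' y hy _ hu
    rw [dist_comm y, hyd, h2] at h3
    have h4 : x = x + unitVec θ' := dist_le_zero.1 (nonpos_of_mul_nonpos_right h3 hκ)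
    exact unitVec_ne_zero θ' (by simpa using h4.symm)
  -- As a function of the position along `ℓ'`, the linear cost has slope `l * sin (θ' - θ) - s * cos
  -- (θ' - θ) / v`. The quotient is the value of `l` for which it vanishes.
  obtain ⟨l, hl1, hl2⟩ := exists_rat_btwn
    (show s * Real.cos (θ' - θ) / (v * Real.sin (θ' - θ)) <
      s * Real.cos (θ' - θ) / (v * Real.sin (θ' - θ)) + ε by linarith)
  refine ⟨l, fun y hy z hz => ?_⟩
  obtain ⟨e1, e2⟩ := hnrm y hy z hz
  have e3 : linearCost s l θ v y - linearCost s l θ v z =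
      (l - s * Real.cos (θ' - θ) / (v * Real.sin (θ' - θ))) *
        (Real.sin (θ' - θ) * (tng θ' y - tng θ' z)) := by
    have : linearCost s l θ v y - linearCost s l θ v z =
      l * (nrm θ y - nrm θ z) - s * (tng θ y - tng θ z) / v := by unfold linearCost; ring
    rw [this, e1, e2]
    rcases eq_or_ne v 0 with rfl | hv
    · simp
    · field_simp
  rw [e3, abs_mul]
  refine mul_le_mul (abs_le.2 ⟨by linarith, by linarith⟩) ?_ (abs_nonneg _) hε.le
  rw [abs_mul]
  calc _ ≤ 1 * dist y z :=
        mul_le_mul (Real.abs_sin_le_one _) (abs_tng_sub_le _ _ _) (abs_nonneg _) zero_le_one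
    _ = _ := one_mul _

/-- Paths in a region where all lines but one are slow have bounded linear cost per unit time, if the
exceptional line has. -/
theorem Feasible.abs_linearCost_sub_le {η : ℝ → Plane} {a b s l θ v δ : ℝ} (h : Feasible E a b η)
    (hv : 0 < v) (hδ : 0 < δ) (hδκ : (|l| + |s| / v) * δ ≤ 1)
    (hslow : (∀ u ∈ Icc a b, η u ∉ silhouette E δ) ∨ ∃ q ∈ E, 0 < q.2 ∧
      (∀ u ∈ Icc a b, ∀ r ∈ E, δ ≤ r.2 → η u ∈ r.1 → r = q) ∧ δ ≤ q.2 ∧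
      ∀ y ∈ q.1, ∀ z ∈ q.1,
        |linearCost s l θ v y - linearCost s l θ v z| ≤ 1 / q.2 * dist y z) :
    |linearCost s l θ v (η a) - linearCost s l θ v (η b)| ≤ b - a := by
  have hκ0 : 0 ≤ |l| + |s| / v := by positivity
  have free : ∀ c d, a ≤ c → c ≤ d → d ≤ b → (∀ u ∈ Ioo c d, η u ∉ silhouette E δ) →
      |linearCost s l θ v (η c) - linearCost s l θ v (η d)| ≤ d - c := by
    intro c d hc hcd hd hu
    refine (PoissonRoads.abs_linearCost_sub_le s l θ hv _ _).trans ?_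
    have h1 := mul_le_mul_of_nonneg_left (h.dist_le_of_Ioo hδ hc hcd hd hu) hκ0
    rw [← mul_assoc] at h1
    exact h1.trans (by nlinarith [sub_nonneg.2 hcd])
  rcases hslow with h0 | ⟨q, hq, hqv, hqs, hδq, hql⟩
  · exact free a b le_rfl h.le le_rfl fun u hu => h0 u ⟨hu.1.le, hu.2.le⟩
  by_cases hex : ∃ u ∈ Icc a b, η u ∈ q.1
  · obtain ⟨u, hu, huq⟩ := hex
    obtain ⟨c, hc, hcq, hfirst⟩ := exists_first_mem (C := {x | x ∈ q.1})
      (h.continuousOn.mono (Icc_subset_Icc le_rfl hu.2)) (isClosed_line q.1) hu.1 huq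
    obtain ⟨d, hd, hdq, hlast⟩ := exists_last_mem (C := {x | x ∈ q.1})
      (h.continuousOn.mono (Icc_subset_Icc hu.1 le_rfl)) (isClosed_line q.1) hu.2 huq
    have hcd : c ≤ d := hc.2.trans hd.1
    have f1 := free a c le_rfl hc.1 (hc.2.trans hu.2) fun w hw ⟨r, hr, hrv, hwr⟩ => by
      have := hqs w ⟨hw.1.le, hw.2.le.trans (hc.2.trans hu.2)⟩ r hr hrv hwr
      exact hfirst w ⟨hw.1.le, hw.2⟩ (this ▸ hwr)
    have f2 := free d b (hu.1.trans hd.1) hd.2 le_rfl fun w hw ⟨r, hr, hrv, hwr⟩ => by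
      have := hqs w ⟨(hu.1.trans hd.1).trans hw.1.le, hw.2.le⟩ r hr hrv hwr
      exact hlast w ⟨hw.1, hw.2.le⟩ (this ▸ hwr)
    -- Between the first and last visit to `q`, only `q` has limit at least `δ`, so the speed bound
    -- is `q.2`; before and after, the path is off `q` and its speed is at most `δ`.
    have f3 : dist (η c) (η d) ≤ q.2 * (d - c) := by
      refine abs_le_of_forall_lt_mul fun v' hv' => ?_
      refine h.obeys v' (hqv.trans hv') c d hc.1 hcd hd.2 fun w hw ⟨r, hr, hrv, hwr⟩ => ?_
      have := hqs w ⟨hc.1.trans hw.1, hw.2.trans hd.2⟩ r hr (hδq.trans (hv'.le.trans hrv)) hwr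
      rw [this] at hrv
      linarith
    have f4 := hql _ hcq _ hdq
    have f5 : 1 / q.2 * dist (η c) (η d) ≤ d - c := by
      rw [one_div, inv_mul_le_iff₀ hqv]; exact f3
    calc |linearCost s l θ v (η a) - linearCost s l θ v (η b)|
        = |(linearCost s l θ v (η a) - linearCost s l θ v (η c)) +
            (linearCost s l θ v (η c) - linearCost s l θ v (η d)) +
            (linearCost s l θ v (η d) - linearCost s l θ v (η b))| := by ring_nf
      _ ≤ _ := abs_add_three _ _ _
      _ ≤ _ := by linarith
  · push Not at hex
    exact free a b le_rfl h.le le_rfl fun u hu ⟨r, hr, hrv, hur⟩ =>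
      hex u ⟨hu.1.le, hu.2.le⟩ (hqs u ⟨hu.1.le, hu.2.le⟩ r hr hrv hur ▸ hur)

/-- In every time interval a geodesic follows some line for a while. -/
theorem Geodesic.exists_follows (hL : Generic L) (h : Geodesic L T ξ) {a b : ℝ} (ha : 0 ≤ a)
    (hab : a < b) (hb : b ≤ T) :
    ∃ M ∈ L, ∃ α β, a ≤ α ∧ α < β ∧ β ≤ b ∧ ∀ u ∈ Icc α β, ξ u ∈ M.1 := by
  by_contra! hno
  -- By the dichotomy of germs, a geodesic that follows no line is off each given line just after
  -- any time. By local finiteness it then obeys every positive speed bound, so it is at rest,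
  -- against injectivity.
  have hoff : ∀ u ∈ Ico a b, ∀ M ∈ L, ∀ᶠ w in 𝓝[>] u, ξ w ∉ M.1 := by
    intro u hu M hM
    refine (h.germ_right hL hM ⟨ha.trans hu.1, hu.2.trans_le hb⟩).resolve_left fun hev => ?_
    obtain ⟨β, hβ, hβM⟩ := (mem_nhdsGT_iff_exists_mem_Ioc_Ioo_subset hu.2).1 hev
    obtain ⟨x, hx⟩ := exists_between hβ.1
    obtain ⟨y, hy⟩ := exists_between hx.2
    obtain ⟨w, hw, hwM⟩ := hno M hM x y (hu.1.trans hx.1.le) hy.1 (hy.2.le.trans hβ.2)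
    exact hwM (hβM ⟨hx.1.trans_le hw.1, hw.2.trans_lt hy.2⟩)
  have hconst : dist (ξ a) (ξ b) ≤ 0 * (b - a) := by
    refine abs_le_of_forall_lt_mul fun v hv => ?_
    refine dist_le_of_eventually_right hab.le (h.continuousOn.mono (Icc_subset_Icc ha hb))
      fun u hu => ?_
    have h1 : ∀ᶠ w in 𝓝[>] u, ∀ r ∈ {r ∈ L | v ≤ r.2 ∧ |rad r.1| ≤ ‖ξ u‖}, ξ w ∉ r.1 := by
      rw [eventually_all_finite (hL.locallyFinite ‖ξ u‖ v hv)]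
      exact fun r hr => hoff u hu r hr.1
    have h2 := (h.tendsto_right ⟨ha.trans hu.1, hu.2.trans_le hb⟩).eventually
      (hL.locallyFinite.eventually_mem hv (ξ u))
    obtain ⟨β, hβ, hβ'⟩ := (mem_nhdsGT_iff_exists_mem_Ioc_Ioo_subset hu.2).1 (h1.and h2)
    filter_upwards [Ioo_mem_nhdsGT hβ.1] with w hw
    refine h.feasible.dist_le_of_Ioo hv (ha.trans hu.1) hw.1.le
      (hw.2.le.trans (hβ.2.trans hb)) fun z hz ⟨r, hr, hvr, hzr⟩ => ?_
    obtain ⟨g1, g2⟩ := hβ' ⟨hz.1, hz.2.trans hw.2⟩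
    exact g1 r ⟨hr, hvr, abs_rad_le_norm (g2 r hr hvr hzr)⟩ hzr
  rw [zero_mul] at hconst
  have := h.injOn ⟨ha, hab.le.trans hb⟩ ⟨ha.trans hab.le, hb⟩ (dist_le_zero.1 hconst)
  linarith

/-- Every line of a generic pattern is isolated by a rational box. -/
theorem Generic.exists_box (hL : Generic L) {M : PlanarLine × ℝ} (hM : M ∈ L) :
    ∃ b, M ∈ boxSet b ∧ ∀ q ∈ L, q ∈ boxSet b → q = M := by
  have hMv := hL.pos M hM
  set f : PlanarLine × ℝ → ℝ × ℝ × ℝ := fun q => (rad q.1, ang q.1, q.2) with hf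
  set F : Set (PlanarLine × ℝ) := {q ∈ L | M.2 / 2 ≤ q.2 ∧ |rad q.1| ≤ |rad M.1| + 1}
  have hF : F.Finite := hL.locallyFinite _ _ (by positivity)
  have hcl : IsClosed (f '' (F \ {M})) := ((hF.sdiff).image f).isClosed
  have hMF : f M ∉ f '' (F \ {M}) := by
    rintro ⟨q, ⟨hq, hqM⟩, hqf⟩
    simp only [hf, Prod.mk.injEq] at hqf
    exact hqM (Prod.ext (line_ext hqf.1 hqf.2.1) hqf.2.2)
  obtain ⟨ε, hε, hball⟩ := Metric.mem_nhds_iff.1 (hcl.isOpen_compl.mem_nhds hMF)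
  -- The bounds `1` and `M.2 / 2` force lines in the box into the finite set `F`; the bound `ε`
  -- separates `M` from the rest of `F`.
  set e := min ε (min 1 (M.2 / 2)) with he
  have he0 : 0 < e := by positivity
  have he1 : e ≤ ε := min_le_left _ _
  have he2 : e ≤ 1 := (min_le_right _ _).trans (min_le_left _ _)
  have he3 : e ≤ M.2 / 2 := (min_le_right _ _).trans (min_le_right _ _)
  have hbt : ∀ x : ℝ, ∃ y z : ℚ, x - e < y ∧ (y : ℝ) < x ∧ x < z ∧ (z : ℝ) < x + e := fun x => by
    obtain ⟨y, hy⟩ := exists_rat_btwn (show x - e < x by linarith)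
    obtain ⟨z, hz⟩ := exists_rat_btwn (show x < x + e by linarith)
    exact ⟨y, z, hy.1, hy.2, hz.1, hz.2⟩
  obtain ⟨r1, r2, hr1, hr2, hr3, hr4⟩ := hbt (rad M.1)
  obtain ⟨a1, a2, ha1, ha2, ha3, ha4⟩ := hbt (ang M.1)
  obtain ⟨v1, v2, hv1, hv2, hv3, hv4⟩ := hbt M.2
  refine ⟨((r1, r2), (a1, a2), (v1, v2)), ⟨⟨hr2, hr3⟩, ⟨ha2, ha3⟩, ⟨hv2, hv3⟩⟩, ?_⟩
  rintro q hq ⟨⟨g1, g2⟩, ⟨g3, g4⟩, ⟨g5, g6⟩⟩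
  simp only at g1 g2 g3 g4 g5 g6
  by_contra hqM
  have hr : |rad q.1 - rad M.1| < e := abs_lt.2 ⟨by linarith, by linarith⟩
  have hqF : q ∈ F := by
    refine ⟨hq, by linarith, ?_⟩
    have := abs_sub_abs_le_abs_sub (rad q.1) (rad M.1)
    linarith
  have : f q ∈ Metric.ball (f M) ε := by
    rw [Metric.mem_ball, Prod.dist_eq, Prod.dist_eq, Real.dist_eq, Real.dist_eq, Real.dist_eq]
    refine max_lt (hr.trans_le he1) (max_lt ?_ ?_)
    · exact (abs_lt.2 ⟨by simp only [hf]; linarith, by simp only [hf]; linarith⟩ : _ < e).trans_le he1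
    · exact (abs_lt.2 ⟨by simp only [hf]; linarith, by simp only [hf]; linarith⟩ : _ < e).trans_le he1
  exact hball this ⟨q, ⟨hqF, hqM⟩, rfl⟩

/-- Off the line of `p`, a path that obeys the limits of `L` also obeys those of the other lines. -/
theorem Feasible.diff_singleton {a b : ℝ} (h : Feasible L a b ξ) (hoff : ∀ u ∈ Icc a b, ξ u ∉ p.1) :
    Feasible (L \ {p}) a b ξ := by
  refine ⟨h.le, h.lipschitz, fun v hv s t hs hst ht hu => h.obeys v hv s t hs hst ht ?_⟩
  rintro u hu' ⟨r, hr, hvr, hur⟩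
  refine hu u hu' ⟨r, ⟨hr, fun hrp => ?_⟩, hvr, hur⟩
  rw [mem_singleton_iff] at hrp
  exact hoff u ⟨hs.trans hu'.1, hu'.2.trans ht⟩ (hrp ▸ hur)

/-- A geodesic leaves a crossing along a line at most at the speed-limit of the line. -/
theorem Geodesic.dist_le_speed_mul (hL : Generic L) (h : Geodesic L T ξ) (hp : p ∈ L)
    (ht₀ : t₀ ∈ Ico 0 T) (hx : ξ t₀ ∈ p.1) (hon : ∀ᶠ u in 𝓝[>] t₀, ξ u ∈ p.1) :
    ∀ᶠ t in 𝓝[>] t₀, dist (ξ t₀) (ξ t) ≤ p.2 * (t - t₀) := by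
  have hpv := hL.pos p hp
  obtain ⟨b, hb, hbL⟩ := hL.locallyFinite.eventually_right h ht₀ hpv
  obtain ⟨b', hb', hbp⟩ := (mem_nhdsGT_iff_exists_mem_Ioc_Ioo_subset ht₀.2).1 hon
  filter_upwards [Ioo_mem_nhdsGT hb.1, Ioo_mem_nhdsGT hb'.1] with t htb htb'
  refine abs_le_of_forall_lt_mul fun v hv => ?_
  refine h.feasible.dist_le_of_Ioo (hpv.trans hv) ht₀.1 htb.1.le (htb.2.le.trans hb.2) ?_
  rintro u hu ⟨r, hr, hvr, hur⟩
  -- A faster line met soon after `t₀` would go through `ξ t₀`. It meets `p` only there, and the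
  -- geodesic does not return.
  have hxr := hbL u ⟨hu.1, hu.2.trans htb.2⟩ r hr (hv.le.trans hvr) hur
  have hrp : p.1 ≠ r.1 := hL.line_ne p hp r hr (by rintro rfl; linarith)
  have := eq_of_mem_lines hrp hx hxr (hbp ⟨hu.1, hu.2.trans htb'.2⟩) hur
  have := h.injOn ⟨ht₀.1, ht₀.2.le⟩ ⟨ht₀.1.trans hu.1.le, hu.2.le.trans (htb.2.le.trans hb.2)⟩ this
  linarith [hu.1]

end

/-! ### Steepness of the travel cost at a line approached by slowing down. -/

section

variable {L E : Set (PlanarLine × ℝ)} {T : ℝ} {ξ : ℝ → Plane} {p : PlanarLine × ℝ} {t₀ : ℝ}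

/-- Near a point of a line there is a linear cost, of given slope along the line, that bounds from below
the time needed by paths that avoid the line. -/
theorem Generic.exists_tilt_of_mem (hL : Generic L) (hp : p ∈ L) {x₀ : Plane} (hx : x₀ ∈ p.1)
    (s : ℚ) : ∃ (l : ℚ) (δ : ℝ), 0 < δ ∧ (|(l : ℝ)| + |(s : ℝ)| / p.2) * δ ≤ 1 ∧ ∃ r₀ > 0,
      (∀ z ∈ Metric.ball x₀ r₀, z ∉ silhouette (L \ {p}) δ) ∨ ∃ q ∈ L \ {p}, 0 < q.2 ∧
        (∀ z ∈ Metric.ball x₀ r₀, ∀ r ∈ L \ {p}, δ ≤ r.2 → z ∈ r.1 → r = q) ∧ δ ≤ q.2 ∧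
        ∀ y ∈ q.1, ∀ z ∈ q.1, |linearCost s l (ang p.1) p.2 y - linearCost s l (ang p.1) p.2 z| ≤
          1 / q.2 * dist y z := by
  have hpv := hL.pos p hp
  by_cases hq : ∃ q ∈ L, q ≠ p ∧ x₀ ∈ q.1
  · obtain ⟨q, hq, hqp, hxq⟩ := hq
    have hqv := hL.pos q hq
    obtain ⟨l, hl⟩ := exists_tilt (hL.line_ne p hp q hq hqp.symm) hx hxq s p.2
      (ε := 1 / q.2) (by positivity)
    have hκ : 0 < |(l : ℝ)| + |(s : ℝ)| / p.2 + 1 := by positivity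
    -- The second bound makes the linear cost of slow motion at most the time it takes; the `+ 1`
    -- only keeps the denominator positive.
    set δ := min q.2 (1 / (|(l : ℝ)| + |(s : ℝ)| / p.2 + 1)) with hδ
    have hδ0 : 0 < δ := by positivity
    obtain ⟨r₀, hr₀, hball⟩ := Metric.eventually_nhds_iff_ball.1
      (hL.locallyFinite.eventually_mem hδ0 x₀)
    refine ⟨l, δ, hδ0, ?_, r₀, hr₀, Or.inr ⟨q, ⟨hq, hqp⟩, hqv, ?_, min_le_left _ _, hl⟩⟩
    · have h1 : δ ≤ 1 / (|(l : ℝ)| + |(s : ℝ)| / p.2 + 1) := min_le_right _ _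
      rw [le_div_iff₀ hκ] at h1
      nlinarith
    · intro z hz r hr hδr hzr
      by_contra hne
      exact hL.no_triple p hp q hq r hr.1 hqp.symm (fun h => hr.2 h.symm) (fun h => hne h.symm) x₀
        hx hxq (hball z hz r hr.1 hδr hzr)
  · push Not at hq
    have hκ : 0 < |(s : ℝ)| / p.2 + 1 := by positivity
    obtain ⟨r₀, hr₀, hball⟩ := Metric.eventually_nhds_iff_ball.1
      (hL.locallyFinite.eventually_mem (show 0 < 1 / (|(s : ℝ)| / p.2 + 1) by positivity) x₀)
    refine ⟨0, 1 / (|(s : ℝ)| / p.2 + 1), by positivity, ?_, r₀, hr₀, Or.inl ?_⟩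
    · rw [mul_one_div, div_le_one hκ]; simp
    · rintro z hz ⟨r, hr, hδr, hzr⟩
      exact hq r hr.1 hr.2 (hball z hz r hr.1 hδr hzr)

/-- In every time interval a geodesic passes a point of a line which is the only point of that line with
its value of some coordinate, a rational number. -/
theorem Geodesic.exists_start (hL : Generic L) (h : Geodesic L T ξ) {a b : ℝ} (ha : 0 ≤ a)
    (hab : a < b) (hb : b ≤ T) :
    ∃ M ∈ L, ∃ τ ∈ Icc a b, ∃ (i : Fin 2) (ρ : ℚ), ξ τ ∈ M.1 ∧ ξ τ i = ρ ∧
      ∀ z : Plane, z ∈ M.1 → z i = ρ → z = ξ τ := by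
  obtain ⟨M, hM, α, β, hα, hαβ, hβ, hMon⟩ := h.exists_follows hL ha hab hb
  have hαT : Icc α β ⊆ Icc 0 T := fun u hu => ⟨ha.trans (hα.trans hu.1), hu.2.trans (hβ.trans hb)⟩
  have hne : ξ α ≠ ξ β := fun he =>
    hαβ.ne (h.injOn (hαT ⟨le_rfl, hαβ.le⟩) (hαT ⟨hαβ.le, le_rfl⟩) he)
  obtain ⟨i, hi⟩ : ∃ i, ξ α i ≠ ξ β i := by
    by_contra! hall
    exact hne (PiLp.ext hall)
  obtain ⟨ρ, hρ⟩ : ∃ ρ : ℚ, (ρ : ℝ) ∈ uIcc (ξ α i) (ξ β i) := by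
    rcases hi.lt_or_gt with h1 | h1
    · obtain ⟨ρ, h2, h3⟩ := exists_rat_btwn h1
      exact ⟨ρ, Icc_subset_uIcc ⟨h2.le, h3.le⟩⟩
    · obtain ⟨ρ, h2, h3⟩ := exists_rat_btwn h1
      exact ⟨ρ, Icc_subset_uIcc' ⟨h2.le, h3.le⟩⟩
  have hcoord : Continuous fun z : Plane => z i := by fun_prop
  obtain ⟨τ, hτ, hτρ⟩ := intermediate_value_uIcc (f := fun u => ξ u i) (a := α) (b := β)
    (by rw [uIcc_of_le hαβ.le]; exact hcoord.comp_continuousOn (h.continuousOn.mono hαT)) hρ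
  rw [uIcc_of_le hαβ.le] at hτ
  simp only at hτρ
  have hτM := hMon τ hτ
  refine ⟨M, hM, τ, ⟨hα.trans hτ.1, hτ.2.trans hβ⟩, i, ρ, hτM, hτρ, ?_⟩
  · intro z hz hzρ
    -- the coordinate is injective on `M` since it separates two points of `M`
    set φ := ang M.1
    have hMn : ∀ {y : Plane}, y ∈ M.1 → nrm φ y = rad M.1 := fun hy => mem_line_iff.1 hy
    have hcs := Real.sin_sq_add_cos_sq φ
    have hαM := hMn (hMon α ⟨le_rfl, hαβ.le⟩)
    have hβM := hMn (hMon β ⟨hαβ.le, le_rfl⟩)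
    have hzM := hMn hz
    have hτM' := hMn hτM
    refine nrm_tng_ext (hzM.trans hτM'.symm) ?_
    have hcoordM : ∃ a : ℝ, ∀ y y' : Plane, nrm φ y = rad M.1 → nrm φ y' = rad M.1 →
        y i - y' i = a * (tng φ y - tng φ y') := by
      fin_cases i
      · refine ⟨Real.cos φ, fun y y' hy hy' => ?_⟩
        simp only [nrm, tng, Fin.zero_eta] at hy hy' ⊢
        linear_combination (-(y 0 - y' 0)) * hcs - Real.sin φ * (hy - hy')
      · refine ⟨Real.sin φ, fun y y' hy hy' => ?_⟩
        simp only [nrm, tng, Fin.mk_one] at hy hy' ⊢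
        linear_combination (-(y 1 - y' 1)) * hcs + Real.cos φ * (hy - hy')
    obtain ⟨a, ha⟩ := hcoordM
    have ha0 : a ≠ 0 := by
      rintro rfl
      have := ha _ _ hαM hβM
      exact hi (by linarith)
    have h1 := ha _ _ hzM hτM'
    rw [hzρ, hτρ, sub_self] at h1
    linarith [(mul_eq_zero.1 h1.symm).resolve_left ha0]

/-- A path near a line from a point of a geodesic to the other side of the line is not cheaper than the
geodesic. -/
theorem Geodesic.le_linearCost_of_crossing (h : Geodesic L T ξ) (hp : p ∈ L) (hpv : 0 < p.2)
    {x₀ : Plane} {τ t₁ δ r₀ s l σ t : ℝ} {η : ℝ → Plane} (hτ0 : 0 ≤ τ) (hτt₁ : τ ≤ t₁) (ht₁ : t₁ ≤ T)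
    (hx₀r : nrm (ang p.1) x₀ = rad p.1) (ht₁p : ξ t₁ ∈ p.1)
    (hd₁ : dist x₀ (ξ t₁) ≤ p.2 * (t₁ - t₀)) (hs1 : |s| = 1)
    (hs : s * (tng (ang p.1) (ξ t₁) - tng (ang p.1) x₀) = dist x₀ (ξ t₁)) (hδ : 0 < δ)
    (hκδ : (|l| + |s| / p.2) * δ ≤ 1)
    (halt : (∀ z ∈ Metric.ball x₀ r₀, z ∉ silhouette (L \ {p}) δ) ∨ ∃ q ∈ L \ {p}, 0 < q.2 ∧
        (∀ z ∈ Metric.ball x₀ r₀, ∀ r ∈ L \ {p}, δ ≤ r.2 → z ∈ r.1 → r = q) ∧ δ ≤ q.2 ∧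
        ∀ y ∈ q.1, ∀ z ∈ q.1, |linearCost s l (ang p.1) p.2 y - linearCost s l (ang p.1) p.2 z| ≤
          1 / q.2 * dist y z)
    (hr₀y : r₀ ≤ dist x₀ (ξ t₁)) (hη : Feasible (L \ {p}) 0 t η) (hηstart : η 0 = ξ τ)
    (hηU : ∀ u ∈ Icc 0 t, dist (η u) x₀ < r₀) (hσ : |σ| = 1)
    (hside0 : σ * nrm (ang p.1) (η 0) ≤ σ * rad p.1)
    (hside : σ * rad p.1 ≤ σ * nrm (ang p.1) (η t)) :
    t₀ - τ + linearCost s l (ang p.1) p.2 x₀ ≤ t + linearCost s l (ang p.1) p.2 (η t) := by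
  set θ := ang p.1
  have hηc : ContinuousOn (fun u => σ * nrm θ (η u)) (Icc 0 t) :=
    continuousOn_const.mul ((continuous_nrm θ).comp_continuousOn hη.continuousOn)
  -- At time `t'` the path is on the line of `p`. Going on from there along `p` to `ξ t₁` cannot
  -- beat the geodesic, which bounds `t'` from below; from `t'` to `t` the linear cost drops by at
  -- most `t - t'`.
  obtain ⟨t', ht', ht'r⟩ := intermediate_value_Icc hη.le hηc ⟨hside0, hside⟩
  have ht'p : nrm θ (η t') = rad p.1 := by
    have hne : σ ≠ 0 := fun h0 => by
      rw [h0] at hσ; simp at hσ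
    exact mul_left_cancel₀ hne ht'r
  have hη' := hη.mono ht'.1 ht'.2 le_rfl
  have hcost : |linearCost s l θ p.2 (η t') - linearCost s l θ p.2 (η t)| ≤ t - t' := by
    refine hη'.abs_linearCost_sub_le hpv hδ hκδ ?_
    have hmem : ∀ u ∈ Icc t' t, η u ∈ Metric.ball x₀ r₀ := fun u hu =>
      hηU u ⟨ht'.1.trans hu.1, hu.2⟩
    rcases halt with h0 | ⟨q', hq', hqv', hqs', hrest⟩
    · exact Or.inl fun u hu => h0 _ (hmem u hu)
    · exact Or.inr ⟨q', hq', hqv', fun u hu => hqs' _ (hmem u hu), hrest⟩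
  have hreach := ((hη.mono le_rfl ht'.1 ht'.2).reach.mono_lines sdiff_subset).trans
    (reach_along_line hp hpv (mem_line_iff.2 ht'p) ht₁p)
  rw [hηstart] at hreach
  have hmin := h.minimal τ t₁ _ hτ0 hτt₁ ht₁ hreach
  -- Within `r₀ ≤ dist x₀ (ξ t₁)` of `x₀` the path has not passed `ξ t₁`, so the remaining distance
  -- along `p` is linear in the tangential coordinate.
  have hdist : dist (η t') (ξ t₁) = s * (tng θ (ξ t₁) - tng θ (η t')) := by
    have e1 : nrm θ (ξ t₁) = nrm θ (η t') := (mem_line_iff.1 ht₁p).trans ht'p.symm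
    rw [dist_comm, ← abs_tng_sub_eq_dist e1]
    have e2 : |(s : ℝ) * (tng θ (ξ t₁) - tng θ (η t'))| = |tng θ (ξ t₁) - tng θ (η t')| := by
      rw [abs_mul, hs1, one_mul]
    rw [← e2, abs_of_nonneg]
    have e3 : |(s : ℝ) * (tng θ (η t') - tng θ x₀)| ≤ dist (η t') x₀ := by
      rw [abs_mul, hs1, one_mul]; exact abs_tng_sub_le _ _ _
    have e4 := hηU t' ht'
    have e5 := le_abs_self ((s : ℝ) * (tng θ (η t') - tng θ x₀))
    linarith
  rw [hdist] at hmin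
  have hc1 := (abs_le.1 hcost).2
  have hc2 : linearCost s l θ p.2 (η t') - linearCost s l θ p.2 x₀ =
      - (s * (tng θ (η t') - tng θ x₀)) / p.2 := by
    unfold linearCost
    rw [ht'p, hx₀r]
    ring
  have hc3 : dist x₀ (ξ t₁) / p.2 ≤ t₁ - t₀ := by
    rw [div_le_iff₀ hpv, mul_comm]; exact hd₁
  have hc4 : (s : ℝ) * (tng θ (ξ t₁) - tng θ (η t')) / p.2 =
      dist x₀ (ξ t₁) / p.2 + -(s * (tng θ (η t') - tng θ x₀)) / p.2 := by
    rw [← hs, ← add_div]; ring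
  rw [hc4] at hmin
  linarith

/-- If a geodesic slows down before it starts to follow a line, then the least cost of reaching the
line is a steep function of the position of the line, for some probe. -/
theorem Geodesic.exists_isSteep (hL : Generic L) (h : Geodesic L T ξ) (hp : p ∈ L)
    (ht₀ : t₀ ∈ Ioo 0 T) (hx : ξ t₀ ∈ p.1) (hon : ∀ᶠ u in 𝓝[>] t₀, ξ u ∈ p.1)
    (hslow : SlowsDown L ξ t₀) :
    ∃ Q : Probe, IsSteep (fun r => Q.value r (ang p.1) p.2 (L \ {p})) (Q.sgn * rad p.1) := by
  have hpv := hL.pos p hp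
  have ht₀r : t₀ ∈ Ico 0 T := ⟨ht₀.1.le, ht₀.2⟩
  set θ := ang p.1 with hθ
  set x₀ := ξ t₀ with hx₀
  have hx₀r : nrm θ x₀ = rad p.1 := mem_line_iff.1 hx
  -- a later point on the line
  obtain ⟨t₁, ⟨hd₁, ht₁p⟩, ht₁⟩ :=
    (((h.dist_le_speed_mul hL hp ht₀r hx hon).and hon).and (Ioo_mem_nhdsGT ht₀.2)).exists
  have hy0 : 0 < dist x₀ (ξ t₁) := by
    refine dist_pos.2 fun he => ?_
    have := h.injOn ⟨ht₀.1.le, ht₀.2.le⟩ ⟨ht₀.1.le.trans ht₁.1.le, ht₁.2.le⟩ he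
    linarith [ht₁.1]
  have hynrm : nrm θ x₀ = nrm θ (ξ t₁) := hx₀r.trans (mem_line_iff.1 ht₁p).symm
  obtain ⟨s, hs1, hs⟩ : ∃ s : ℚ, |(s : ℝ)| = 1 ∧ s * (tng θ (ξ t₁) - tng θ x₀) = dist x₀ (ξ t₁) := by
    rw [dist_comm, ← abs_tng_sub_eq_dist hynrm.symm]
    rcases abs_choice (tng θ (ξ t₁) - tng θ x₀) with h1 | h1
    · exact ⟨1, by simp, by rw [h1]; simp⟩
    · exact ⟨-1, by simp, by rw [h1]; simp⟩
  -- The slope `s` refunds progress towards `ξ t₁` at the speed of `p`; the tilt `l` prevents gains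
  -- by overshooting `p`.
  obtain ⟨l, δ, hδ, hκδ, r₁, hr₁, halt⟩ := hL.exists_tilt_of_mem hp hx s
  set κ := |(l : ℝ)| + |(s : ℝ)| / p.2 with hκ
  have hκ0 : 0 ≤ κ := by positivity
  set r₀ := min r₁ (dist x₀ (ξ t₁)) with hr₀
  have hr₀0 : 0 < r₀ := by positivity
  have hr₀1 : r₀ ≤ r₁ := min_le_left _ _
  have hr₀y : r₀ ≤ dist x₀ (ξ t₁) := min_le_right _ _
  -- the ball
  obtain ⟨c, hc⟩ := (TopologicalSpace.denseRange_denseSeq Plane).exists_dist_lt x₀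
    (show 0 < r₀ / 4 by positivity)
  obtain ⟨R, hR1, hR2⟩ := exists_rat_btwn (show r₀ / 4 < r₀ / 2 by linarith)
  have hU : ∀ z, dist z (TopologicalSpace.denseSeq Plane c) ≤ R → dist z x₀ < r₀ := fun z hz => by
    linarith [dist_triangle z (TopologicalSpace.denseSeq Plane c) x₀,
      dist_comm x₀ (TopologicalSpace.denseSeq Plane c)]
  -- the time window
  have hwin : ∀ᶠ u in 𝓝[<] t₀, ξ u ∉ p.1 ∧ dist (ξ u) (TopologicalSpace.denseSeq Plane c) < R := by
    filter_upwards [hslow p.2 hpv, (h.tendsto_left ⟨ht₀.1, ht₀.2.le⟩).eventually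
      (Metric.isOpen_ball.mem_nhds (show x₀ ∈ Metric.ball (TopologicalSpace.denseSeq Plane c) R from
        hc.trans hR1))] with u hu1 hu2
    exact ⟨fun hup => hu1 ⟨p, hp, le_rfl, hup⟩, hu2⟩
  obtain ⟨a₀, ha₀, hwin⟩ := (mem_nhdsLT_iff_exists_mem_Ico_Ioo_subset ht₀.1).1 hwin
  obtain ⟨a₁, ha₁⟩ := exists_between ha₀.2
  obtain ⟨b₁, hb₁⟩ := exists_between ha₁.2
  -- the starting point
  obtain ⟨M, hM, τ, hτ, i, ρ, hτM, hτρ, hunique⟩ := h.exists_start hL (ha₀.1.trans ha₁.1.le) hb₁.1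
    (hb₁.2.le.trans ht₀.2.le)
  have hwinI : ∀ u, τ ≤ u → u < t₀ → u ∈ Ioo a₀ t₀ := fun u h1 h2 =>
    ⟨ha₁.1.trans_le (hτ.1.trans h1), h2⟩
  have hτt₀ : τ < t₀ := hτ.2.trans_lt hb₁.2
  have hτ0 : 0 ≤ τ := ha₀.1.trans (ha₁.1.le.trans hτ.1)
  have hMp : M ≠ p := by
    rintro rfl
    exact (hwin (hwinI τ le_rfl hτt₀)).1 hτM
  obtain ⟨box, hMbox, hbox⟩ := hL.exists_box hM
  -- the side
  have hcont : ContinuousOn ξ (Ioo a₀ t₀) := h.continuousOn.mono fun u hu =>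
    ⟨ha₀.1.trans hu.1.le, hu.2.le.trans ht₀.2.le⟩
  obtain ⟨o, ho⟩ : ∃ o : ℤˣ, ∀ u ∈ Ioo a₀ t₀,
      ((o : ℤ) : ℝ) * nrm θ (ξ u) < ((o : ℤ) : ℝ) * rad p.1 := by
    have hg : ContinuousOn (fun u => nrm θ (ξ u)) (Ioo a₀ t₀) :=
      (continuous_nrm θ).comp_continuousOn hcont
    have hne : ∀ u ∈ Ioo a₀ t₀, nrm θ (ξ u) ≠ rad p.1 := fun u hu he =>
      (hwin hu).1 (mem_line_iff.2 he)
    by_cases hex : ∃ w ∈ Ioo a₀ t₀, nrm θ (ξ w) < rad p.1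
    · obtain ⟨w, hw, hwr⟩ := hex
      refine ⟨1, fun u hu => ?_⟩
      simp only [Units.val_one, Int.cast_one, one_mul]
      by_contra! hle
      obtain ⟨z, hz, hzr⟩ := isPreconnected_Ioo.intermediate_value hw hu hg ⟨hwr.le, hle⟩
      exact hne z hz hzr
    · push Not at hex
      refine ⟨-1, fun u hu => ?_⟩
      have := lt_of_le_of_ne (hex u hu) (hne u hu).symm
      simpa using this
  -- With this cap, truncation affects neither the lower nor the upper estimate of the cost.
  obtain ⟨K, hK⟩ := exists_nat_ge (T + κ * (‖x₀‖ + r₀))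
  set Q : Probe := ⟨box, i, ρ, c, R, o, s, l, K⟩
  have hlinb : ∀ z, dist z x₀ < r₀ → |linearCost s l θ p.2 z| ≤ κ * (‖x₀‖ + r₀) := fun z hz => by
    refine (abs_linearCost_le (s : ℝ) (l : ℝ) θ hpv z).trans (mul_le_mul_of_nonneg_left ?_ hκ0)
    have := norm_sub_norm_le z x₀
    rw [← dist_eq_norm] at this
    linarith
  have hEloc : LocallyFiniteSpeeds (L \ {p}) := hL.locallyFinite.mono sdiff_subset
  -- the cost of reaching the line
  have hlow : t₀ - τ + linearCost s l θ p.2 x₀ ≤ Q.value (Q.sgn * rad p.1) θ p.2 (L \ {p}) := by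
    refine Probe.le_value hEloc (M := M) (fun q hq hqb => hbox q hq.1 hqb) hpv ?_ ?_
    · have h1 := (le_abs_self _).trans (hlinb x₀ (by rw [dist_self]; exact hr₀0))
      change _ ≤ (K : ℝ)
      linarith [ht₀.2]
    · rintro w t ⟨η, hη, hη0, ⟨q, hq, hqb, hηq⟩, rfl, hηball⟩ hside
      -- The box singles out `M`, and the rational coordinate singles out `ξ τ` on `M`.
      have hηstart : η 0 = ξ τ := hunique _ (hbox q hq.1 hqb ▸ hηq) hη0
      refine h.le_linearCost_of_crossing hp hpv hτ0 (hτt₀.le.trans ht₁.1.le) ht₁.2.le hx₀r ht₁p hd₁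
        hs1 hs hδ hκδ (halt.imp (fun h0 z hz => h0 z (Metric.ball_subset_ball hr₀1 hz)) ?_) hr₀y hη
        hηstart (fun u hu => hU _ (hηball u hu)) Q.abs_sgn_eq_one ?_ hside
      · rintro ⟨q', hq', hqv', hqs', hrest⟩
        exact ⟨q', hq', hqv', fun z hz => hqs' z (Metric.ball_subset_ball hr₀1 hz), hrest⟩
      · rw [hηstart]; exact (ho τ (hwinI τ le_rfl hτt₀)).le
  -- steepness
  refine ⟨Q, fun A => ?_⟩
  -- Approaching at speed at most `v`, the geodesic needs time `t₀ - u` for a distance at most `v *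
  -- (t₀ - u)`. The linear cost takes away at most half of that time, by `κ * v ≤ 1 / 2`; the other
  -- half is at least `A / (k + 1)`, by `A * v ≤ 1 / 2`.
  set v : ℝ := min (1 / (2 * (κ + 1))) (1 / (2 * ((A : ℝ) + 1))) with hv
  have hv0 : 0 < v := by positivity
  have hv1 : κ * v ≤ 1 / 2 := by
    calc κ * v ≤ (κ + 1) * (1 / (2 * (κ + 1))) :=
          mul_le_mul (by linarith) (min_le_left _ _) hv0.le (by positivity)
      _ = 1 / 2 := by field_simp
  have hv2 : A * v ≤ 1 / 2 := by
    calc (A : ℝ) * v ≤ ((A : ℝ) + 1) * (1 / (2 * ((A : ℝ) + 1))) :=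
          mul_le_mul (by linarith) (min_le_right _ _) hv0.le (by positivity)
      _ = 1 / 2 := by field_simp
  obtain ⟨a₂, ha₂, ha₂s⟩ := (mem_nhdsLT_iff_exists_mem_Ico_Ioo_subset hτt₀).1 (hslow v hv0)
  obtain ⟨a₃, ha₃⟩ := exists_between ha₂.2
  have ha₃w : a₃ ∈ Ioo a₀ t₀ := hwinI a₃ (ha₂.1.trans ha₃.1.le) ha₃.2
  have hgap : 0 < Q.sgn * rad p.1 - Q.sgn * nrm θ (ξ a₃) := sub_pos.2 (ho a₃ ha₃w)
  obtain ⟨N, hN⟩ := exists_nat_one_div_lt hgap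
  refine ⟨N, fun k hk => ?_⟩
  have hkpos : (0 : ℝ) < 1 / ((k : ℝ) + 1) := by positivity
  have hkgap : 1 / ((k : ℝ) + 1) < Q.sgn * rad p.1 - Q.sgn * nrm θ (ξ a₃) := by
    refine lt_of_le_of_lt ?_ hN
    have : (N : ℝ) ≤ k := by exact_mod_cast hk
    gcongr
  have hcI : ContinuousOn (fun u => Q.sgn * nrm θ (ξ u)) (Icc a₃ t₀) :=
    continuousOn_const.mul ((continuous_nrm θ).comp_continuousOn (h.continuousOn.mono fun u hu =>
      ⟨ha₀.1.trans (ha₃w.1.le.trans hu.1), hu.2.trans ht₀.2.le⟩))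
  -- At time `u` the geodesic is `1 / (k + 1)` short of the line. Up to then it has avoided `p`
  -- since `τ`, so it competes for the lower level in the pattern without `p`.
  obtain ⟨u, hu, hur⟩ := intermediate_value_Icc ha₃.2.le hcI
    (show Q.sgn * rad p.1 - 1 / ((k : ℝ) + 1) ∈ Icc (Q.sgn * nrm θ (ξ a₃)) (Q.sgn * nrm θ (ξ t₀)) by
      rw [← hx₀, hx₀r]
      exact ⟨by linarith only [hkgap], by linarith only [hkpos]⟩)
  simp only at hur
  have hut₀ : u < t₀ := by
    refine lt_of_le_of_ne hu.2 ?_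
    rintro rfl
    rw [← hx₀, hx₀r] at hur
    linarith only [hur, hkpos]
  have hτu : τ ≤ u := ha₂.1.trans (ha₃.1.le.trans hu.1)
  have huT : u ≤ T := hu.2.trans ht₀.2.le
  have hslowu : dist (ξ u) x₀ ≤ v * (t₀ - u) :=
    h.feasible.dist_le_of_Ioo hv0 (hτ0.trans hτu) hut₀.le ht₀.2.le fun w hw =>
      ha₂s ⟨ha₃.1.trans_le (hu.1.trans hw.1.le), hw.2⟩
  have harr : Arrives (boxSet Q.box) Q.coord Q.start Q.ctr Q.radius (L \ {p}) (ξ u) (u - τ) := by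
    have hoff : ∀ w ∈ Icc τ u, ξ w ∉ p.1 ∧ dist (ξ w) (TopologicalSpace.denseSeq Plane c) < R :=
      fun w hw => hwin (hwinI w hw.1 (hw.2.trans_lt hut₀))
    have h1 := ((h.feasible.mono hτ0 hτu huT).diff_singleton fun w hw =>
      (hoff w hw).1).comp_add_const τ
    rw [sub_self] at h1
    refine ⟨_, h1, ?_, ⟨M, ⟨hM, hMp⟩, hMbox, ?_⟩, ?_, fun w hw => ?_⟩
    · simp only [zero_add]; exact hτρ
    · simp only [zero_add]; exact hτM
    · simp
    · exact (hoff (w + τ) ⟨le_add_of_nonneg_left hw.1, le_sub_iff_add_le.1 hw.2⟩).2.le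
  have hup : Q.value (Q.sgn * rad p.1 - 1 / ((k : ℝ) + 1)) θ p.2 (L \ {p}) ≤
      u - τ + linearCost s l θ p.2 (ξ u) := by
    refine Probe.value_le hpv harr hur.ge le_rfl ?_
    have h1 := neg_abs_le (linearCost s l θ p.2 (ξ u))
    have h2 := hlinb (ξ u) (hU _ (hwin (hwinI u hτu hut₀)).2.le)
    change -(K : ℝ) ≤ _
    linarith only [h1, h2, hK, hτu, ht₀.1, ht₀.2]
  have hl1 := (le_abs_self _).trans (abs_linearCost_sub_le (s : ℝ) (l : ℝ) θ hpv (ξ u) x₀)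
  have hl2 := mul_le_mul_of_nonneg_left hslowu hκ0
  have hl3 : κ * (v * (t₀ - u)) ≤ (t₀ - u) / 2 := by
    rw [← mul_assoc]
    have := mul_le_mul_of_nonneg_right hv1 (sub_nonneg.2 hut₀.le)
    linarith only [this]
  have hk1 : 1 / ((k : ℝ) + 1) ≤ v * (t₀ - u) := by
    refine le_trans ?_ hslowu
    have h1 : 1 / ((k : ℝ) + 1) = Q.sgn * (nrm θ x₀ - nrm θ (ξ u)) := by
      rw [mul_sub, hur, hx₀r]; ring
    rw [h1, dist_comm]
    refine (le_abs_self _).trans ?_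
    rw [abs_mul, Q.abs_sgn_eq_one, one_mul]
    exact abs_nrm_sub_le _ _ _
  have hk2 : (A : ℝ) / (k + 1) ≤ (t₀ - u) / 2 := by
    calc (A : ℝ) / (k + 1) = A * (1 / ((k : ℝ) + 1)) := by ring
      _ ≤ A * (v * (t₀ - u)) := mul_le_mul_of_nonneg_left hk1 (Nat.cast_nonneg _)
      _ = (A * v) * (t₀ - u) := by ring
      _ ≤ 1 / 2 * (t₀ - u) := mul_le_mul_of_nonneg_right hv2 (sub_nonneg.2 hut₀.le)
      _ = _ := by ring
  simp only
  unfold κ at hl2 hl3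
  linarith only [hlow, hup, hl1, hl2, hl3, hk2]

end

section

/-! ### Configurations and the Mecke formula -/

/-- Point configurations on `S`. -/
structure Config (S : Type*) where
  /-- the points of the configuration -/
  carrier : Set S

/-- The events that a configuration has no points in a given measurable set. -/
def avoidanceSets (S : Type*) [MeasurableSpace S] : Set (Set (Config S)) :=
  {G | ∃ C : Set S, MeasurableSet C ∧ G = {E : Config S | Disjoint E.carrier C}}

/-- Void events form a π-system, to which the Mecke formula can be reduced, and the exceptional sets
below are built from them by countable operations. -/
instance (S : Type*) [MeasurableSpace S] : MeasurableSpace (Config S) :=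
  MeasurableSpace.generateFrom (avoidanceSets S)

section Mecke

variable {S Ω : Type*} [MeasurableSpace S] [MeasurableSpace Ω]

theorem isPiSystem_avoidanceSets : IsPiSystem (avoidanceSets S) := by
  rintro _ ⟨C, hC, rfl⟩ _ ⟨D, hD, rfl⟩ -
  refine ⟨C ∪ D, hC.union hD, ?_⟩
  ext E
  exact disjoint_union_right.symm

theorem measurableSet_avoid {C : Set S} (hC : MeasurableSet C) :
    MeasurableSet {E : Config S | Disjoint E.carrier C} :=
  MeasurableSpace.measurableSet_generateFrom ⟨C, hC, rfl⟩

theorem measurableSet_hit {C : Set S} (hC : MeasurableSet C) :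
    MeasurableSet {E : Config S | (E.carrier ∩ C).Nonempty} := by
  have := (measurableSet_avoid hC).compl
  convert this using 1
  ext E
  exact not_disjoint_iff_nonempty_inter.symm

theorem lintegral_natCast_poissonMeasure (r : ℝ≥0) :
    ∫⁻ n : ℕ, (n : ℝ≥0∞) ∂(poissonMeasure r) = r := by
  rw [poissonMeasure, lintegral_sum_measure]
  simp only [lintegral_smul_measure, lintegral_dirac, smul_eq_mul]
  rw [tsum_eq_zero_add' ENNReal.summable]
  have h1 : ∀ n : ℕ, ENNReal.ofReal (Real.exp (-r) * (r : ℝ) ^ (n + 1) / (n + 1).factorial) *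
      ((n + 1 : ℕ) : ℝ≥0∞) =
      r * ENNReal.ofReal (Real.exp (-r) * (r : ℝ) ^ n / n.factorial) := by
    intro n
    rw [← ENNReal.ofReal_natCast, ← ENNReal.ofReal_mul (by positivity), ← ENNReal.ofReal_coe_nnreal,
      ← ENNReal.ofReal_mul (by positivity), Nat.factorial_succ]
    congr 1
    push_cast
    field_simp
    ring
  simp_rw [h1]
  rw [ENNReal.tsum_mul_left, ← ENNReal.ofReal_tsum_of_nonneg (fun n => by positivity)
    (hasSum_one_poissonMeasure r).summable, (hasSum_one_poissonMeasure r).tsum_eq]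
  simp

variable {m : Measure S} {P : Measure Ω} {L : Ω → Set S}

theorem poissonLaw_of_ne_top {a : ℝ≥0∞} (ha : a ≠ ∞) :
    poissonLaw a = (poissonMeasure a.toNNReal).map (fun n : ℕ => (n : ℕ∞)) := if_neg ha

theorem poissonLaw_singleton_natCast {a : ℝ≥0∞} (ha : a ≠ ∞) (n : ℕ) :
    poissonLaw a {(n : ℕ∞)} = poissonMeasure a.toNNReal {n} := by
  rw [poissonLaw_of_ne_top ha, Measure.map_apply .of_discrete (.of_discrete)]
  congr 1
  ext k
  simp

/-- The identity `exp (-a) * a = a * exp (-a)` is the source of the intensity factor in the Mecke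
formula. -/
theorem poissonLaw_singleton_one {a : ℝ≥0∞} (ha : a ≠ ∞) :
    poissonLaw a {1} = a * poissonLaw a {0} := by
  have h0 := poissonLaw_singleton_natCast ha 0
  have h1 := poissonLaw_singleton_natCast ha 1
  rw [Nat.cast_zero] at h0
  rw [Nat.cast_one] at h1
  rw [h0, h1, poissonMeasure_singleton, poissonMeasure_singleton]
  conv_rhs => rw [← ENNReal.coe_toNNReal ha, ← ENNReal.ofReal_coe_nnreal,
    ← ENNReal.ofReal_mul (by positivity)]
  congr 1
  simp only [Nat.factorial_zero, Nat.factorial_one, pow_zero, pow_one]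
  simp only [ENNReal.toNNReal_coe, ENNReal.ofReal_coe_nnreal]
  ring

theorem lintegral_toENNReal_poissonLaw {a : ℝ≥0∞} (ha : a ≠ ∞) :
    ∫⁻ n : ℕ∞, (n : ℝ≥0∞) ∂(poissonLaw a) = a := by
  rw [poissonLaw_of_ne_top ha, lintegral_map .of_discrete .of_discrete]
  simp only [ENat.toENNReal_coe]
  rw [lintegral_natCast_poissonMeasure, ENNReal.coe_toNNReal ha]

namespace IsPoissonProcess

theorem lintegral_encard (hL : IsPoissonProcess m P L) {B : Set S} (hB : MeasurableSet B) (hmB : m B ≠ ∞) :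
    ∫⁻ ω, ((L ω ∩ B).encard : ℝ≥0∞) ∂P = m B := by
  rw [← lintegral_toENNReal_poissonLaw hmB, ← hL.map_count B hB,
    lintegral_map .of_discrete (hL.measurable_count B hB)]

theorem measure_encard_eq (hL : IsPoissonProcess m P L) {B : Set S} (hB : MeasurableSet B) (n : ℕ∞) :
    P {ω | (L ω ∩ B).encard = n} = poissonLaw (m B) {n} := by
  rw [← hL.map_count B hB, Measure.map_apply (hL.measurable_count B hB) .of_discrete]
  rfl

theorem indepFun_encard (hL : IsPoissonProcess m P L) {B C : Set S} (hB : MeasurableSet B) (hC : MeasurableSet C)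
    (hBC : Disjoint B C) :
    IndepFun (fun ω => (L ω ∩ B).encard) (fun ω => (L ω ∩ C).encard) P := by
  have := hL.indep_count 2 ![B, C] (by intro i; fin_cases i <;> simpa)
    (by intro i j hij; fin_cases i <;> fin_cases j <;> simp_all [disjoint_comm])
  exact this.indepFun (i := 0) (j := 1) (by simp)

theorem measurable (hL : IsPoissonProcess m P L) : Measurable (fun ω => (⟨L ω⟩ : Config S)) := by
  refine measurable_generateFrom ?_
  rintro _ ⟨C, hC, rfl⟩
  have : (fun ω => (⟨L ω⟩ : Config S)) ⁻¹' {E : Config S | Disjoint E.carrier C} =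
      {ω | (L ω ∩ C).encard = 0} := by
    ext ω
    simp only [mem_preimage, mem_ofPred_eq, encard_eq_zero]
    exact disjoint_iff_inter_eq_empty
  rw [this]
  exact hL.measurable_count C hC (measurableSet_singleton 0)

end IsPoissonProcess

/-- The points of `E` in `W` at which the pair of the point and the rest of `E` lies in `𝔅`. -/
def markedPoints {S : Type*} (W : Set S) (𝔅 : Set (S × Config S)) (E : Set S) : Set S :=
  {p ∈ E ∩ W | (p, Config.mk (E \ {p})) ∈ 𝔅}

/-- A point of `W ∩ A` counts if `C` holds no other point. Either `C` is empty and all points of `(W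
∩ A) \ C` count, or `C` holds a single point, which lies in `W ∩ A` and is the only one to count. -/
theorem encard_markedPoints_rectangle {S : Type*} (W A C E : Set S) :
    ((markedPoints W (A ×ˢ {E : Config S | Disjoint E.carrier C}) E).encard : ℝ≥0∞) =
      ((E ∩ ((W ∩ A) \ C)).encard : ℝ≥0∞) * {n : ℕ∞ | n = 0}.indicator 1 (E ∩ C).encard +
      {n : ℕ∞ | n = 1}.indicator 1 (E ∩ (W ∩ A ∩ C)).encard *
        {n : ℕ∞ | n = 0}.indicator 1 (E ∩ (C \ (W ∩ A))).encard := by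
  have hmem : ∀ p, p ∈ markedPoints W (A ×ˢ {E : Config S | Disjoint E.carrier C}) E ↔
      p ∈ E ∧ p ∈ W ∧ p ∈ A ∧ ∀ q ∈ E, q ∈ C → q = p := by
    intro p
    have : (p, Config.mk (E \ {p})) ∈ A ×ˢ {E : Config S | Disjoint E.carrier C} ↔
        p ∈ A ∧ Disjoint (E \ {p}) C := Iff.rfl
    change (p ∈ E ∧ p ∈ W) ∧ _ ↔ _
    rw [this, Set.disjoint_left]
    constructor
    · rintro ⟨⟨h1, h2⟩, h3, h4⟩
      exact ⟨h1, h2, h3, fun q hq hqC => by_contra fun hne => h4 ⟨hq, hne⟩ hqC⟩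
    · rintro ⟨h1, h2, h3, h4⟩
      exact ⟨⟨h1, h2⟩, h3, fun q hq hqC => hq.2 (h4 q hq.1 hqC)⟩
  rcases (E ∩ C).eq_empty_or_nonempty with h0 | ⟨p₀, hp₀⟩
  · have e1 : markedPoints W (A ×ˢ {E : Config S | Disjoint E.carrier C}) E =
        E ∩ ((W ∩ A) \ C) := by
      ext p
      rw [hmem]
      constructor
      · rintro ⟨h1, h2, h3, -⟩
        exact ⟨h1, ⟨h2, h3⟩, fun h => (h0.subset ⟨h1, h⟩).elim⟩
      · rintro ⟨h1, ⟨h2, h3⟩, -⟩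
        exact ⟨h1, h2, h3, fun q hq hqC => (h0.subset ⟨hq, hqC⟩).elim⟩
    have e2 : E ∩ (W ∩ A ∩ C) = ∅ := subset_eq_empty
      (inter_subset_inter_right E inter_subset_right) h0
    rw [e1, e2, h0]
    simp
  · have e0 : (E ∩ C).encard ≠ 0 := encard_ne_zero.2 ⟨p₀, hp₀⟩
    have e0' : (E ∩ C).encard ∉ {n : ℕ∞ | n = 0} := e0
    rw [indicator_of_notMem e0', mul_zero, zero_add]
    by_cases hone : (E ∩ (W ∩ A ∩ C)).encard = 1 ∧ (E ∩ (C \ (W ∩ A))).encard = 0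
    · rw [indicator_of_mem (show _ ∈ {n : ℕ∞ | n = 1} from hone.1),
        indicator_of_mem (show _ ∈ {n : ℕ∞ | n = 0} from hone.2)]
      obtain ⟨p, hp⟩ := encard_eq_one.1 hone.1
      have hpm : p ∈ E ∩ (W ∩ A ∩ C) := hp ▸ mem_singleton p
      have : markedPoints W (A ×ˢ {E : Config S | Disjoint E.carrier C}) E = {p} := by
        ext q
        rw [hmem, mem_singleton_iff]
        constructor
        · rintro ⟨-, -, -, h4⟩
          exact (h4 p hpm.1 hpm.2.2).symm
        · rintro rfl
          refine ⟨hpm.1, hpm.2.1.1, hpm.2.1.2, fun r hr hrC => ?_⟩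
          by_cases hrD : r ∈ W ∩ A
          · exact hp.subset ⟨hr, hrD, hrC⟩
          · exact ((encard_eq_zero.1 hone.2).subset ⟨hr, hrC, hrD⟩).elim
      rw [this]
      simp
    · have : markedPoints W (A ×ˢ {E : Config S | Disjoint E.carrier C}) E = ∅ := by
        refine eq_empty_of_forall_notMem fun p hp => hone ?_
        rw [hmem] at hp
        obtain ⟨h1, h2, h3, h4⟩ := hp
        have hpp : p₀ = p := h4 p₀ hp₀.1 hp₀.2
        constructor
        · rw [encard_eq_one]
          refine ⟨p, Subset.antisymm (fun q hq => h4 q hq.1 hq.2.2) ?_⟩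
          rw [singleton_subset_iff]
          exact ⟨h1, ⟨h2, h3⟩, hpp ▸ hp₀.2⟩
        · rw [encard_eq_zero]
          refine eq_empty_of_forall_notMem fun q hq => hq.2.2 ?_
          rw [h4 q hq.1 hq.2.1]
          exact ⟨h2, h3⟩
      rw [this]
      rw [not_and_or] at hone
      rcases hone with h | h
      · rw [indicator_of_notMem (show _ ∉ {n : ℕ∞ | n = 1} from h)]; simp
      · rw [indicator_of_notMem (show _ ∉ {n : ℕ∞ | n = 0} from h)]; simp

theorem encard_iUnion_of_disjoint {α : Type*} {s : ℕ → Set α} (hs : Pairwise (Function.onFun Disjoint s)) :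
    ((⋃ i, s i).encard : ℝ≥0∞) = ∑' i, ((s i).encard : ℝ≥0∞) := by
  let _ : MeasurableSpace α := ⊤
  have := measure_iUnion (μ := Measure.count) hs fun i => MeasurableSpace.measurableSet_top
  simpa only [Measure.count_apply MeasurableSpace.measurableSet_top] using this

/-- The Mecke formula, as far as it concerns expected numbers of points. -/
theorem IsPoissonProcess.mecke [IsProbabilityMeasure P] (hL : IsPoissonProcess m P L) {W : Set S}
    (hW : MeasurableSet W) (hmW : m W ≠ ∞) {𝔅 : Set (S × Config S)} (h𝔅 : MeasurableSet 𝔅) :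
    AEMeasurable (fun ω => ((markedPoints W 𝔅 (L ω)).encard : ℝ≥0∞)) P ∧
      ∫⁻ ω, ((markedPoints W 𝔅 (L ω)).encard : ℝ≥0∞) ∂P =
        ((m.restrict W).prod (P.map fun ω => (⟨L ω⟩ : Config S))) 𝔅 := by
  have hfin : IsFiniteMeasure (m.restrict W) := ⟨by simpa using hmW.lt_top⟩
  have hLm := hL.measurable
  have hprob : IsProbabilityMeasure (P.map fun ω => (⟨L ω⟩ : Config S)) :=
    Measure.isProbabilityMeasure_map hLm.aemeasurable
  have hcount : ∀ B : Set S, MeasurableSet B → Measurable fun ω => ((L ω ∩ B).encard : ℝ≥0∞) :=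
    fun B hB => (Measurable.of_discrete (f := fun n : ℕ∞ => (n : ℝ≥0∞))).comp
      (hL.measurable_count B hB)
  have hgen : (Prod.instMeasurableSpace : MeasurableSpace (S × Config S)) =
      MeasurableSpace.generateFrom
        (image2 (· ×ˢ ·) {s : Set S | MeasurableSet s} (avoidanceSets S)) :=
    have huniv : (univ : Set (Config S)) ∈ avoidanceSets S := ⟨∅, .empty, by ext E; simp⟩
    (generateFrom_eq_prod MeasurableSpace.generateFrom_measurableSet rfl
      isCountablySpanning_measurableSet
      ⟨fun _ => univ, fun _ => huniv, iUnion_const _⟩).symm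
  induction 𝔅, h𝔅 using MeasurableSpace.induction_on_inter hgen
    (MeasurableSpace.isPiSystem_measurableSet.prod isPiSystem_avoidanceSets) with
  | empty =>
    have : ∀ E, markedPoints W (∅ : Set (S × Config S)) E = ∅ := fun E => by
      ext p; simp [markedPoints]
    simp [this]
  | basic t ht =>
    obtain ⟨A, hA, _, ⟨C, hC, rfl⟩, rfl⟩ := ht
    replace hA : MeasurableSet A := hA
    have hind : ∀ (n : ℕ∞) (B : Set S), MeasurableSet B →
        Measurable fun ω => {k : ℕ∞ | k = n}.indicator (1 : ℕ∞ → ℝ≥0∞) (L ω ∩ B).encard :=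
      fun n B hB => (Measurable.of_discrete (f := {k : ℕ∞ | k = n}.indicator (1 : ℕ∞ → ℝ≥0∞))).comp
        (hL.measurable_count B hB)
    have hintind : ∀ (n : ℕ∞) (B : Set S), MeasurableSet B →
        ∫⁻ ω, {k : ℕ∞ | k = n}.indicator (1 : ℕ∞ → ℝ≥0∞) (L ω ∩ B).encard ∂P =
          poissonLaw (m B) {n} := by
      intro n B hB
      rw [← hL.measure_encard_eq hB]
      exact lintegral_indicator_one (hL.measurable_count B hB (measurableSet_singleton n))
    -- With `D = W ∩ A`, independence gives the mean `m (D \ C) * P(C empty) + P(one point in D ∩ C)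
    -- * P(C \ D empty)`. By the Poisson identity the second term is `m (D ∩ C) * P(C empty)`, and
    -- the sum is `m D * P(C empty)`.
    have hD := hW.inter hA
    have m1 := (hD.diff hC)
    have m2 := (hD.inter hC)
    have m3 := (hC.diff hD)
    simp only [encard_markedPoints_rectangle]
    refine ⟨(((hcount _ m1).mul (hind 0 C hC)).add ((hind 1 _ m2).mul (hind 0 _ m3))).aemeasurable, ?_⟩
    have hmD : m (W ∩ A) ≠ ∞ := measure_ne_top_of_subset inter_subset_left hmW
    have i1 : IndepFun (fun ω => ((L ω ∩ ((W ∩ A) \ C)).encard : ℝ≥0∞))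
        (fun ω => {k : ℕ∞ | k = 0}.indicator (1 : ℕ∞ → ℝ≥0∞) (L ω ∩ C).encard) P :=
      (hL.indepFun_encard m1 hC disjoint_sdiff_left).comp (φ := fun n : ℕ∞ => (n : ℝ≥0∞))
        (ψ := {k : ℕ∞ | k = 0}.indicator (1 : ℕ∞ → ℝ≥0∞))
        .of_discrete .of_discrete
    have i2 : IndepFun (fun ω => {k : ℕ∞ | k = 1}.indicator (1 : ℕ∞ → ℝ≥0∞)
          (L ω ∩ (W ∩ A ∩ C)).encard)
        (fun ω => {k : ℕ∞ | k = 0}.indicator (1 : ℕ∞ → ℝ≥0∞) (L ω ∩ (C \ (W ∩ A))).encard) P :=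
      (hL.indepFun_encard m2 m3 (disjoint_sdiff_right.mono_left inter_subset_left)).comp
        (φ := {k : ℕ∞ | k = 1}.indicator (1 : ℕ∞ → ℝ≥0∞))
        (ψ := {k : ℕ∞ | k = 0}.indicator (1 : ℕ∞ → ℝ≥0∞))
        .of_discrete .of_discrete
    have i3 : poissonLaw (m (W ∩ A ∩ C)) {0} * poissonLaw (m (C \ (W ∩ A))) {0} =
        poissonLaw (m C) {0} := by
      have h1 := (hL.indepFun_encard m2 m3
        (disjoint_sdiff_right.mono_left inter_subset_left)).measure_inter_preimage_eq_mul {0} {0}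
        (measurableSet_singleton 0) (measurableSet_singleton 0)
      rw [← hL.measure_encard_eq m2, ← hL.measure_encard_eq m3, ← hL.measure_encard_eq hC]
      refine (Eq.trans ?_ h1).symm
      congr 1
      ext ω
      simp only [mem_ofPred_eq, mem_inter_iff, mem_preimage, mem_singleton_iff, encard_eq_zero]
      rw [← union_empty_iff, ← inter_union_distrib_left, inter_comm (W ∩ A) C,
        inter_union_sdiff]
    have e1 := lintegral_mul_eq_lintegral_mul_lintegral_of_indepFun'' (hcount _ m1).aemeasurable
      (hind 0 C hC).aemeasurable i1
    have e2 := lintegral_mul_eq_lintegral_mul_lintegral_of_indepFun'' (hind 1 _ m2).aemeasurable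
      (hind 0 _ m3).aemeasurable i2
    refine (lintegral_add_left ((hcount _ m1).mul (hind 0 C hC)) _).trans ?_
    simp only [Pi.mul_apply]
    rw [e1, e2,
      hL.lintegral_encard m1 (measure_ne_top_of_subset sdiff_subset hmD), hintind 0 C hC,
      hintind 1 _ m2, hintind 0 _ m3,
      poissonLaw_singleton_one (measure_ne_top_of_subset inter_subset_left hmD), mul_assoc, i3,
      ← add_mul, measure_sdiff_add_inter _ hC, Measure.prod_prod, Measure.restrict_apply hA,
      Measure.map_apply hLm (measurableSet_avoid hC), inter_comm A W, ← hL.measure_encard_eq hC]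
    congr 2
    ext ω
    simp only [mem_ofPred_eq, mem_preimage, encard_eq_zero]
    exact disjoint_iff_inter_eq_empty.symm
  | compl t ht ih =>
    obtain ⟨ih1, ih2⟩ := ih
    have hadd : ∀ E : Set S, ((markedPoints W t E).encard : ℝ≥0∞) +
        ((markedPoints W tᶜ E).encard : ℝ≥0∞) = ((E ∩ W).encard : ℝ≥0∞) := by
      intro E
      rw [← ENat.toENNReal_add, ← encard_union_eq]
      · congr 2
        ext p
        simp only [markedPoints, mem_union, mem_ofPred_eq]
        tauto
      · rw [Set.disjoint_left]
        rintro p ⟨-, h1⟩ ⟨-, h2⟩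
        exact h2 h1
    have htot : ∫⁻ ω, ((L ω ∩ W).encard : ℝ≥0∞) ∂P = m W := hL.lintegral_encard hW hmW
    have hNfin : ∀ᵐ ω ∂P, ((L ω ∩ W).encard : ℝ≥0∞) < ∞ :=
      ae_lt_top (hcount W hW) (by rw [htot]; exact hmW)
    -- Counts can be subtracted only where `W` holds finitely many points, which is almost sure;
    -- hence only almost everywhere measurability is claimed.
    have hsub : (fun ω => ((markedPoints W tᶜ (L ω)).encard : ℝ≥0∞)) =ᵐ[P]
        fun ω => ((L ω ∩ W).encard : ℝ≥0∞) - ((markedPoints W t (L ω)).encard : ℝ≥0∞) := by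
      filter_upwards [hNfin] with ω hω
      rw [← hadd (L ω)] at hω ⊢
      rw [ENNReal.add_sub_cancel_left (ENNReal.add_lt_top.1 hω).1.ne]
    refine ⟨((hcount W hW).aemeasurable.sub ih1).congr hsub.symm, ?_⟩
    have h1 : ∫⁻ ω, ((markedPoints W t (L ω)).encard : ℝ≥0∞) ∂P +
        ∫⁻ ω, ((markedPoints W tᶜ (L ω)).encard : ℝ≥0∞) ∂P = m W := by
      rw [← lintegral_add_left' ih1]
      simp only [hadd, htot]
    have h2 := measure_add_measure_compl (μ := (m.restrict W).prod (P.map fun ω => (⟨L ω⟩ : Config S))) ht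
    rw [← univ_prod_univ, Measure.prod_prod,
      measure_univ (μ := P.map fun ω => (⟨L ω⟩ : Config S)), mul_one, Measure.restrict_apply_univ,
      ← h1, ih2] at h2
    exact ((ENNReal.add_right_inj (measure_ne_top _ _)).1 h2).symm
  | iUnion f hf hfm ih =>
    have hU : ∀ E : Set S, ((markedPoints W (⋃ i, f i) E).encard : ℝ≥0∞) =
        ∑' i, ((markedPoints W (f i) E).encard : ℝ≥0∞) := by
      intro E
      rw [← encard_iUnion_of_disjoint]
      · congr 2
        ext p
        rw [mem_iUnion]
        change (p ∈ E ∩ W ∧ _ ∈ ⋃ i, f i) ↔ _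
        rw [mem_iUnion]
        exact ⟨fun ⟨h, i, hi⟩ => ⟨i, h, hi⟩, fun ⟨i, h, hi⟩ => ⟨h, i, hi⟩⟩
      · intro i j hij
        change Disjoint (markedPoints W (f i) E) (markedPoints W (f j) E)
        rw [Set.disjoint_left]
        rintro p ⟨-, h1⟩ ⟨-, h2⟩
        exact Set.disjoint_left.1 (hf hij) h1 h2
    simp only [hU]
    refine ⟨AEMeasurable.tsum fun i => (ih i).1, ?_⟩
    rw [lintegral_tsum fun i => (ih i).1, measure_iUnion hf hfm]
    exact tsum_congr fun i => (ih i).2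

/-- Almost surely no point of a Poisson process forms an exceptional pair with the rest of the process,
if for almost every configuration of the process almost no point is exceptional. -/
theorem IsPoissonProcess.ae_forall_notMem [IsProbabilityMeasure P] (hL : IsPoissonProcess m P L)
    {W : Set S} (hW : MeasurableSet W) (hmW : m W ≠ ∞) {𝔅 : Set (S × Config S)}
    (h𝔅 : MeasurableSet 𝔅) (hnull : ∀ᵐ ω ∂P, m {p ∈ W | (p, (⟨L ω⟩ : Config S)) ∈ 𝔅} = 0) :
    ∀ᵐ ω ∂P, ∀ p ∈ L ω, p ∈ W → (p, Config.mk (L ω \ {p})) ∉ 𝔅 := by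
  have hfin : IsFiniteMeasure (m.restrict W) := ⟨by simpa using hmW.lt_top⟩
  have hprob : IsProbabilityMeasure (P.map fun ω => (⟨L ω⟩ : Config S)) :=
    Measure.isProbabilityMeasure_map hL.measurable.aemeasurable
  obtain ⟨h1, h2⟩ := hL.mecke hW hmW h𝔅
  -- Integrated over the configuration last, the product measure vanishes by hypothesis, so the
  -- expected number of exceptional points is `0`.
  have h3 : ((m.restrict W).prod (P.map fun ω => (⟨L ω⟩ : Config S))) 𝔅 = 0 := by
    rw [Measure.prod_apply_symm h𝔅, lintegral_map (measurable_measure_prodMk_right h𝔅) hL.measurable]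
    refine lintegral_eq_zero_of_ae_eq_zero ?_
    filter_upwards [hnull] with ω hω
    rw [Measure.restrict_apply (measurable_prodMk_right h𝔅)]
    refine measure_mono_null ?_ hω
    exact fun p hp => ⟨hp.2, hp.1⟩
  rw [h3, lintegral_eq_zero_iff' h1] at h2
  filter_upwards [h2] with ω hω p hp hpW hmem
  have : (markedPoints W 𝔅 (L ω)).encard = 0 := by simpa using hω
  exact (encard_eq_zero.1 this).subset ⟨⟨hp, hpW⟩, hmem⟩

end Mecke

end

section

/-! ### The intensity measure of the marked lines -/

instance : IsFiniteMeasure (volume.comap (Subtype.val : Ico (0 : ℝ) Real.pi → ℝ)) := by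
  refine ⟨?_⟩
  rw [(MeasurableEmbedding.subtype_coe measurableSet_Ico).comap_apply, image_univ,
    Subtype.range_coe, Real.volume_Ico]
  exact ENNReal.ofReal_lt_top

instance : SFinite lineMeasure := by unfold lineMeasure; infer_instance

instance (γ : ℝ) : SFinite (speedMeasure γ) := by unfold speedMeasure; infer_instance

@[simp]
theorem rad_lineOfParams (z : ℝ × Ico (0 : ℝ) Real.pi) : rad (lineOfParams z) = z.1 :=
  congrArg Prod.fst (lineEquiv.symm_apply_apply z)

@[simp]
theorem ang_lineOfParams (z : ℝ × Ico (0 : ℝ) Real.pi) : ang (lineOfParams z) = z.2 :=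
  congrArg (fun z => (z.2 : ℝ)) (lineEquiv.symm_apply_apply z)

theorem measurable_lineOfParams : Measurable lineOfParams := lineEquiv.measurable

/-- The marked lines at distance at most `R` from the origin with speed-limit at least `v`. -/
def fastLines (R v : ℝ) : Set (PlanarLine × ℝ) := {q | v ≤ q.2 ∧ |rad q.1| ≤ R}

theorem measurableSet_fastLines (R v : ℝ) : MeasurableSet (fastLines R v) :=
  (measurableSet_le measurable_const measurable_snd).inter
    (measurableSet_le ((measurable_rad.comp measurable_fst).norm) measurable_const)

theorem markedLineIntensity_fastLines_lt_top {γ : ℝ} (hγ : 2 < γ) (R : ℝ) {v : ℝ} (hv : 0 < v) :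
    markedLineIntensity γ (fastLines R v) < ∞ := by
  have e : fastLines R v = {ℓ | |rad ℓ| ≤ R} ×ˢ Ici v := by
    ext q
    exact and_comm
  rw [e, markedLineIntensity, Measure.prod_prod]
  refine ENNReal.mul_lt_top ?_ ?_
  · have hm : MeasurableSet {ℓ | |rad ℓ| ≤ R} :=
      measurableSet_le measurable_rad.norm measurable_const
    rw [lineMeasure, Measure.map_apply measurable_lineOfParams hm, Measure.smul_apply]
    have e' : lineOfParams ⁻¹' {ℓ | |rad ℓ| ≤ R} = Icc (-R) R ×ˢ univ := by
      ext z
      simp [abs_le]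
    rw [e', Measure.prod_prod, smul_eq_mul]
    exact ENNReal.mul_lt_top (by simp) (ENNReal.mul_lt_top measure_Icc_lt_top (measure_lt_top _ _))
  · rw [speedMeasure, withDensity_apply _ measurableSet_Ici, Measure.restrict_restrict measurableSet_Ici]
    have h1 : IntegrableOn (fun t : ℝ => (γ - 1) * t ^ (-γ)) (Ioi (v / 2)) :=
      (integrableOn_Ioi_rpow_of_lt (by linarith) (half_pos hv)).const_mul _
    have h2 := (h1.mono_set (s := Ici v ∩ Ioi 0)
      fun t ht => (half_lt_self hv).trans_le ht.1).lintegral_lt_top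
    exact h2

/-- For fixed angle and speed, the intensity is a multiple of Lebesgue measure in the signed
distance. All null sets below are found by moving a line parallel to itself. -/
theorem markedLineIntensity_eq_zero {γ : ℝ} {A : Set (PlanarLine × ℝ)} (hA : MeasurableSet A)
    (h : ∀ (θ : Ico (0 : ℝ) Real.pi) (v : ℝ), volume {r : ℝ | (lineOfParams (r, θ), v) ∈ A} = 0) :
    markedLineIntensity γ A = 0 := by
  rw [markedLineIntensity, Measure.prod_apply_symm hA]
  refine lintegral_eq_zero_of_ae_eq_zero (Eventually.of_forall fun v => ?_)
  have hAv : MeasurableSet ((fun ℓ => (ℓ, v)) ⁻¹' A) := measurable_prodMk_right hA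
  change lineMeasure _ = 0
  rw [lineMeasure, Measure.map_apply measurable_lineOfParams hAv, Measure.smul_apply,
    Measure.prod_apply_symm (measurable_lineOfParams hAv)]
  have h0 := lintegral_eq_zero_of_ae_eq_zero
    (μ := volume.comap (Subtype.val : Ico (0 : ℝ) Real.pi → ℝ)) (Eventually.of_forall fun θ => h θ v)
  exact (congrArg _ h0).trans (smul_zero _)

theorem markedLineIntensity_rad_eq (γ ρ : ℝ) :
    markedLineIntensity γ {p | rad p.1 = ρ} = 0 := by
  refine markedLineIntensity_eq_zero
    (measurableSet_eq_fun (measurable_rad.comp measurable_fst) measurable_const) fun θ v => ?_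
  simp

theorem markedLineIntensity_mem (γ : ℝ) (x : Plane) :
    markedLineIntensity γ {p | x ∈ p.1} = 0 := by
  refine markedLineIntensity_eq_zero ?_ fun θ v => ?_
  · have e : {p : PlanarLine × ℝ | x ∈ p.1} = {p | lineDist p.1 x = 0} := by
      ext p
      simp only [mem_ofPred_eq, mem_line_iff, lineDist, abs_eq_zero, sub_eq_zero]
    rw [e]
    exact measurableSet_eq_fun ((measurable_lineDist x).comp measurable_fst) measurable_const
  · refine measure_mono_null (t := {nrm θ x}) (fun r hr => ?_) (by simp)
    exact (mem_lineOfParams.1 hr).symm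

theorem markedLineIntensity_speed_nonpos (γ : ℝ) :
    markedLineIntensity γ {p | p.2 ≤ 0} = 0 := by
  have e : {p : PlanarLine × ℝ | p.2 ≤ 0} = univ ×ˢ Iic 0 := by ext p; simp
  rw [e, markedLineIntensity, Measure.prod_prod]
  have : speedMeasure γ (Iic 0) = 0 := by
    rw [speedMeasure, withDensity_apply _ measurableSet_Iic, Measure.restrict_restrict measurableSet_Iic,
      Iic_inter_Ioi, Ioc_self, Measure.restrict_empty, lintegral_zero_measure]
  rw [this, mul_zero]

/-! ### Almost sure properties of the line process -/

/-- An increasing sequence of sets that exhausts the marked lines of positive speed-limit. -/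
def window (k : ℕ) : Set (PlanarLine × ℝ) := fastLines k (1 / ((k : ℝ) + 1))

theorem measurableSet_window (k : ℕ) : MeasurableSet (window k) := measurableSet_fastLines _ _

theorem markedLineIntensity_window_ne_top {γ : ℝ} (hγ : 2 < γ) (k : ℕ) :
    markedLineIntensity γ (window k) ≠ ∞ :=
  (markedLineIntensity_fastLines_lt_top hγ _ (by positivity)).ne

theorem eventually_mem_window {p : PlanarLine × ℝ} (hp : 0 < p.2) : ∀ᶠ k in atTop, p ∈ window k := by
  filter_upwards [tendsto_one_div_add_atTop_nhds_zero_nat.eventually_le_const hp,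
    tendsto_natCast_atTop_atTop.eventually_ge_atTop |rad p.1|] with k h1 h2 using ⟨h1, h2⟩

theorem exists_nonpos_of_forall_exists_lt {α : Type*} {s : Set α} (hs : s.Finite) {f : α → ℝ}
    {c : ℕ → ℝ} (hc : Tendsto c atTop (𝓝 0)) (h : ∀ n, ∃ a ∈ s, f a < c n) : ∃ a ∈ s, f a ≤ 0 := by
  by_contra! hpos
  have h1 : ∀ᶠ n in atTop, ∀ a ∈ s, c n ≤ f a :=
    (eventually_all_finite hs).2 fun a ha => hc.eventually_le_const (hpos a ha)
  obtain ⟨n, hn⟩ := h1.exists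
  obtain ⟨a, ha, hlt⟩ := h n
  exact (hn a ha).not_gt hlt

variable {Ω : Type*} [MeasurableSpace Ω] {P : Measure Ω} {γ : ℝ} {L : Ω → Set (PlanarLine × ℝ)}

theorem ae_speed_pos (hL : IsPoissonProcess (markedLineIntensity γ) P L) :
    ∀ᵐ ω ∂P, ∀ p ∈ L ω, 0 < p.2 := by
  have hB : MeasurableSet {p : PlanarLine × ℝ | p.2 ≤ 0} :=
    measurableSet_le measurable_snd measurable_const
  have h0 := markedLineIntensity_speed_nonpos γ
  have h1 := hL.lintegral_encard hB (by rw [h0]; exact ENNReal.zero_ne_top)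
  have h2 := (lintegral_eq_zero_iff ((Measurable.of_discrete (f := fun n : ℕ∞ => (n : ℝ≥0∞))).comp
    (hL.measurable_count _ hB))).1 (h1.trans h0)
  filter_upwards [h2] with ω hω p hp
  have : (L ω ∩ {p | p.2 ≤ 0}).encard = 0 := by simpa using hω
  by_contra! hle
  exact (encard_eq_zero.1 this).subset ⟨hp, hle⟩

theorem ae_locallyFiniteSpeeds (hγ : 2 < γ) (hL : IsPoissonProcess (markedLineIntensity γ) P L) :
    ∀ᵐ ω ∂P, LocallyFiniteSpeeds (L ω) := by
  have h1 : ∀ᵐ ω ∂P, ∀ k : ℕ, (L ω ∩ window k).encard ≠ ⊤ := by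
    refine ae_all_iff.2 fun k => ?_
    have h2 := hL.lintegral_encard (measurableSet_window k) (markedLineIntensity_window_ne_top hγ k)
    filter_upwards [ae_lt_top ((Measurable.of_discrete (f := fun n : ℕ∞ => (n : ℝ≥0∞))).comp
      (hL.measurable_count _ (measurableSet_window k)))
      (h2.trans_ne (markedLineIntensity_window_ne_top hγ k))] with ω hω
    simpa using hω.ne
  filter_upwards [h1] with ω hω R v hv
  obtain ⟨k, hk1, hk2⟩ := ((tendsto_one_div_add_atTop_nhds_zero_nat.eventually_le_const hv).and
    (tendsto_natCast_atTop_atTop.eventually_ge_atTop R)).exists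
  refine (encard_ne_top_iff.1 (hω k)).subset ?_
  exact fun p hp => ⟨hp.1, hk1.trans hp.2.1, hp.2.2.trans hk2⟩

theorem LocallyFiniteSpeeds.finite_inter_window {E : Set (PlanarLine × ℝ)} (hE : LocallyFiniteSpeeds E)
    (k : ℕ) : (E ∩ window k).Finite :=
  (hE k (1 / ((k : ℝ) + 1)) (by positivity)).subset fun _ hp => ⟨hp.1, hp.2⟩

theorem measurableSet_config_hit {C : Set (PlanarLine × ℝ)} (hC : MeasurableSet C) :
    MeasurableSet {z : (PlanarLine × ℝ) × Config (PlanarLine × ℝ) | (z.2.carrier ∩ C).Nonempty} :=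
  measurable_snd (measurableSet_hit hC)

/-- The marked lines at the same distance from the origin as a line of the configuration in the
`k`-th window. -/
def equidistantSet (k : ℕ) : Set ((PlanarLine × ℝ) × Config (PlanarLine × ℝ)) :=
  ⋂ n : ℕ, ⋃ ρ : ℚ, {z | |rad z.1.1 - ρ| < 1 / ((n : ℝ) + 1)} ∩
    {z | (z.2.carrier ∩ (window k ∩ {q | |rad q.1 - ρ| < 1 / ((n : ℝ) + 1)})).Nonempty}

theorem measurableSet_rad_near (ρ ε : ℝ) : MeasurableSet {q : PlanarLine × ℝ | |rad q.1 - ρ| < ε} :=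
  measurableSet_lt ((measurable_rad.comp measurable_fst).sub_const ρ).norm measurable_const

/-- Passing through rational `ρ` decouples the line from the configuration: only conditions on the
line and hit events remain. -/
theorem measurableSet_equidistantSet (k : ℕ) : MeasurableSet (equidistantSet k) :=
  .iInter fun _ => .iUnion fun ρ => (measurable_fst (measurableSet_rad_near ρ _)).inter
    (measurableSet_config_hit ((measurableSet_window k).inter (measurableSet_rad_near ρ _)))

/-- Even the signed distances of two lines in a window differ almost surely: given the rest of the
process, finitely many values are forbidden, each of intensity zero. -/
theorem ae_line_ne [IsProbabilityMeasure P] (hγ : 2 < γ)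
    (hL : IsPoissonProcess (markedLineIntensity γ) P L) :
    ∀ᵐ ω ∂P, ∀ p ∈ L ω, ∀ q ∈ L ω, p ≠ q → p.1 ≠ q.1 := by
  have h1 : ∀ k, ∀ᵐ ω ∂P, ∀ p ∈ L ω, p ∈ window k →
      (p, Config.mk (L ω \ {p})) ∉ equidistantSet k := fun k => by
    refine hL.ae_forall_notMem (measurableSet_window k) (markedLineIntensity_window_ne_top hγ k)
      (measurableSet_equidistantSet k) ?_
    filter_upwards [ae_locallyFiniteSpeeds hγ hL] with ω hω
    refine measure_mono_null (t := ⋃ q ∈ L ω ∩ window k, {p | rad p.1 = rad q.1}) ?_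
      ((measure_biUnion_null_iff (hω.finite_inter_window k).countable).2
        fun q _ => markedLineIntensity_rad_eq γ _)
    rintro p ⟨-, hp⟩
    obtain ⟨q, hq, hle⟩ := exists_nonpos_of_forall_exists_lt (hω.finite_inter_window k)
      (f := fun q => |rad p.1 - rad q.1|) (c := fun n : ℕ => 2 * (1 / ((n : ℝ) + 1)))
      (by simpa using tendsto_one_div_add_atTop_nhds_zero_nat.const_mul (2 : ℝ)) fun n => by
        obtain ⟨ρ, hρ, q, hqE, hqW, hqρ⟩ := mem_iUnion.1 (mem_iInter.1 hp n)
        refine ⟨q, ⟨hqE, hqW⟩, ?_⟩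
        have := abs_sub_le (rad p.1) ρ (rad q.1)
        rw [abs_sub_comm (ρ : ℝ)] at this
        have h1 : |rad p.1 - ρ| < 1 / ((n : ℝ) + 1) := hρ
        have h2 : |rad q.1 - ρ| < 1 / ((n : ℝ) + 1) := hqρ
        linarith
    exact mem_biUnion hq (sub_eq_zero.1 (abs_nonpos_iff.1 hle))
  filter_upwards [ae_all_iff.2 h1, ae_speed_pos hL] with ω hω hpos p hp q hq hpq heq
  obtain ⟨k, hkp, hkq⟩ :=
    ((eventually_mem_window (hpos p hp)).and (eventually_mem_window (hpos q hq))).exists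
  refine hω k p hp hkp (mem_iInter.2 fun n => ?_)
  obtain ⟨ρ, hρ⟩ := exists_rat_near (rad p.1) (ε := 1 / ((n : ℝ) + 1)) (by positivity)
  refine mem_iUnion.2 ⟨ρ, hρ, q, ⟨hq, fun h => hpq h.symm⟩, hkq, ?_⟩
  change |rad q.1 - ρ| < _
  rw [← heq]
  exact hρ

/-- The marked lines that go through a common point of two lines of the configuration whose angles are
separated by `α`. -/
def tripleSet (k : ℕ) (α : ℚ) : Set ((PlanarLine × ℝ) × Config (PlanarLine × ℝ)) :=
  ⋂ n : ℕ, ⋃ i : ℕ, ⋃ _ : ‖TopologicalSpace.denseSeq Plane i‖ ≤ k,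
    {z | lineDist z.1.1 (TopologicalSpace.denseSeq Plane i) < 1 / ((n : ℝ) + 1)} ∩
    ({z | (z.2.carrier ∩ (window k ∩ {q | ang q.1 < α} ∩
      {q | lineDist q.1 (TopologicalSpace.denseSeq Plane i) < 1 / ((n : ℝ) + 1)})).Nonempty} ∩
    {z | (z.2.carrier ∩ (window k ∩ {q | α < ang q.1} ∩
      {q | lineDist q.1 (TopologicalSpace.denseSeq Plane i) < 1 / ((n : ℝ) + 1)})).Nonempty})

theorem measurableSet_lineDist_lt (x : Plane) (ε : ℝ) :
    MeasurableSet {q : PlanarLine × ℝ | lineDist q.1 x < ε} :=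
  measurableSet_lt ((measurable_lineDist x).comp measurable_fst) measurable_const

theorem measurableSet_tripleSet (k : ℕ) (α : ℚ) : MeasurableSet (tripleSet k α) := by
  have hang : Measurable fun q : PlanarLine × ℝ => ang q.1 := measurable_ang.comp measurable_fst
  refine .iInter fun n => .iUnion fun i => .iUnion fun _ =>
    (measurable_fst (measurableSet_lineDist_lt _ _)).inter
      ((measurableSet_config_hit ?_).inter (measurableSet_config_hit ?_))
  · exact ((measurableSet_window k).inter (measurableSet_lt hang measurable_const)).inter
      (measurableSet_lineDist_lt _ _)
  · exact ((measurableSet_window k).inter (measurableSet_lt measurable_const hang)).inter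
      (measurableSet_lineDist_lt _ _)

theorem continuous_lineDist (ℓ : PlanarLine) : Continuous (lineDist ℓ) :=
  ((continuous_nrm _).sub continuous_const).abs

theorem lineDist_nonneg (ℓ : PlanarLine) (x : Plane) : 0 ≤ lineDist ℓ x := abs_nonneg _

theorem mem_of_lineDist_nonpos {ℓ : PlanarLine} {x : Plane} (h : lineDist ℓ x ≤ 0) : x ∈ ℓ :=
  mem_line_iff.2 (sub_eq_zero.1 (abs_nonpos_iff.1 h))

theorem exists_common_point_of_mem_tripleSet {k : ℕ} {α : ℚ} {p : PlanarLine × ℝ}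
    {E : Set (PlanarLine × ℝ)} (hE : LocallyFiniteSpeeds E) (h : (p, Config.mk E) ∈ tripleSet k α) :
    ∃ q ∈ E ∩ window k, ∃ r ∈ E ∩ window k, q.1 ≠ r.1 ∧ ∃ x, x ∈ p.1 ∧ x ∈ q.1 ∧ x ∈ r.1 := by
  have hcont : ∀ z : (PlanarLine × ℝ) × (PlanarLine × ℝ), Continuous fun x =>
      lineDist p.1 x + lineDist z.1.1 x + lineDist z.2.1 x := fun z =>
    ((continuous_lineDist _).add (continuous_lineDist _)).add (continuous_lineDist _)
  -- A minimiser is fixed for each pair of lines. As the window leaves finitely many pairs, a single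
  -- pair has minima below every bound, and its minimiser is a common point.
  have hmin : ∀ z : (PlanarLine × ℝ) × (PlanarLine × ℝ), ∃ x : Plane, ∀ y : Plane, ‖y‖ ≤ k →
      lineDist p.1 x + lineDist z.1.1 x + lineDist z.2.1 x ≤
        lineDist p.1 y + lineDist z.1.1 y + lineDist z.2.1 y := fun z => by
    obtain ⟨x, -, hx⟩ := (isCompact_closedBall (0 : Plane) k).exists_isMinOn
      ⟨0, by simp⟩ (hcont z).continuousOn
    exact ⟨x, fun y hy => hx (by simpa using hy)⟩
  choose x hx using hmin
  have hfin : {z : (PlanarLine × ℝ) × (PlanarLine × ℝ) | z ∈ (E ∩ window k) ×ˢ (E ∩ window k) ∧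
      ang z.1.1 < α ∧ (α : ℝ) < ang z.2.1}.Finite :=
    ((hE.finite_inter_window k).prod (hE.finite_inter_window k)).subset fun _ hz => hz.1
  obtain ⟨z, ⟨⟨hz1, hz2⟩, hz3, hz4⟩, hle⟩ := exists_nonpos_of_forall_exists_lt hfin
    (f := fun z => lineDist p.1 (x z) + lineDist z.1.1 (x z) + lineDist z.2.1 (x z))
    (c := fun n : ℕ => 3 * (1 / ((n : ℝ) + 1)))
    (by simpa using tendsto_one_div_add_atTop_nhds_zero_nat.const_mul (3 : ℝ)) fun n => by
      have := mem_iInter.1 h n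
      simp only [mem_iUnion] at this
      obtain ⟨i, hi, h1, ⟨q, hqE, ⟨hqW, hqα⟩, hqx⟩, ⟨r, hrE, ⟨hrW, hrα⟩, hrx⟩⟩ := this
      refine ⟨(q, r), ⟨⟨⟨hqE, hqW⟩, ⟨hrE, hrW⟩⟩, hqα, hrα⟩, (hx (q, r) _ hi).trans_lt ?_⟩
      simp only [mem_ofPred_eq] at h1 hqx hrx
      linarith
  have n1 := lineDist_nonneg p.1 (x z)
  have n2 := lineDist_nonneg z.1.1 (x z)
  have n3 := lineDist_nonneg z.2.1 (x z)
  refine ⟨z.1, hz1, z.2, hz2, fun heq => ?_, x z, mem_of_lineDist_nonpos (by linarith),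
    mem_of_lineDist_nonpos (by linarith), mem_of_lineDist_nonpos (by linarith)⟩
  rw [heq] at hz3
  linarith

/-- Lines through the crossing of two given lines have intensity zero. A rational number between the
angles keeps two of the lines distinct in the limit; lines of equal angle with a common point
coincide. -/
theorem ae_no_triple [IsProbabilityMeasure P] (hγ : 2 < γ)
    (hL : IsPoissonProcess (markedLineIntensity γ) P L) :
    ∀ᵐ ω ∂P, ∀ p ∈ L ω, ∀ q ∈ L ω, ∀ r ∈ L ω, p ≠ q → p ≠ r → q ≠ r →
      ∀ x, x ∈ p.1 → x ∈ q.1 → x ∉ r.1 := by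
  have h1 : ∀ k α, ∀ᵐ ω ∂P, ∀ p ∈ L ω, p ∈ window k →
      (p, Config.mk (L ω \ {p})) ∉ tripleSet k α := fun k α => by
    refine hL.ae_forall_notMem (measurableSet_window k) (markedLineIntensity_window_ne_top hγ k)
      (measurableSet_tripleSet k α) ?_
    filter_upwards [ae_locallyFiniteSpeeds hγ hL] with ω hω
    have hcount := (hω.finite_inter_window k).countable
    refine measure_mono_null (t := ⋃ q ∈ L ω ∩ window k, ⋃ r ∈ L ω ∩ window k,
      {p | q.1 ≠ r.1 ∧ ∃ x, x ∈ p.1 ∧ x ∈ q.1 ∧ x ∈ r.1}) ?_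
      ((measure_biUnion_null_iff hcount).2 fun q _ =>
        (measure_biUnion_null_iff hcount).2 fun r _ => ?_)
    · rintro p ⟨-, hp⟩
      obtain ⟨q, hq, r, hr, h⟩ := exists_common_point_of_mem_tripleSet hω hp
      exact mem_biUnion hq (mem_biUnion hr h)
    · by_cases hx : q.1 ≠ r.1 ∧ ∃ x, x ∈ q.1 ∧ x ∈ r.1
      · obtain ⟨hne, x, hxq, hxr⟩ := hx
        refine measure_mono_null ?_ (markedLineIntensity_mem γ x)
        rintro p ⟨-, y, hyp, hyq, hyr⟩
        rwa [← eq_of_mem_lines hne hxq hxr hyq hyr] at hyp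
      · refine measure_mono_null (t := ∅) ?_ measure_empty
        rintro p ⟨hne, y, -, hyq, hyr⟩
        exact hx ⟨hne, y, hyq, hyr⟩
  filter_upwards [ae_all_iff.2 fun k => ae_all_iff.2 (h1 k), ae_speed_pos hL, ae_line_ne hγ hL] with
    ω hω hpos hne
  have key : ∀ p ∈ L ω, ∀ q ∈ L ω, ∀ r ∈ L ω, p ≠ q → p ≠ r → ang q.1 < ang r.1 →
      ∀ x, x ∈ p.1 → x ∈ q.1 → x ∉ r.1 := by
    intro p hp q hq r hr hpq hpr hlt x hxp hxq hxr
    obtain ⟨α, hα1, hα2⟩ := exists_rat_btwn hlt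
    obtain ⟨k, hkp, hkq, hkr, hkx⟩ := ((eventually_mem_window (hpos p hp)).and
      ((eventually_mem_window (hpos q hq)).and ((eventually_mem_window (hpos r hr)).and
        ((tendsto_natCast_atTop_atTop (R := ℝ)).eventually_gt_atTop ‖x‖)))).exists
    refine hω k α p hp hkp (mem_iInter.2 fun n => ?_)
    have hopen : IsOpen ({y : Plane | ‖y‖ < k} ∩ Metric.ball x (1 / ((n : ℝ) + 1))) :=
      (isOpen_lt continuous_norm continuous_const).inter Metric.isOpen_ball
    obtain ⟨i, hi1, hi2⟩ := (TopologicalSpace.denseRange_denseSeq Plane).exists_mem_open hopen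
      ⟨x, hkx, Metric.mem_ball_self (by positivity)⟩
    have hd : ∀ ℓ : PlanarLine, x ∈ ℓ →
        lineDist ℓ (TopologicalSpace.denseSeq Plane i) < 1 / ((n : ℝ) + 1) := fun ℓ hℓ =>
      (lineDist_le_dist hℓ).trans_lt hi2
    simp only [mem_iUnion]
    exact ⟨i, le_of_lt hi1, hd _ hxp, ⟨q, ⟨hq, fun h => hpq h.symm⟩, ⟨hkq, hα1⟩, hd _ hxq⟩,
      ⟨r, ⟨hr, fun h => hpr h.symm⟩, ⟨hkr, hα2⟩, hd _ hxr⟩⟩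
  intro p hp q hq r hr hpq hpr hqr x hxp hxq hxr
  rcases lt_trichotomy (ang q.1) (ang r.1) with hlt | heq | hlt
  · exact key p hp q hq r hr hpq hpr hlt x hxp hxq hxr
  · refine hne q hq r hr hqr (line_ext ?_ heq)
    rw [← mem_line_iff.1 hxq, ← mem_line_iff.1 hxr, heq]
  · exact key p hp r hr q hq hpr hpq hlt x hxp hxr hxq

theorem ae_generic [IsProbabilityMeasure P] (hγ : 2 < γ)
    (hL : IsPoissonProcess (markedLineIntensity γ) P L) : ∀ᵐ ω ∂P, Generic (L ω) := by
  filter_upwards [ae_speed_pos hL, ae_locallyFiniteSpeeds hγ hL, ae_line_ne hγ hL,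
    ae_no_triple hγ hL] with ω h1 h2 h3 h4 using ⟨h1, h2, h3, h4⟩

end

section

/-! ### Travel costs are almost surely not steep at the lines of the process -/

theorem measurableSet_boxSet (b : (ℚ × ℚ) × (ℚ × ℚ) × (ℚ × ℚ)) : MeasurableSet (boxSet b) :=
  ((measurable_rad.comp measurable_fst) measurableSet_Ioo).inter
    (((measurable_ang.comp measurable_fst) measurableSet_Ioo).inter (measurable_snd measurableSet_Ioo))

theorem measurableSet_admissible {C : Set (PlanarLine × ℝ)} (hC : MeasurableSet C) (i : Fin 2) (ρ : ℝ)
    (c : Plane) (R ε : ℝ) (N m : ℕ) (x : ℕ → Plane) :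
    MeasurableSet {E : Config (PlanarLine × ℝ) | Admissible C i ρ c R ε E.carrier N m x} := by
  have e : {E : Config (PlanarLine × ℝ) | Admissible C i ρ c R ε E.carrier N m x} =
      {_E | |x 0 i - ρ| < ε} ∩
      ({E | (E.carrier ∩ (C ∩ {q | lineDist q.1 (x 0) < ε})).Nonempty} ∩
      ({_E | ∀ k ≤ m, dist (x k) c < R + ε} ∩
      ⋂ k : ℕ, ⋂ _ : k < m, ({_E | dist (x k) (x (k + 1)) * (N + 1) ≤ ε} ∪
        {E | (E.carrier ∩ ({q | dist (x k) (x (k + 1)) * (N + 1) < q.2 + ε} ∩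
          {q | lineDist q.1 (x k) < ε})).Nonempty}))) := by
    ext E
    simp only [mem_inter_iff, mem_iInter]
    exact ⟨fun ⟨h1, h2, h3, h4⟩ => ⟨h1, h2, h3, h4⟩, fun ⟨h1, h2, h3, h4⟩ => ⟨h1, h2, h3, h4⟩⟩
  rw [e]
  refine (MeasurableSet.const _).inter ((measurableSet_hit (hC.inter
    (measurableSet_lineDist_lt _ _))).inter ((MeasurableSet.const _).inter
    (.iInter fun k => .iInter fun _ => (MeasurableSet.const _).union (measurableSet_hit
      (MeasurableSet.inter ?_ (measurableSet_lineDist_lt _ _))))))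
  exact measurableSet_lt measurable_const (measurable_snd.add_const ε)

/-- The cost is a supremum of infima over countably many discrete paths, whose admissibility is a
hit event of the configuration. -/
theorem Probe.measurable_value (Q : Probe) :
    Measurable fun z : ℝ × ℝ × ℝ × Config (PlanarLine × ℝ) =>
      Q.value z.1 z.2.1 z.2.2.1 z.2.2.2.carrier := by
  unfold Probe.value
  refine .iSup fun n => .iInf fun j => ?_
  unfold Probe.cost
  refine Measurable.ite ?_ ?_ measurable_const
  · refine (MeasurableSet.const (n ≤ j.1)).inter (MeasurableSet.inter ?_ ?_)
    · exact (measurable_snd.comp (measurable_snd.comp measurable_snd))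
        (measurableSet_admissible (measurableSet_boxSet Q.box) _ _ _ _ _ _ _ _)
    · refine measurableSet_lt (measurable_fst.sub_const _) ?_
      unfold nrm
      fun_prop
  · unfold Probe.lin linearCost nrm tng
    fun_prop

/-- The marked lines at which a travel cost is steep. -/
def steepSet (Q : Probe) : Set ((PlanarLine × ℝ) × Config (PlanarLine × ℝ)) :=
  {z | IsSteep (fun r => Q.value r (ang z.1.1) z.1.2 z.2.carrier) (Q.sgn * rad z.1.1)}

theorem measurableSet_steepSet (Q : Probe) : MeasurableSet (steepSet Q) := by
  have hr : Measurable fun z : (PlanarLine × ℝ) × Config (PlanarLine × ℝ) => rad z.1.1 :=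
    measurable_rad.comp (measurable_fst.comp measurable_fst)
  have ha : Measurable fun z : (PlanarLine × ℝ) × Config (PlanarLine × ℝ) => ang z.1.1 :=
    measurable_ang.comp (measurable_fst.comp measurable_fst)
  have hV : ∀ c : ℝ, Measurable fun z : (PlanarLine × ℝ) × Config (PlanarLine × ℝ) =>
      Q.value (Q.sgn * rad z.1.1 - c) (ang z.1.1) z.1.2 z.2.carrier := fun c =>
    Q.measurable_value.comp (f := fun z : (PlanarLine × ℝ) × Config (PlanarLine × ℝ) =>
      (Q.sgn * rad z.1.1 - c, ang z.1.1, z.1.2, z.2)) (by fun_prop)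
  have hV0 := hV 0
  simp only [sub_zero] at hV0
  unfold steepSet IsSteep
  simp only [ofPred_forall, ofPred_exists]
  exact .iInter fun A => .iUnion fun N => .iInter fun k => .iInter fun _ =>
    measurableSet_le measurable_const (hV0.sub (hV _))

/-- For a frozen configuration, angle and speed, the cost is monotone in the level, so its steep
points are Lebesgue-null. Side `-1` is treated by reflecting Lebesgue measure. -/
theorem markedLineIntensity_steep (γ : ℝ) (Q : Probe) (E : Config (PlanarLine × ℝ)) :
    markedLineIntensity γ {p | (p, E) ∈ steepSet Q} = 0 := by
  refine markedLineIntensity_eq_zero (measurable_prodMk_right (measurableSet_steepSet Q))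
    fun θ v => ?_
  have h := ae_not_isSteep (Q.value_mono θ v E.carrier)
  have h' : ∀ᵐ r, ¬ IsSteep (fun r => Q.value r θ v E.carrier) (Q.sgn * r) := by
    rcases Int.units_eq_one_or Q.side with hs | hs
    · simpa [Probe.sgn, hs] using h
    · have := (Measure.measurePreserving_neg (volume : Measure ℝ)).quasiMeasurePreserving.ae h
      simpa [Probe.sgn, hs] using this
  rw [ae_iff] at h'
  simpa [steepSet] using h'

/-- The cost at `p` is computed without `p`, which is the form in which the Mecke formula applies.
-/
theorem ae_forall_not_isSteep {Ω : Type*} [MeasurableSpace Ω] {P : Measure Ω} [IsProbabilityMeasure P]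
    {γ : ℝ} (hγ : 2 < γ) {L : Ω → Set (PlanarLine × ℝ)}
    (hL : IsPoissonProcess (markedLineIntensity γ) P L) :
    ∀ᵐ ω ∂P, ∀ p ∈ L ω, ∀ Q : Probe,
      ¬ IsSteep (fun r => Q.value r (ang p.1) p.2 (L ω \ {p})) (Q.sgn * rad p.1) := by
  have h1 : ∀ (Q : Probe) (k : ℕ), ∀ᵐ ω ∂P, ∀ p ∈ L ω, p ∈ window k →
      (p, Config.mk (L ω \ {p})) ∉ steepSet Q := fun Q k =>
    hL.ae_forall_notMem (measurableSet_window k) (markedLineIntensity_window_ne_top hγ k)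
      (measurableSet_steepSet Q) (Eventually.of_forall fun ω =>
        measure_mono_null (fun _ hp => hp.2) (markedLineIntensity_steep γ Q ⟨L ω⟩))
  filter_upwards [ae_all_iff.2 fun Q => ae_all_iff.2 (h1 Q), ae_speed_pos hL] with ω hω hpos p hp Q
  obtain ⟨k, hk⟩ := (eventually_mem_window (hpos p hp)).exists
  exact hω Q k p hp hk

end

end PoissonRoads

end

/-! ### The theorem, from genericity and the absence of steep lines. -/

theorem mainTheorem11 {Ω : Type*} [MeasurableSpace Ω] (P : Measure Ω) [IsProbabilityMeasure P]
    (γ : ℝ) (hγ : 2 < γ) (L : Ω → Set (PoissonRoads.PlanarLine × ℝ))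
    (hL : PoissonRoads.IsPoissonProcess (PoissonRoads.markedLineIntensity γ) P L) :
    ∀ᵐ ω ∂P, ∀ p ∈ L ω, ∀ (T : ℝ) (ξ : ℝ → PoissonRoads.Plane),
      PoissonRoads.IsPiGeodesic (L ω) T ξ →
      ∃ (n : ℕ) (a b : Fin n → ℝ),
        (∀ i, a i ≤ b i) ∧
        {t ∈ Icc 0 T | ξ t ∈ p.1} = ⋃ i, Icc (a i) (b i) ∧
        Pairwise (fun i j => Disjoint (Icc (a i) (b i)) (Icc (a j) (b j))) ∧
        (∀ i, ξ '' Icc (a i) (b i) = segment ℝ (ξ (a i)) (ξ (b i))) ∧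
        Pairwise (fun i j =>
          Disjoint (segment ℝ (ξ (a i)) (ξ (b i))) (segment ℝ (ξ (a j)) (ξ (b j)))) ∧
        ∀ i, a i < b i →
          (0 < a i → PoissonRoads.ProperEncounter (L ω) T ξ p.1 (a i) ∧
            PoissonRoads.OnAnotherLine (L ω) p.1 (ξ (a i))) ∧
          (b i < T → PoissonRoads.ProperEncounter (L ω) T ξ p.1 (b i) ∧
            PoissonRoads.OnAnotherLine (L ω) p.1 (ξ (b i))) := by
  filter_upwards [PoissonRoads.ae_generic hγ hL, PoissonRoads.ae_forall_not_isSteep hγ hL] with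
    ω hgen hsteep p hp T ξ hξ
  refine (hξ.geodesic hgen.locallyFinite).intersection_structure hgen hp ?_
  intro η hη t ht hmem hon hslow
  obtain ⟨Q, hQ⟩ := hη.exists_isSteep hgen hp ht hmem hon hslow
  exact hsteep p hp Q hQ
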